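/- \textbf{Setting.} Let $N\simeq\mathbb Z^d$ be a lattice, $M=\mathrm{Hom}(N,\mathbb Z)$, and let $\mathcal A=\{v_1,\dots,v_k\}\subset N$ be a set of $k$ distinct elements which generates $N$ as a group and for which there is a homomorphism $\deg:N\to\mathbb Z$ with $\deg(v_i)=1$ for all $i$. Let $K=\sum_i\mathbb R_{\ge0}v_i\subset N\otimes\mathbb R$, and let $\Sigma$ be the simplicial fan with support $K$ induced by a regular triangulation of $\Delta=\mathrm{conv}(\mathcal A)$ with vertices in $\mathcal A$ (not all $v_i$ need to be vertices). For a cone $\sigma$ of $\Sigma$ let $I(\sigma)$ be the set of $i$ such that $v_i$ generates a ray of $\sigma$, and let $I(\Sigma)=\bigcup_\sigma I(\sigma)$. Let $C_\Sigma\subset\mathbb R^k$ be the open secondary cone of $\Sigma$: the set of $\omega\in\mathbb R^k$ such that for every maximal cone $\sigma$ there is a linear function $\psi$ on $N\otimes\mathbb R$ with $\psi(v_i)=\omega_i$ for $i\in I(\sigma)$ and $\psi(v_i)<\omega_i$ for $i\notin I(\sigma)$; regularity means $C_\Sigma\neq\emptyset$. For $c\in\mathbb R^k$ let $U_\Sigma=U_\Sigma(c)=\{x\in(\mathbb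 C^\times)^k:(-\log|x_i|)_i\in c+C_\Sigma\}$. \textbf{Box elements.} Let $\beta\in N\otimes\mathbb C$. Let $\mathrm{Bx}(\Sigma;\beta)$ be the set of $\alpha\in\mathbb C^k$ such that for some maximal cone $\sigma$ one has $\alpha_i=0$ for $i\notin I(\sigma)$, $0\le\mathrm{Re}\,\alpha_i<1$ for all $i$, and $\sum_i\alpha_iv_i\in N+\beta$. For $\chi\in N\otimes\mathbb R$ let $\mathrm{Box}(\Sigma;\chi)$ be the set of points of $N+\chi$ of the form $\sum_ia_iv_i$ with $a_i\in[0,1)$ and $a_i=0$ for $i\notin I(\sigma)$, for some maximal cone $\sigma$. For $\delta>0$ put $\beta_\delta=\mathrm{Re}\,\beta+\delta\,\mathrm{Im}\,\beta$, and for $\alpha\in \mathrm{Bx}(\Sigma;\beta)$ put $(\alpha_\delta)_i=\{\mathrm{Re}\,\alpha_i+\delta\,\mathrm{Im}\,\alpha_i\}$ (fractional part) and $c(\alpha_\delta)=\sum_i(\alpha_\delta)_iv_i$. Call $\delta>0$ \emph{admissible} for $\beta$ if $\alpha\mapsto c(\alpha_\delta)$ is a bijection $\mathrm{Bx}(\Sigma;\beta)\to\mathrm{Box}(\Sigma;\beta_\delta)$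 and, for all $\alpha\in\mathrm{Bx}(\Sigma;\beta)$ and all $i$, $(\alpha_\delta)_i=0$ if and only if $\alpha_i=0$. \textbf{Modules.} $R=\mathbb C[\Sigma]$ has the basis $[n]$, $n\in N\cap K$, and the product $[m][n]=[m+n]$ if some cone of $\Sigma$ contains $m$ and $n$, and $0$ otherwise. For $\chi\in N\otimes\mathbb R$ the $R$-module $\mathbb C[\Sigma;\chi]$ has the basis $[w]$, $w\in(N+\chi)\cap K$, and $[n]\cdot[w]=[n+w]$ if some cone of $\Sigma$ contains $n$ and $w$, and $0$ otherwise. For $\xi\in N\otimes\mathbb R$ the shadow module $\mathbb C[\Sigma;\chi]_\xi$ is the $R$-submodule generated by those $[w]$ with $w+\epsilon\xi\in K$ for all sufficiently small $\epsilon>0$. For a basis $g_1,\dots,g_d$ of $M$ put $Z_j=\sum_{i\in I(\Sigma)}g_j(v_i)[v_i]$. The completion ${}^\wedge$ is taken with respect to the grading by $\deg$, so its elements are arbitrary (possibly infinite) combinations of the basis elements. \textbf{$\Gamma$-series.} For $\alpha\in\mathrm{Bx}(\Sigma;\beta)$ and $v\in K\cap N$ let $L(\alpha,v)$ be the set of $l\in\mathbb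 C^k$ with $\sum_il_iv_i=\beta-v$ and $l_i-\alpha_i\in\mathbb Z$ for all $i$. Put $D_i=[v_i]$ if $i\in I(\Sigma)$ and $D_i=0$ otherwise, and, for a choice of $\arg x_i$, $$\Phi_v(x)=\sum_{\alpha\in\mathrm{Bx}(\Sigma;\beta)}\ \sum_{l\in L(\alpha,v)}\ \prod_{i=1}^k\frac{x_i^{l_i+D_i}}{\Gamma(l_i+D_i+1)}\cdot[c(\alpha_\delta)],\qquad x_i^{l_i+D_i}=e^{(l_i+D_i)(\log|x_i|+\sqrt{-1}\arg x_i)},$$ where each product stands for its Taylor series in the $D_i$. \textbf{Theorem.} There is $c\in\mathbb R^k$, depending only on $\mathcal A$ and $\Sigma$, such that $U_\Sigma=U_\Sigma(c)$ is open and non-empty and the following holds for every $\beta\in N\otimes\mathbb C$. All sufficiently small $\delta>0$ are admissible for $\beta$. Moreover, for every admissible $\delta$, every basis $g_1,\dots,g_d$ of $M$, every open $W\subseteq U_\Sigma$ and every continuous choice of $\arg x_1,\dots,\arg x_k$ on $W$: (i) for all $v\in K\cap N$ and $x\in W$, the coefficients of $\Phi_v(x)$ are given by absolutely convergent series, and $\Phi_v(x)$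 lies in the completion of $\mathbb C[\Sigma;\beta_\delta]_{\mathrm{Re}\,\beta}$; (ii) every linear map $h:\mathbb C[\Sigma;\beta_\delta]_{\mathrm{Re}\,\beta}/(Z_1,\dots,Z_d)\,\mathbb C[\Sigma;\beta_\delta]_{\mathrm{Re}\,\beta}\to\mathbb C$ vanishes on the classes of all but finitely many basis elements $[w]$ (so that $h\circ\Phi_v$ makes sense), and the functions $h\circ\Phi_v$, $v\in K\cap N$, are holomorphic on $W$ and satisfy there the better behaved GKZ equations $$\partial_i(h\circ\Phi_v)=h\circ\Phi_{v+v_i}\qquad(v\in K\cap N,\ 1\le i\le k),$$ $$\sum_{i=1}^kg(v_i)\,x_i\,\partial_i(h\circ\Phi_v)=g(\beta-v)\,(h\circ\Phi_v)\qquad(g\in M,\ v\in K\cap N).$$ -/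

import Mathlib

open scoped TensorProduct

noncomputable section

namespace BBGKZ

variable {N : Type*} [AddCommGroup N] {k : ℕ}

/-! ### The lattice `N`, its scalar extensions, and cones -/

/-- The image `1 ⊗ n` of a lattice vector in `N ⊗ 𝕜`. -/
def emb (𝕜 : Type*) [CommRing 𝕜] (n : N) : 𝕜 ⊗[ℤ] N := (1 : 𝕜) ⊗ₜ[ℤ] n

/-- The real part `N ⊗ ℂ → N ⊗ ℝ`. -/
def rePart : (ℂ ⊗[ℤ] N) →ₗ[ℤ] (ℝ ⊗[ℤ] N) :=
  LinearMap.rTensor N (Complex.reLm.restrictScalars ℤ)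

/-- The imaginary part `N ⊗ ℂ → N ⊗ ℝ`. -/
def imPart : (ℂ ⊗[ℤ] N) →ₗ[ℤ] (ℝ ⊗[ℤ] N) :=
  LinearMap.rTensor N (Complex.imLm.restrictScalars ℤ)

/-- The `ℂ`-linear extension `N ⊗ ℂ → ℂ` of `g ∈ M = Hom(N, ℤ)`. -/
def extC (g : N →ₗ[ℤ] ℤ) : (ℂ ⊗[ℤ] N) →ₗ[ℂ] ℂ :=
  (TensorProduct.AlgebraTensorModule.rid ℤ ℂ ℂ).toLinearMap ∘ₗ g.baseChange ℂ

/-- The cone `∑_{i ∈ I} ℝ_{≥ 0} v_i` in `N ⊗ ℝ`. -/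
def cone (v : Fin k → N) (I : Finset (Fin k)) : Set (ℝ ⊗[ℤ] N) :=
  {w | ∃ a : Fin k → ℝ, (∀ i, 0 ≤ a i) ∧ (∀ i, i ∉ I → a i = 0) ∧
    w = ∑ i, a i • emb ℝ (v i)}

/-- The cone `K` generated by all the `v_i`, that is, the cone over their convex hull. -/
def coneK (v : Fin k → N) : Set (ℝ ⊗[ℤ] N) := cone v Finset.univ

/-! ### Regular triangulations

A simplicial fan whose rays are generated by some of the `v_i` is recorded by the set `T` of the
index sets `I(σ)` of its cones `σ`. -/

/-- `I` is the index set of a maximal cone. -/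
def IsMaxCone (T : Set (Finset (Fin k))) (I : Finset (Fin k)) : Prop :=
  Maximal (fun J => J ∈ T) I

/-- The open secondary cone of the fan: the height vectors `ω` whose values on the generators of
each maximal cone are interpolated by a linear function that is strictly below `ω` at all the
other `v_i`. -/
def secondaryCone (v : Fin k → N) (T : Set (Finset (Fin k))) : Set (Fin k → ℝ) :=
  {ω | ∀ I, IsMaxCone T I → ∃ ψ : (ℝ ⊗[ℤ] N) →ₗ[ℝ] ℝ,
    (∀ i ∈ I, ψ (emb ℝ (v i)) = ω i) ∧ (∀ i, i ∉ I → ψ (emb ℝ (v i)) < ω i)}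

/-- `T` is the simplicial fan with support `K` induced by a regular triangulation of the convex
hull of the `v_i` (not all of the `v_i` need to be vertices of the triangulation). -/
structure IsRegularTriangulation (v : Fin k → N) (T : Set (Finset (Fin k))) : Prop where
  face_mem : ∀ I ∈ T, ∀ J, J ⊆ I → J ∈ T
  linearIndependent : ∀ I ∈ T, LinearIndependent ℝ (fun i : I => emb ℝ (v i))
  inter : ∀ I ∈ T, ∀ J ∈ T, cone v I ∩ cone v J = cone v (I ∩ J)
  support : (⋃ I ∈ T, cone v I) = coneK v
  regular : (secondaryCone v T).Nonempty

/-! ### Box elements and the passage from `β` to `β_δ` -/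

/-- The set `Bx(Σ; β) ⊆ ℂ^k` for `β ∈ N ⊗ ℂ`. -/
def Bx (v : Fin k → N) (T : Set (Finset (Fin k))) (β : ℂ ⊗[ℤ] N) : Set (Fin k → ℂ) :=
  {α | ∃ I, IsMaxCone T I ∧ (∀ i, 0 ≤ (α i).re ∧ (α i).re < 1) ∧ (∀ i, i ∉ I → α i = 0) ∧
    ∃ n : N, emb ℂ n + β = ∑ i, α i • emb ℂ (v i)}

/-- The set `Box(Σ; χ) ⊆ N ⊗ ℝ` for `χ ∈ N ⊗ ℝ`. -/
def Box (v : Fin k → N) (T : Set (Finset (Fin k))) (χ : ℝ ⊗[ℤ] N) : Set (ℝ ⊗[ℤ] N) :=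
  {c | ∃ I, IsMaxCone T I ∧ ∃ a : Fin k → ℝ, (∀ i, 0 ≤ a i ∧ a i < 1) ∧
    (∀ i, i ∉ I → a i = 0) ∧ c = ∑ i, a i • emb ℝ (v i) ∧ ∃ n : N, c = emb ℝ n + χ}

/-- `β_δ = Re β + δ Im β`. -/
def betaDelta (β : ℂ ⊗[ℤ] N) (δ : ℝ) : ℝ ⊗[ℤ] N := rePart β + δ • imPart β

/-- `(α_δ)_i = {Re α_i + δ Im α_i}`. -/
def alphaDelta (δ : ℝ) (α : Fin k → ℂ) : Fin k → ℝ :=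
  fun i => Int.fract ((α i).re + δ * (α i).im)

/-- `c(α_δ) = ∑ (α_δ)_i v_i`. -/
def boxPoint (v : Fin k → N) (δ : ℝ) (α : Fin k → ℂ) : ℝ ⊗[ℤ] N :=
  ∑ i, alphaDelta δ α i • emb ℝ (v i)

/-- `δ > 0` is such that `α ↦ c(α_δ)` is a one-to-one correspondence between `Bx(Σ; β)` and
`Box(Σ; β_δ)` which preserves support cones. -/
structure IsAdmissible (v : Fin k → N) (T : Set (Finset (Fin k))) (β : ℂ ⊗[ℤ] N) (δ : ℝ) :
    Prop where
  pos : 0 < δ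
  bijOn : Set.BijOn (boxPoint v δ) (Bx v T β) (Box v T (betaDelta β δ))
  support_eq : ∀ α ∈ Bx v T β, ∀ i, alphaDelta δ α i = 0 ↔ α i = 0

/-! ### The deformed module `ℂ[Σ; χ]` and its shadow submodules -/

/-- The points `n + χ` of the support of the fan, with `n ∈ N`. -/
def basisSet (v : Fin k → N) (T : Set (Finset (Fin k))) (χ : ℝ ⊗[ℤ] N) : Set (ℝ ⊗[ℤ] N) :=
  {w | (∃ I ∈ T, w ∈ cone v I) ∧ ∃ n : N, w = emb ℝ n + χ}

/-- The module `ℂ[Σ; χ]`, with basis `[w]`, `w ∈ (N + χ) ∩ |Σ|`. -/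
abbrev DMod (v : Fin k → N) (T : Set (Finset (Fin k))) (χ : ℝ ⊗[ℤ] N) : Type _ :=
  basisSet v T χ →₀ ℂ

/-- The completion of the graded module `ℂ[Σ; χ]`: possibly infinite combinations of the basis
elements (each graded piece is finite dimensional). -/
abbrev DModHat (v : Fin k → N) (T : Set (Finset (Fin k))) (χ : ℝ ⊗[ℤ] N) : Type _ :=
  basisSet v T χ → ℂ

theorem cone_add {v : Fin k → N} {I : Finset (Fin k)} {x y : ℝ ⊗[ℤ] N}
    (hx : x ∈ cone v I) (hy : y ∈ cone v I) : x + y ∈ cone v I := by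
  obtain ⟨a, ha, ha', rfl⟩ := hx
  obtain ⟨b, hb, hb', rfl⟩ := hy
  refine ⟨fun i => a i + b i, fun i => add_nonneg (ha i) (hb i), fun i hi => ?_, ?_⟩
  · simp [ha' i hi, hb' i hi]
  · simp [add_smul, Finset.sum_add_distrib]

theorem basisSet_add {v : Fin k → N} {T : Set (Finset (Fin k))} {χ w : ℝ ⊗[ℤ] N} {n : N}
    (hw : w ∈ basisSet v T χ) (h : ∃ I ∈ T, emb ℝ n ∈ cone v I ∧ w ∈ cone v I) :
    emb ℝ n + w ∈ basisSet v T χ := by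
  obtain ⟨I, hI, hn, hw'⟩ := h
  obtain ⟨-, m, rfl⟩ := hw
  refine ⟨⟨I, hI, cone_add hn hw'⟩, n + m, ?_⟩
  simp [emb, TensorProduct.tmul_add, add_assoc]

open Classical in
/-- Multiplication by the basis element `[n]` of the ring `R = ℂ[Σ]` on `ℂ[Σ; χ]`:
`[n] · [w] = [n + w]` if some cone of the fan contains both `n` and `w`, and `0` otherwise. -/
def mulBasis (v : Fin k → N) (T : Set (Finset (Fin k))) (χ : ℝ ⊗[ℤ] N) (n : N) :
    Module.End ℂ (DMod v T χ) :=
  Finsupp.linearCombination ℂ (fun w : basisSet v T χ =>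
    if h : ∃ I ∈ T, emb ℝ n ∈ cone v I ∧ (w : ℝ ⊗[ℤ] N) ∈ cone v I then
      Finsupp.single ⟨emb ℝ n + w, basisSet_add w.2 h⟩ (1 : ℂ)
    else 0)

/-- The shadow module `ℂ[Σ; χ]_ξ`: the `R`-submodule of `ℂ[Σ; χ]` (that is, the subspace stable
under multiplication by every `[n]`) generated by the `[w]` with `w + ε ξ ∈ |Σ|` for all
sufficiently small `ε > 0`. -/
def shadow (v : Fin k → N) (T : Set (Finset (Fin k))) (χ ξ : ℝ ⊗[ℤ] N) :
    Submodule ℂ (DMod v T χ) :=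
  sInf {P | (∀ w : basisSet v T χ,
      (∀ᶠ ε : ℝ in nhdsWithin 0 (Set.Ioi 0),
        ∃ I ∈ T, (w : ℝ ⊗[ℤ] N) + ε • ξ ∈ cone v I) → Finsupp.single w (1 : ℂ) ∈ P) ∧
    ∀ n : N, ∀ m ∈ P, mulBasis v T χ n m ∈ P}

open Classical in
/-- `D_i = [v_i]` if `v_i` generates a ray of the fan, and `D_i = 0` otherwise. -/
def opD (v : Fin k → N) (T : Set (Finset (Fin k))) (χ : ℝ ⊗[ℤ] N) (i : Fin k) :
    Module.End ℂ (DMod v T χ) :=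
  if {i} ∈ T then mulBasis v T χ (v i) else 0

/-- Multiplication by `Z_g = ∑_{i ∈ I(Σ)} g(v_i) [v_i]`. -/
def opZ (v : Fin k → N) (T : Set (Finset (Fin k))) (χ : ℝ ⊗[ℤ] N) (g : N →ₗ[ℤ] ℤ) :
    Module.End ℂ (DMod v T χ) :=
  ∑ i, ((g (v i) : ℤ) : ℂ) • opD v T χ i

instance shadowAddCommGroup (v : Fin k → N) (T : Set (Finset (Fin k))) (χ ξ : ℝ ⊗[ℤ] N) :
    AddCommGroup (shadow v T χ ξ) :=
  Submodule.addCommGroup _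

/-- `(Z_1, …, Z_d) ℂ[Σ; χ]_ξ`, as a subspace of `ℂ[Σ; χ]_ξ`. -/
def zShadow (v : Fin k → N) (T : Set (Finset (Fin k))) (χ ξ : ℝ ⊗[ℤ] N) {d : ℕ}
    (g : Fin d → (N →ₗ[ℤ] ℤ)) : Submodule ℂ (shadow v T χ ξ) :=
  (Submodule.span ℂ {y | ∃ j, ∃ m ∈ shadow v T χ ξ, y = opZ v T χ (g j) m}).submoduleOf
    (shadow v T χ ξ)

/-- The quotient `ℂ[Σ; χ]_ξ / (Z_1, …, Z_d) ℂ[Σ; χ]_ξ`. -/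
abbrev ShadowQuot (v : Fin k → N) (T : Set (Finset (Fin k))) (χ ξ : ℝ ⊗[ℤ] N) {d : ℕ}
    (g : Fin d → (N →ₗ[ℤ] ℤ)) : Type _ :=
  (shadow v T χ ξ) ⧸ zShadow v T χ ξ g

/-- The points `w` whose basis element `[w]` lies in the shadow module `ℂ[Σ; χ]_ξ`. -/
def shadowSet (v : Fin k → N) (T : Set (Finset (Fin k))) (χ ξ : ℝ ⊗[ℤ] N) :
    Set (basisSet v T χ) :=
  {w | Finsupp.single w (1 : ℂ) ∈ shadow v T χ ξ}

/-- The class of `[w]` in the quotient of the shadow module. -/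
def shadowClass (v : Fin k → N) (T : Set (Finset (Fin k))) (χ ξ : ℝ ⊗[ℤ] N) {d : ℕ}
    (g : Fin d → (N →ₗ[ℤ] ℤ)) (w : shadowSet v T χ ξ) : ShadowQuot v T χ ξ g :=
  Submodule.Quotient.mk ⟨Finsupp.single (w : basisSet v T χ) (1 : ℂ), w.2⟩

/-- The value of a linear functional `h` on an element of the completion of the shadow module:
`∑_w F_w h([w])`, which is a finite sum when `h` vanishes on all but finitely many `[w]`. -/
def applyHat (v : Fin k → N) (T : Set (Finset (Fin k))) (χ ξ : ℝ ⊗[ℤ] N) {d : ℕ}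
    (g : Fin d → (N →ₗ[ℤ] ℤ)) (h : ShadowQuot v T χ ξ g →ₗ[ℂ] ℂ) (F : DModHat v T χ) : ℂ :=
  ∑ᶠ w : shadowSet v T χ ξ, F w * h (shadowClass v T χ ξ g w)

/-! ### The `Γ`-series -/

/-- The set `L(α, u)` of the `l ∈ ℂ^k` with `∑ l_i v_i = β - u` and `l_i - α_i ∈ ℤ`. -/
def setL (v : Fin k → N) (β : ℂ ⊗[ℤ] N) (α : Fin k → ℂ) (u : N) : Set (Fin k → ℂ) :=
  {l | ∑ i, l i • emb ℂ (v i) = β - emb ℂ u ∧ ∀ i, ∃ z : ℤ, l i - α i = z}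

/-- The coefficient of `t ^ m` in the Taylor expansion at `0` of the entire function
`t ↦ x ^ (l + t) / Γ(l + t + 1)`, where `x ^ s = exp (s * y)` and `y` is a logarithm of `x`.
(`Complex.Gamma` is `0` at its poles, and so is the inverse of that, as it should be.) -/
def taylorCoeff (l y : ℂ) (m : ℕ) : ℂ :=
  iteratedDeriv m (fun t : ℂ => Complex.exp ((l + t) * y) * (Complex.Gamma (l + t + 1))⁻¹) 0 /
    (m.factorial : ℂ)

/-- The monomial `D_1 ^ m_1 ⋯ D_k ^ m_k`. -/
def monomialD (v : Fin k → N) (T : Set (Finset (Fin k))) (χ : ℝ ⊗[ℤ] N) (m : Fin k → ℕ) :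
    Module.End ℂ (DMod v T χ) :=
  (List.ofFn fun i => opD v T χ i ^ m i).prod

open Classical in
/-- The basis element `[c]`, for a point `c` (and `0` if `c` is not in `(N + χ) ∩ |Σ|`). -/
def basisElt (v : Fin k → N) (T : Set (Finset (Fin k))) (χ : ℝ ⊗[ℤ] N) (c : ℝ ⊗[ℤ] N) :
    DMod v T χ :=
  if h : c ∈ basisSet v T χ then Finsupp.single ⟨c, h⟩ (1 : ℂ) else 0

/-- The element `∏ x_i ^ (l_i + D_i) / Γ(l_i + D_i + 1) · [c]` of the completion of `ℂ[Σ; χ]`,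
where `y_i` is the chosen logarithm of `x_i`: the power series in the `D_i` is applied to `[c]`,
and only finitely many monomials contribute to the coefficient of a given `[w]`. -/
def gammaTerm (v : Fin k → N) (T : Set (Finset (Fin k))) (χ : ℝ ⊗[ℤ] N) (c : ℝ ⊗[ℤ] N)
    (l y : Fin k → ℂ) : DModHat v T χ :=
  fun w => ∑ᶠ m : Fin k → ℕ, (∏ i, taylorCoeff (l i) (y i) (m i)) *
    (monomialD v T χ m (basisElt v T χ c)) w

/-- The `Γ`-series `Φ_u`, at the point with chosen logarithms `y_i`. -/
def gammaSeries (v : Fin k → N) (T : Set (Finset (Fin k))) (β : ℂ ⊗[ℤ] N) (δ : ℝ) (u : N)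
    (y : Fin k → ℂ) : DModHat v T (betaDelta β δ) :=
  fun w => ∑ᶠ α : Bx v T β, ∑' l : setL v β α u,
    gammaTerm v T (betaDelta β δ) (boxPoint v δ α) l y w

/-- The region of the `x ∈ (ℂ^×)^k` with `(-log |x_i|)_i` in the translate by `c` of the open
secondary cone. -/
def regionU (v : Fin k → N) (T : Set (Finset (Fin k))) (c : Fin k → ℝ) : Set (Fin k → ℂ) :=
  {x | (∀ i, x i ≠ 0) ∧ (fun i => -Real.log ‖x i‖ - c i) ∈ secondaryCone v T}

/-- `θ` is a continuous choice of the arguments of the coordinates on `W`. -/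
def IsArgChoice (W : Set (Fin k → ℂ)) (θ : (Fin k → ℂ) → Fin k → ℝ) : Prop :=
  ContinuousOn θ W ∧ ∀ x ∈ W, ∀ i, x i = (‖x i‖ : ℂ) * Complex.exp (Complex.I * (θ x i : ℂ))

/-- The logarithms `log |x_i| + √-1 arg x_i` for the choice `θ` of arguments. -/
def logVec (θ : (Fin k → ℂ) → Fin k → ℝ) (x : Fin k → ℂ) : Fin k → ℂ :=
  fun i => (Real.log ‖x i‖ : ℂ) + Complex.I * (θ x i : ℂ)

/-! ### The better behaved GKZ system -/

/-- The partial derivative `∂_i F` at `x`. -/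
def partialD (i : Fin k) (F : (Fin k → ℂ) → ℂ) (x : Fin k → ℂ) : ℂ :=
  fderiv ℂ F x (Pi.single i 1)

/-- The sequence `(F_u)_{u ∈ K ∩ N}` consists of holomorphic functions on the open set `W` and
satisfies both sets of equations of the better behaved GKZ system with parameter `β` there. -/
def IsSolution (v : Fin k → N) (β : ℂ ⊗[ℤ] N) (W : Set (Fin k → ℂ))
    (F : N → (Fin k → ℂ) → ℂ) : Prop :=
  ∀ u : N, emb ℝ u ∈ coneK v →
    DifferentiableOn ℂ (F u) W ∧
    (∀ x ∈ W, ∀ i, partialD i (F u) x = F (u + v i) x) ∧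
    (∀ x ∈ W, ∀ g : N →ₗ[ℤ] ℤ,
      ∑ i, ((g (v i) : ℤ) : ℂ) * x i * partialD i (F u) x = extC g (β - emb ℂ u) * F u x)

end BBGKZ

end

/-!
Every basis element `[w]` of `ℂ[Σ; β_δ]` has a unique vector of coordinates with respect to the
generators of the smallest cone containing `w`. When `δ` is admissible, the fractional parts of
these coordinates form `α_δ` for exactly one `α ∈ Bx(Σ; β)`, and the integral parts `m_i` are the
exponents of the only monomial in the `D_i` that takes `[c(α_δ)]` to `[w]`. So the coefficient of
`[w]` in `Φ_u` is the scalar series `coeffSeries`, the sum over `l ∈ L(α, u)` of the coefficients of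
`∏ t_i ^ m_i` in `∏ x_i ^ (l_i + t_i) / Γ(l_i + t_i + 1)`
(`IsAdmissible.exists_box`, `gammaSeries_eq_coeffSeries`).

A term of this series can be nonzero only if `l_i` is a nonnegative integer whenever `α_i = 0` and
`m_i = 0`, that is, outside of the smallest cone containing `w`. This has two consequences.

* Because `Re β = u + ∑ Re l_i v_i`, one can move from `w` in the direction of `Re β` without
  leaving the fan, so `[w]` is one of the generators of the shadow module
  (`mem_shadowSet_of_gammaSeries_ne_zero`).
* Write `l = α + z` and let `I` be a maximal cone containing `w`. The degree of `∑ z_i v_i` is fixed,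
  so the Gamma factors grow at most like `B ^ ∑ |z_i|` with `B` depending only on `k`
  (`exists_bound_prod_taylorCoeff`). The `z_i` with `i ∉ I` are nonnegative and determine the others,
  so `∑ |z_i|` is bounded by a multiple of their sum, and `|x ^ l|` decays exponentially in that sum,
  at a rate that is the margin by which `-log |x_i|` satisfies the inequalities of the secondary
  cone. The translation by a large multiple `c` of a point of the secondary cone makes the decay win
  (`exists_isConvergenceShift`). The bounds are locally uniform in `log x`, so the series may be
  differentiated term by term.

Termwise, `∂_i` replaces `l` by `l - e_i`, which maps `L(α, u)` onto `L(α, u + v_i)`: this is the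
first set of equations. On the other hand `x_i ∂_i` is multiplication by `l_i + t_i`, which gives the
Euler equations up to the term `∑ g(v_i) [v_i] Φ_u = Z_g Φ_u` (`IsConvergenceShift.euler`), which a functional on the quotient
by the `Z_j` kills (`sum_defect_eq_zero`).

The sums over `[w]` are finite because the quotient lives in bounded degree: modulo the `Z_j`, a basis
element with a coordinate greater than `1` is a combination of basis elements of the same degree with
strictly larger support (`single_mem_zSpan`).
-/


noncomputable section

namespace BBGKZ

section

variable {N : Type*} [AddCommGroup N] {k : ℕ}

/-! ### Coordinates on a simplicial fan -/

/-- The point `∑ a_i v_i` of `N ⊗ ℝ`. -/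
def pt (v : Fin k → N) (a : Fin k → ℝ) : ℝ ⊗[ℤ] N := ∑ i, a i • emb ℝ (v i)

open Classical in
/-- The support of a coordinate vector. -/
def supp {R : Type*} [Zero R] (a : Fin k → R) : Finset (Fin k) :=
  Finset.univ.filter fun i => a i ≠ 0

@[simp] theorem mem_supp {R : Type*} [Zero R] {a : Fin k → R} {i : Fin k} :
    i ∈ supp a ↔ a i ≠ 0 := by simp [supp]

theorem notMem_supp {R : Type*} [Zero R] {a : Fin k → R} {i : Fin k} :
    i ∉ supp a ↔ a i = 0 := by simp

theorem pt_add (v : Fin k → N) (a b : Fin k → ℝ) : pt v (a + b) = pt v a + pt v b := by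
  simp [pt, add_smul, Finset.sum_add_distrib]

theorem pt_smul (v : Fin k → N) (r : ℝ) (a : Fin k → ℝ) : pt v (r • a) = r • pt v a := by
  simp [pt, Finset.smul_sum, smul_smul]

theorem pt_sub (v : Fin k → N) (a b : Fin k → ℝ) : pt v (a - b) = pt v a - pt v b := by
  simp [pt, sub_smul, Finset.sum_sub_distrib]

@[simp] theorem pt_single (v : Fin k → N) (i : Fin k) (r : ℝ) :
    pt v (Pi.single i r) = r • emb ℝ (v i) := by
  rw [pt, Finset.sum_eq_single i]
  · simp
  · intro j _ hj; simp [hj]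
  · simp

theorem map_pt {v : Fin k → N} (ψ : (ℝ ⊗[ℤ] N) →ₗ[ℝ] ℝ) (a : Fin k → ℝ) :
    ψ (pt v a) = ∑ i, a i * ψ (emb ℝ (v i)) := by
  simp [pt]

theorem emb_add {𝕜 : Type*} [CommRing 𝕜] (m n : N) : emb 𝕜 (m + n) = emb 𝕜 m + emb 𝕜 n :=
  TensorProduct.tmul_add _ _ _

theorem emb_zsmul {𝕜 : Type*} [CommRing 𝕜] (z : ℤ) (n : N) :
    emb 𝕜 (z • n) = (z : 𝕜) • emb 𝕜 n := by
  rw [emb, emb, TensorProduct.tmul_smul, ← Int.cast_smul_eq_zsmul 𝕜]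

theorem emb_neg {𝕜 : Type*} [CommRing 𝕜] (n : N) : emb 𝕜 (-n) = -emb 𝕜 n :=
  TensorProduct.tmul_neg _ _

theorem emb_sub {𝕜 : Type*} [CommRing 𝕜] (m n : N) : emb 𝕜 (m - n) = emb 𝕜 m - emb 𝕜 n :=
  TensorProduct.tmul_sub _ _ _

theorem emb_sum {𝕜 : Type*} [CommRing 𝕜] {ι : Type*} (s : Finset ι) (f : ι → N) :
    emb 𝕜 (∑ i ∈ s, f i) = ∑ i ∈ s, emb 𝕜 (f i) :=
  TensorProduct.tmul_sum _ _ _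

theorem pt_intCast (v : Fin k → N) (z : Fin k → ℤ) :
    pt v (fun i => (z i : ℝ)) = emb ℝ (∑ i, z i • v i) := by
  simp [pt, emb_sum, emb_zsmul]

/-- `a` is the vector of coordinates of a point of the fan with respect to the generators of the
smallest cone that contains the point. -/
structure IsFanCoord (T : Set (Finset (Fin k))) (a : Fin k → ℝ) : Prop where
  nonneg : ∀ i, 0 ≤ a i
  supp_mem : supp a ∈ T

theorem mem_cone_iff {v : Fin k → N} {I : Finset (Fin k)} {w : ℝ ⊗[ℤ] N} :
    w ∈ cone v I ↔ ∃ a : Fin k → ℝ, (∀ i, 0 ≤ a i) ∧ supp a ⊆ I ∧ w = pt v a := by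
  constructor
  · rintro ⟨a, h0, h1, rfl⟩
    refine ⟨a, h0, fun i hi => ?_, rfl⟩
    by_contra h
    exact (mem_supp.1 hi) (h1 i h)
  · rintro ⟨a, h0, h1, rfl⟩
    exact ⟨a, h0, fun i hi => notMem_supp.1 fun h => hi (h1 h), rfl⟩

theorem mem_coneK_iff {v : Fin k → N} {w : ℝ ⊗[ℤ] N} :
    w ∈ coneK v ↔ ∃ a : Fin k → ℝ, (∀ i, 0 ≤ a i) ∧ w = pt v a := by
  simp [coneK, mem_cone_iff]

theorem pt_mem_coneK {v : Fin k → N} {a : Fin k → ℝ} (ha : ∀ i, 0 ≤ a i) :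
    pt v a ∈ coneK v := mem_coneK_iff.2 ⟨a, ha, rfl⟩

theorem smul_mem_coneK {v : Fin k → N} {w : ℝ ⊗[ℤ] N} {t : ℝ} (ht : 0 ≤ t)
    (hw : w ∈ coneK v) : t • w ∈ coneK v := by
  obtain ⟨a, ha, rfl⟩ := mem_coneK_iff.1 hw
  rw [← pt_smul]
  exact pt_mem_coneK fun i => mul_nonneg ht (ha i)

theorem supp_add_of_nonneg {a b : Fin k → ℝ} (ha : ∀ i, 0 ≤ a i) (hb : ∀ i, 0 ≤ b i) :
    supp (a + b) = supp a ∪ supp b := by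
  ext i
  have h1 := ha i
  have h2 := hb i
  simp only [mem_supp, Pi.add_apply, Finset.mem_union]
  rw [← not_and_or, not_iff_not]
  constructor
  · intro h; constructor <;> linarith
  · rintro ⟨h, h'⟩; rw [h, h', add_zero]

section Fan

variable {v : Fin k → N} {T : Set (Finset (Fin k))}

theorem IsRegularTriangulation.eq_of_pt_eq (hT : IsRegularTriangulation v T)
    {I : Finset (Fin k)} (hI : I ∈ T) {a b : Fin k → ℝ} (ha : supp a ⊆ I) (hb : supp b ⊆ I)
    (h : pt v a = pt v b) : a = b := by
  have hli := Fintype.linearIndependent_iff.1 (hT.linearIndependent I hI) (fun i => a i - b i) ?_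
  · funext i
    by_cases hi : i ∈ I
    · exact sub_eq_zero.1 (hli ⟨i, hi⟩)
    · rw [notMem_supp.1 fun h => hi (ha h), notMem_supp.1 fun h => hi (hb h)]
  · rw [Finset.sum_coe_sort I (fun i => (a i - b i) • emb ℝ (v i)),
      Finset.sum_subset (Finset.subset_univ I)]
    · have := sub_eq_zero.2 h
      rwa [← pt_sub] at this
    · intro i _ hi
      rw [notMem_supp.1 fun h => hi (ha h), notMem_supp.1 fun h => hi (hb h)]
      simp

/-- Coordinates on the fan are unique: two cones meet in their common face. -/
theorem IsRegularTriangulation.fanCoord_unique (hT : IsRegularTriangulation v T)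
    {a b : Fin k → ℝ} (ha : IsFanCoord T a) (hb : IsFanCoord T b) (h : pt v a = pt v b) :
    a = b := by
  have h1 : pt v a ∈ cone v (supp a) ∩ cone v (supp b) :=
    ⟨mem_cone_iff.2 ⟨a, ha.nonneg, subset_rfl, rfl⟩,
      mem_cone_iff.2 ⟨b, hb.nonneg, subset_rfl, h⟩⟩
  rw [hT.inter _ ha.supp_mem _ hb.supp_mem] at h1
  obtain ⟨c, -, hc, hac⟩ := mem_cone_iff.1 h1
  rw [hT.eq_of_pt_eq ha.supp_mem subset_rfl (hc.trans Finset.inter_subset_left) hac]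
  exact (hT.eq_of_pt_eq hb.supp_mem subset_rfl (hc.trans Finset.inter_subset_right)
    (h.symm.trans hac)).symm

theorem IsRegularTriangulation.isFanCoord (hT : IsRegularTriangulation v T)
    {a : Fin k → ℝ} (ha : ∀ i, 0 ≤ a i) {I : Finset (Fin k)} (hI : I ∈ T) (hs : supp a ⊆ I) :
    IsFanCoord T a := ⟨ha, hT.face_mem I hI _ hs⟩

theorem IsRegularTriangulation.exists_fanCoord (hT : IsRegularTriangulation v T)
    {w : ℝ ⊗[ℤ] N} (hw : ∃ I ∈ T, w ∈ cone v I) : ∃ a, IsFanCoord T a ∧ w = pt v a := by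
  obtain ⟨I, hI, hw⟩ := hw
  obtain ⟨a, ha, hs, rfl⟩ := mem_cone_iff.1 hw
  exact ⟨a, hT.isFanCoord ha hI hs, rfl⟩

theorem IsRegularTriangulation.mem_coneK (hT : IsRegularTriangulation v T) {w : ℝ ⊗[ℤ] N} :
    w ∈ coneK v ↔ ∃ I ∈ T, w ∈ cone v I := by
  rw [← hT.support]; simp

theorem IsFanCoord.exists_cone {a : Fin k → ℝ} (ha : IsFanCoord T a) :
    ∃ I ∈ T, pt v a ∈ cone v I :=
  ⟨supp a, ha.supp_mem, mem_cone_iff.2 ⟨a, ha.nonneg, subset_rfl, rfl⟩⟩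

theorem exists_isMaxCone {J : Finset (Fin k)} (hJ : J ∈ T) : ∃ I, IsMaxCone T I ∧ J ⊆ I := by
  obtain ⟨I, h1, h2⟩ := Set.Finite.exists_le_maximal (Set.toFinite T) hJ
  exact ⟨I, h2, h1⟩

/-- A segment starting in the relative interior of a maximal cone and pointing towards another
generator stays, for short times, in a single cone of the fan, which has to be the maximal cone
itself. So the generators of a maximal cone span all the `v_j`. -/
theorem IsRegularTriangulation.exists_coord_generator (hT : IsRegularTriangulation v T)
    {I : Finset (Fin k)} (hI : IsMaxCone T I) (j : Fin k) :
    ∃ q : Fin k → ℝ, supp q ⊆ I ∧ emb ℝ (v j) = pt v q := by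
  classical
  set e : Fin k → ℝ := fun i => if i ∈ I then 1 else 0 with he
  have hes : supp e = I := by ext i; simp [he]
  have key : ∀ n : ℕ, ∃ J ∈ T, ∃ a : Fin k → ℝ, (∀ i, 0 ≤ a i) ∧ supp a ⊆ J ∧
      pt v e + (1 / ((n : ℝ) + 1)) • emb ℝ (v j) = pt v a := by
    intro n
    have : pt v e + (1 / ((n : ℝ) + 1)) • emb ℝ (v j) ∈ coneK v := by
      rw [← pt_single, ← pt_add]
      refine pt_mem_coneK fun i => add_nonneg ?_ ?_
      · simp only [he]; split_ifs <;> norm_num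
      · exact (Pi.single_nonneg.2 (by positivity) : (0 : Fin k → ℝ) ≤ _) i
    obtain ⟨J, hJ, hw⟩ := hT.mem_coneK.1 this
    obtain ⟨a, h1, h2, h3⟩ := mem_cone_iff.1 hw
    exact ⟨J, hJ, a, h1, h2, h3⟩
  choose J hJ a ha0 hasupp hapt using key
  obtain ⟨J0, hinf⟩ := Finite.exists_infinite_fiber J
  have hinf' : (J ⁻¹' {J0}).Infinite := Set.infinite_coe_iff.1 hinf
  obtain ⟨n1, hn1⟩ := hinf'.nonempty
  obtain ⟨n2, hn2, hlt⟩ := hinf'.exists_gt n1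
  have hJ0 : J0 ∈ T := by rw [← (hn1 : J n1 = J0)]; exact hJ n1
  have hsub : ∀ n ∈ J ⁻¹' {J0}, supp (a n) ⊆ J0 := fun n hn => by
    rw [← (hn : J n = J0)]; exact hasupp n
  have hε : (1 / ((n1 : ℝ) + 1)) - 1 / ((n2 : ℝ) + 1) ≠ 0 := by
    have : (n1 : ℝ) < n2 := by exact_mod_cast hlt
    have : 1 / ((n2 : ℝ) + 1) < 1 / ((n1 : ℝ) + 1) := by
      apply one_div_lt_one_div_of_lt <;> [positivity; linarith]
    linarith
  set q : Fin k → ℝ := ((1 / ((n1 : ℝ) + 1)) - 1 / ((n2 : ℝ) + 1))⁻¹ • (a n1 - a n2) with hq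
  have hqs : supp q ⊆ J0 := by
    intro i hi
    by_contra h
    apply mem_supp.1 hi
    simp [hq, notMem_supp.1 fun h' => h (hsub _ hn1 h'), notMem_supp.1 fun h' => h (hsub _ hn2 h')]
  have hqpt : emb ℝ (v j) = pt v q := by
    rw [hq, pt_smul, pt_sub, ← hapt, ← hapt, add_sub_add_left_eq_sub, ← sub_smul, smul_smul,
      inv_mul_cancel₀ hε, one_smul]
  set r : Fin k → ℝ := a n1 - (1 / ((n1 : ℝ) + 1)) • q with hr
  have hrs : supp r ⊆ J0 := by
    intro i hi
    by_contra h
    apply mem_supp.1 hi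
    simp [hr, notMem_supp.1 fun h' => h (hsub _ hn1 h'), notMem_supp.1 fun h' => h (hqs h')]
  have hrpt : pt v e = pt v r := by
    rw [hr, pt_sub, pt_smul, ← hqpt, ← hapt, add_sub_cancel_right]
  have hline : ∀ n ∈ J ⁻¹' {J0}, a n = r + (1 / ((n : ℝ) + 1)) • q := by
    intro n hn
    apply hT.eq_of_pt_eq hJ0 (hsub n hn)
    · intro i hi
      by_contra h
      apply mem_supp.1 hi
      simp [notMem_supp.1 fun h' => h (hrs h'), notMem_supp.1 fun h' => h (hqs h')]
    · rw [← hapt, pt_add, pt_smul, ← hrpt, ← hqpt]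
  have hr0 : ∀ i, 0 ≤ r i := by
    intro i
    by_contra! hneg
    obtain ⟨m, hm⟩ := exists_nat_gt (|q i| / (-r i))
    obtain ⟨n, hn, hmn⟩ := hinf'.exists_gt m
    have h1 := ha0 n i
    rw [hline n hn] at h1
    simp only [Pi.add_apply, Pi.smul_apply, smul_eq_mul] at h1
    have hn' : (m : ℝ) < n := by exact_mod_cast hmn
    have h2 : |q i| < ((n : ℝ) + 1) * (-r i) := by
      have := (div_lt_iff₀ (by linarith : 0 < -r i)).1 (hm.trans (hn'.trans (lt_add_one _)))
      exact this
    have h3 : (1 / ((n : ℝ) + 1)) * q i ≤ (1 / ((n : ℝ) + 1)) * |q i| :=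
      mul_le_mul_of_nonneg_left (le_abs_self _) (by positivity)
    have h4 : (1 / ((n : ℝ) + 1)) * |q i| < -r i := by
      rw [one_div, inv_mul_lt_iff₀ (by positivity)]; exact h2
    linarith
  have heq : e = r := hT.fanCoord_unique ⟨fun i => by simp only [he]; split_ifs <;> norm_num,
    by rw [hes]; exact hI.prop⟩ (hT.isFanCoord hr0 hJ0 hrs) hrpt
  have hIJ : I = J0 := hI.eq_of_le hJ0 (by rw [← hes, heq]; exact hrs)
  exact ⟨q, hIJ ▸ hqs, hqpt⟩

end Fan

end

section

variable {N : Type*} [AddCommGroup N] {k : ℕ}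

/-! ### Linear algebra over the real and complex extensions of the lattice -/

theorem rePart_smul_emb (a : ℂ) (n : N) : rePart (a • emb ℂ n) = a.re • emb ℝ n := by
  simp only [emb, TensorProduct.smul_tmul', smul_eq_mul, mul_one]
  rfl

theorem imPart_smul_emb (a : ℂ) (n : N) : imPart (a • emb ℂ n) = a.im • emb ℝ n := by
  simp only [emb, TensorProduct.smul_tmul', smul_eq_mul, mul_one]
  rfl

theorem rePart_emb (n : N) : rePart (emb ℂ n) = emb ℝ n := by
  simpa using rePart_smul_emb 1 n

theorem imPart_emb (n : N) : imPart (emb ℂ n) = 0 := by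
  simpa using imPart_smul_emb 1 n

theorem rePart_sum_smul (v : Fin k → N) (α : Fin k → ℂ) :
    rePart (∑ i, α i • emb ℂ (v i)) = pt v fun i => (α i).re := by
  simp [rePart_smul_emb, pt]

theorem imPart_sum_smul (v : Fin k → N) (α : Fin k → ℂ) :
    imPart (∑ i, α i • emb ℂ (v i)) = pt v fun i => (α i).im := by
  simp [imPart_smul_emb, pt]

/-- The inclusion `N ⊗ ℝ → N ⊗ ℂ`. -/
def complexify : (ℝ ⊗[ℤ] N) →ₗ[ℤ] (ℂ ⊗[ℤ] N) :=
  LinearMap.rTensor N (Complex.ofRealCLM.toLinearMap.restrictScalars ℤ)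

theorem complexify_smul_emb (r : ℝ) (n : N) :
    complexify (r • emb ℝ n) = (r : ℂ) • emb ℂ n := by
  simp only [emb, TensorProduct.smul_tmul', smul_eq_mul, mul_one]
  rfl

theorem rePart_complexify (w : ℝ ⊗[ℤ] N) : rePart (complexify w) = w := by
  induction w using TensorProduct.induction_on with
  | zero => simp
  | tmul c n => rfl
  | add x y hx hy => rw [map_add, map_add, hx, hy]

/-- The `ℝ`-linear extension `N ⊗ ℝ → ℝ` of `g ∈ M = Hom(N, ℤ)`. -/
def extR (g : N →ₗ[ℤ] ℤ) : (ℝ ⊗[ℤ] N) →ₗ[ℝ] ℝ :=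
  (TensorProduct.AlgebraTensorModule.rid ℤ ℝ ℝ).toLinearMap ∘ₗ g.baseChange ℝ

@[simp] theorem extR_emb (g : N →ₗ[ℤ] ℤ) (n : N) : extR g (emb ℝ n) = g n := by
  simp [extR, emb]

@[simp] theorem extC_emb (g : N →ₗ[ℤ] ℤ) (n : N) : extC g (emb ℂ n) = g n := by
  simp [extC, emb]

theorem finite_lattice_of_bounded [Module.Free ℤ N] [Module.Finite ℤ N] (S : Set N)
    (h : ∀ g : N →ₗ[ℤ] ℤ, ∃ C : ℝ, ∀ n ∈ S, |(g n : ℝ)| ≤ C) : S.Finite := by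
  classical
  let b := Module.Free.chooseBasis ℤ N
  choose C hC using fun j => h (b.coord j)
  have hfin : (Set.pi Set.univ fun j => Set.Icc (-⌈C j⌉) ⌈C j⌉).Finite :=
    Set.Finite.pi fun j => Set.finite_Icc _ _
  refine Set.Finite.of_finite_image (f := fun n j => b.coord j n)
    (hfin.subset ?_) ?_
  · rintro _ ⟨n, hn, rfl⟩ j -
    have := hC j n hn
    rw [Set.mem_Icc, ← abs_le, ← Int.cast_le (R := ℝ)]
    push_cast
    exact this.trans (Int.le_ceil _)
  · intro m _ n _ hmn
    refine b.ext_elem fun j => ?_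
    exact congrFun hmn j

section Fan

variable {v : Fin k → N} {T : Set (Finset (Fin k))}

theorem IsRegularTriangulation.exists_coordC (hT : IsRegularTriangulation v T)
    (hgen : AddSubgroup.closure (Set.range v) = ⊤)
    {I : Finset (Fin k)} (hI : IsMaxCone T I) (w : ℂ ⊗[ℤ] N) :
    ∃ a : Fin k → ℂ, (∀ i, i ∉ I → a i = 0) ∧ w = ∑ i, a i • emb ℂ (v i) := by
  let S : Submodule ℂ (ℂ ⊗[ℤ] N) :=
    { carrier := {w | ∃ a : Fin k → ℂ, (∀ i, i ∉ I → a i = 0) ∧ w = ∑ i, a i • emb ℂ (v i)}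
      zero_mem' := ⟨0, by simp, by simp⟩
      add_mem' := by
        rintro _ _ ⟨a, ha, rfl⟩ ⟨b, hb, rfl⟩
        exact ⟨a + b, fun i hi => by simp [ha i hi, hb i hi],
          by simp [add_smul, Finset.sum_add_distrib]⟩
      smul_mem' := by
        rintro c _ ⟨a, ha, rfl⟩
        exact ⟨c • a, fun i hi => by simp [ha i hi], by simp [Finset.smul_sum, smul_smul]⟩ }
  have hgenS : ∀ j, emb ℂ (v j) ∈ S := by
    intro j
    obtain ⟨q, hq, hqe⟩ := hT.exists_coord_generator hI j
    refine ⟨fun i => (q i : ℂ), fun i hi => ?_, ?_⟩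
    · simp [notMem_supp.1 fun h => hi (hq h)]
    · have := congrArg complexify hqe
      rw [← one_smul ℝ (emb ℝ (v j)), complexify_smul_emb] at this
      simpa [pt, complexify_smul_emb] using this
  have hlat : ∀ n : N, emb ℂ n ∈ S := by
    intro n
    have hn : n ∈ AddSubgroup.closure (Set.range v) := by rw [hgen]; trivial
    induction hn using AddSubgroup.closure_induction with
    | mem x hx => obtain ⟨j, rfl⟩ := hx; exact hgenS j
    | zero => simp [emb]
    | add x y _ _ hx hy => rw [emb_add]; exact S.add_mem hx hy
    | neg x _ hx => rw [emb_neg]; exact S.neg_mem hx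
  change w ∈ S
  induction w using TensorProduct.induction_on with
  | zero => exact S.zero_mem
  | tmul c n =>
    have : c ⊗ₜ[ℤ] n = c • emb ℂ n := by simp [emb, TensorProduct.smul_tmul']
    rw [this]; exact S.smul_mem _ (hlat n)
  | add x y hx hy => exact S.add_mem hx hy

theorem IsRegularTriangulation.exists_coord (hT : IsRegularTriangulation v T)
    (hgen : AddSubgroup.closure (Set.range v) = ⊤)
    {I : Finset (Fin k)} (hI : IsMaxCone T I) (w : ℝ ⊗[ℤ] N) :
    ∃ a : Fin k → ℝ, supp a ⊆ I ∧ w = pt v a := by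
  obtain ⟨a, ha, haw⟩ := hT.exists_coordC hgen hI (complexify w)
  refine ⟨fun i => (a i).re, fun i hi => ?_, ?_⟩
  · by_contra h
    exact mem_supp.1 hi (by simp [ha i h])
  · rw [← rePart_sum_smul, ← haw, rePart_complexify]

/-! ### Small `δ` are admissible -/

theorem alphaDelta_mem (δ : ℝ) (α : Fin k → ℂ) (i : Fin k) :
    0 ≤ alphaDelta δ α i ∧ alphaDelta δ α i < 1 := ⟨Int.fract_nonneg _, Int.fract_lt_one _⟩

theorem isFanCoord_alphaDelta (hT : IsRegularTriangulation v T) {β : ℂ ⊗[ℤ] N} (δ : ℝ)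
    {α : Fin k → ℂ} (hα : α ∈ Bx v T β) : IsFanCoord T (alphaDelta δ α) := by
  obtain ⟨I, hI, -, h0, -⟩ := hα
  refine hT.isFanCoord (fun i => (alphaDelta_mem δ α i).1) hI.prop fun i hi => ?_
  by_contra h
  exact mem_supp.1 hi (by simp [alphaDelta, h0 i h])

theorem boxPoint_eq_pt (δ : ℝ) (α : Fin k → ℂ) : boxPoint v δ α = pt v (alphaDelta δ α) := rfl

/-- Both the injectivity of `α ↦ c(α_δ)` and the preservation of supports come down to this. -/
theorem eventually_add_mul_im_ne_int {a : ℂ} (h1 : |a.re| < 1) (h0 : a ≠ 0) :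
    ∀ᶠ δ : ℝ in nhdsWithin 0 (Set.Ioi 0), ∀ n : ℤ, a.re + δ * a.im ≠ n := by
  have htend : Filter.Tendsto (fun δ : ℝ => a.re + δ * a.im) (nhdsWithin 0 (Set.Ioi 0))
      (nhds a.re) := by
    have : Filter.Tendsto (fun δ : ℝ => a.re + δ * a.im) (nhds 0) (nhds (a.re + 0 * a.im)) :=
      (Continuous.tendsto (by fun_prop) 0)
    rw [zero_mul, add_zero] at this
    exact this.mono_left nhdsWithin_le_nhds
  rw [abs_lt] at h1
  have hlt := htend.eventually (Ioo_mem_nhds h1.1 h1.2)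
  -- an integer in `(-1, 1)` is zero
  have hzero : ∀ n : ℤ, (-1 : ℝ) < n → (n : ℝ) < 1 → n = 0 := by
    intro n hn1 hn2
    have h3 : (-1 : ℤ) < n := by exact_mod_cast hn1
    have h4 : n < (1 : ℤ) := by exact_mod_cast hn2
    omega
  by_cases hre : a.re = 0
  · have him : a.im ≠ 0 := fun h => h0 (Complex.ext hre h)
    filter_upwards [hlt, self_mem_nhdsWithin] with δ hδ hpos n hn
    have := hzero n (hn ▸ hδ.1) (hn ▸ hδ.2)
    rw [this, hre, zero_add, Int.cast_zero] at hn
    exact mul_ne_zero (ne_of_gt hpos) him hn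
  · filter_upwards [hlt, htend.eventually_ne hre] with δ hδ hne n hn
    have := hzero n (hn ▸ hδ.1) (hn ▸ hδ.2)
    rw [this, Int.cast_zero] at hn
    exact hne hn

theorem finite_Bx [Module.Free ℤ N] [Module.Finite ℤ N] (hT : IsRegularTriangulation v T)
    (β : ℂ ⊗[ℤ] N) : (Bx v T β).Finite := by
  have hex : ∀ α : Bx v T β, ∃ I, IsMaxCone T I ∧ (∀ i, i ∉ I → α.1 i = 0) ∧
      ∃ n : N, emb ℂ n + β = ∑ i, α.1 i • emb ℂ (v i) :=
    fun α => let ⟨I, h1, _, h3, h4⟩ := α.2; ⟨I, h1, h3, h4⟩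
  choose I hI h0 n hn using hex
  have hfin : (Set.range n).Finite := by
    apply finite_lattice_of_bounded
    intro g
    refine ⟨∑ i, |(g (v i) : ℝ)| + |extR g (rePart β)|, ?_⟩
    rintro _ ⟨α, rfl⟩
    have h1 := congrArg (fun x => extR g (rePart x)) (hn α)
    simp only [map_add, rePart_emb, extR_emb, rePart_sum_smul, map_pt] at h1
    rw [eq_sub_of_add_eq h1]
    refine (abs_sub _ _).trans (add_le_add_left ((Finset.abs_sum_le_sum_abs _ _).trans ?_) _)
    refine Finset.sum_le_sum fun i _ => ?_
    obtain ⟨-, -, hb, -⟩ := α.2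
    rw [abs_mul, abs_of_nonneg (hb i).1]
    exact mul_le_of_le_one_left (abs_nonneg _) (hb i).2.le
  -- `α` is determined by its cone and its lattice point
  have hinj : Function.Injective fun α : Bx v T β => (I α, n α) := by
    intro α α' h
    obtain ⟨hII, hnn⟩ := Prod.mk.inj h
    have h1 : ∑ i, α.1 i • emb ℂ (v i) = ∑ i, α'.1 i • emb ℂ (v i) := by
      rw [← hn, ← hn, hnn]
    have hsub : ∀ (f : ℂ → ℝ), f 0 = 0 → supp (fun i => f (α.1 i)) ⊆ I α ∧
        supp (fun i => f (α'.1 i)) ⊆ I α := by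
      intro f hf
      constructor <;> intro i hi <;> by_contra h' <;> apply mem_supp.1 hi
      · simp [h0 α i h', hf]
      · rw [hII] at h'; simp [h0 α' i h', hf]
    have hre := hT.eq_of_pt_eq (hI α).prop (hsub Complex.re rfl).1 (hsub Complex.re rfl).2
      (by rw [← rePart_sum_smul, ← rePart_sum_smul, h1])
    have him := hT.eq_of_pt_eq (hI α).prop (hsub Complex.im rfl).1 (hsub Complex.im rfl).2
      (by rw [← imPart_sum_smul, ← imPart_sum_smul, h1])
    exact Subtype.ext (funext fun i => Complex.ext (congrFun hre i) (congrFun him i))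
  have : (Set.range fun α : Bx v T β => (I α, n α)).Finite :=
    (Set.finite_univ.prod hfin).subset (by rintro _ ⟨α, rfl⟩; exact ⟨trivial, α, rfl⟩)
  exact Set.finite_coe_iff.1 ((Set.finite_range_iff hinj).1 this)

theorem add_mem_lattice {χ w : ℝ ⊗[ℤ] N} (h : ∃ n : N, w = emb ℝ n + χ) (z : Fin k → ℤ) :
    ∃ n : N, w + pt v (fun i => (z i : ℝ)) = emb ℝ n + χ := by
  obtain ⟨n, rfl⟩ := h
  exact ⟨n + ∑ i, z i • v i, by rw [pt_intCast, emb_add]; abel⟩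

theorem betaDelta_eq {β : ℂ ⊗[ℤ] N} {α : Fin k → ℂ} {n : N}
    (h : emb ℂ n + β = ∑ i, α i • emb ℂ (v i)) (δ : ℝ) :
    emb ℝ n + betaDelta β δ = pt v fun i => (α i).re + δ * (α i).im := by
  have h1 := congrArg rePart h
  have h2 := congrArg imPart h
  rw [map_add, rePart_emb, rePart_sum_smul] at h1
  rw [map_add, imPart_emb, zero_add, imPart_sum_smul] at h2
  rw [betaDelta, ← add_assoc, h1, h2, ← pt_smul, ← pt_add]
  rfl

theorem boxPoint_mem_Box {β : ℂ ⊗[ℤ] N} (δ : ℝ) {α : Fin k → ℂ} (hα : α ∈ Bx v T β) :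
    boxPoint v δ α ∈ Box v T (betaDelta β δ) := by
  obtain ⟨I, hI, -, h0, n, hn⟩ := hα
  refine ⟨I, hI, alphaDelta δ α, alphaDelta_mem δ α, fun i hi => by simp [alphaDelta, h0 i hi],
    rfl, ?_⟩
  have := add_mem_lattice (v := v) (χ := betaDelta β δ) ⟨n, rfl⟩
    (fun i => -⌊(α i).re + δ * (α i).im⌋)
  rw [betaDelta_eq hn δ, ← pt_add] at this
  convert this using 3 with n
  rw [boxPoint_eq_pt]
  congr 1
  funext i
  simp [alphaDelta, Int.fract, sub_eq_add_neg]

/-- Surjectivity holds for every `δ`: expand `β` in the generators of the maximal cone and reduce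
the real parts of the coefficients modulo `1`. -/
theorem surjOn_boxPoint (hT : IsRegularTriangulation v T)
    (hgen : AddSubgroup.closure (Set.range v) = ⊤) (β : ℂ ⊗[ℤ] N) (δ : ℝ) :
    Set.SurjOn (boxPoint v δ) (Bx v T β) (Box v T (betaDelta β δ)) := by
  rintro _ ⟨I, hI, a, ha, ha0, rfl, n, hn⟩
  obtain ⟨b, hb, hbn⟩ := hT.exists_coordC hgen hI (emb ℂ n + β)
  have hab : a = fun i => (b i).re + δ * (b i).im := by
    refine hT.eq_of_pt_eq hI.prop (fun i hi => ?_) (fun i hi => ?_) ?_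
    · by_contra h; exact mem_supp.1 hi (ha0 i h)
    · by_contra h; exact mem_supp.1 hi (by simp [hb i h])
    · rw [← betaDelta_eq hbn δ]; exact hn
  refine ⟨fun i => b i - ((⌊(b i).re⌋ : ℤ) : ℂ), ⟨I, hI, fun i => ?_, fun i hi => ?_,
    n - ∑ i, ⌊(b i).re⌋ • v i, ?_⟩, ?_⟩
  · simp only [Complex.sub_re, Complex.intCast_re]
    exact ⟨Int.fract_nonneg _, Int.fract_lt_one _⟩
  · simp [hb i hi]
  · rw [emb_sub, sub_add_eq_add_sub, hbn]
    simp [sub_smul, Finset.sum_sub_distrib, emb_sum, emb_zsmul]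
  · rw [boxPoint_eq_pt]
    change _ = pt v a
    congr 1
    funext i
    have h1 := ha i
    simp only [alphaDelta, Complex.sub_re, Complex.intCast_re, Complex.sub_im, Complex.intCast_im,
      sub_zero]
    rw [sub_add_eq_add_sub, Int.fract_sub_intCast, ← congrFun hab i]
    exact Int.fract_eq_self.2 h1

theorem eventually_isAdmissible [Module.Free ℤ N] [Module.Finite ℤ N]
    (hT : IsRegularTriangulation v T)
    (hgen : AddSubgroup.closure (Set.range v) = ⊤) (β : ℂ ⊗[ℤ] N) :
    ∀ᶠ δ : ℝ in nhdsWithin 0 (Set.Ioi 0), IsAdmissible v T β δ := by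
  have hfin := finite_Bx hT β
  have h1 : ∀ᶠ δ : ℝ in nhdsWithin 0 (Set.Ioi 0), ∀ α ∈ Bx v T β, ∀ i, α i ≠ 0 →
      ∀ n : ℤ, (α i).re + δ * (α i).im ≠ n := by
    refine hfin.eventually_all.2 fun α hα => Filter.eventually_all.2 fun i => ?_
    by_cases h : α i = 0
    · simp [h]
    · obtain ⟨-, -, hb, -⟩ := hα
      filter_upwards [eventually_add_mul_im_ne_int
        (abs_lt.2 ⟨by linarith [(hb i).1], (hb i).2⟩) h] with δ hδ _ using hδ
  have h2 : ∀ᶠ δ : ℝ in nhdsWithin 0 (Set.Ioi 0), ∀ α ∈ Bx v T β, ∀ α' ∈ Bx v T β, ∀ i,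
      α i - α' i ≠ 0 → ∀ n : ℤ, (α i - α' i).re + δ * (α i - α' i).im ≠ n := by
    refine hfin.eventually_all.2 fun α hα => hfin.eventually_all.2 fun α' hα' =>
      Filter.eventually_all.2 fun i => ?_
    by_cases h : α i - α' i = 0
    · simp [h]
    · obtain ⟨-, -, hb, -⟩ := hα
      obtain ⟨-, -, hb', -⟩ := hα'
      filter_upwards [eventually_add_mul_im_ne_int (a := α i - α' i)
        (abs_lt.2 ⟨by rw [Complex.sub_re]; linarith [(hb i).1, (hb' i).2],
          by rw [Complex.sub_re]; linarith [(hb i).2, (hb' i).1]⟩) h] with δ hδ _ using hδ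
  filter_upwards [h1, h2, self_mem_nhdsWithin] with δ hδ1 hδ2 hpos
  refine ⟨hpos, ⟨fun α hα => boxPoint_mem_Box δ hα, fun α hα α' hα' h => ?_,
    surjOn_boxPoint hT hgen β δ⟩, fun α hα i => ⟨fun h => ?_, fun h => by simp [alphaDelta, h]⟩⟩
  · have heq := hT.fanCoord_unique (isFanCoord_alphaDelta hT δ hα)
      (isFanCoord_alphaDelta hT δ hα') h
    funext i
    by_contra hne
    obtain ⟨z, hz⟩ := Int.fract_eq_fract.1 (congrFun heq i)
    refine hδ2 α hα α' hα' i (sub_ne_zero.2 hne) z ?_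
    rw [← hz, Complex.sub_re, Complex.sub_im]
    ring
  · by_contra hne
    obtain ⟨z, hz⟩ := Int.fract_eq_zero_iff.1 h
    exact hδ1 α hα i hne z hz.symm

end Fan

end

section

variable {N : Type*} [AddCommGroup N] {k : ℕ}

/-! ### The action of the monomials in the `D_i` on basis elements -/

open Classical in
/-- The coordinates of a point of the fan (and `0` outside the support of the fan). -/
def coord (v : Fin k → N) (T : Set (Finset (Fin k))) (w : ℝ ⊗[ℤ] N) : Fin k → ℝ :=
  if h : ∃ a, IsFanCoord T a ∧ w = pt v a then h.choose else 0

/-- A vector of natural numbers as a real vector. -/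
def natVec (p : Fin k → ℕ) : Fin k → ℝ := fun i => (p i : ℝ)

theorem natVec_add (p q : Fin k → ℕ) : natVec (p + q) = natVec p + natVec q := by
  funext i; simp [natVec]

@[simp] theorem natVec_zero : natVec (0 : Fin k → ℕ) = 0 := by
  funext i; simp [natVec]

theorem natVec_single (i : Fin k) : natVec (Pi.single i 1) = Pi.single i 1 := by
  funext j
  by_cases h : j = i
  · subst h; simp [natVec]
  · simp [natVec, h]

theorem natVec_nonneg (p : Fin k → ℕ) (i : Fin k) : 0 ≤ natVec p i := Nat.cast_nonneg _

variable {v : Fin k → N} {T : Set (Finset (Fin k))} {χ : ℝ ⊗[ℤ] N}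

theorem IsRegularTriangulation.coord_pt (hT : IsRegularTriangulation v T) {a : Fin k → ℝ}
    (ha : IsFanCoord T a) : coord v T (pt v a) = a := by
  have h : ∃ b, IsFanCoord T b ∧ pt v a = pt v b := ⟨a, ha, rfl⟩
  rw [coord, dif_pos h]
  exact hT.fanCoord_unique h.choose_spec.1 ha h.choose_spec.2.symm

theorem IsRegularTriangulation.coord_spec (hT : IsRegularTriangulation v T)
    (w : basisSet v T χ) : IsFanCoord T (coord v T w) ∧ (w : ℝ ⊗[ℤ] N) = pt v (coord v T w) := by
  obtain ⟨a, ha, hw⟩ := hT.exists_fanCoord w.2.1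
  rw [hw, hT.coord_pt ha]
  exact ⟨ha, rfl⟩

theorem IsRegularTriangulation.coord_injective (hT : IsRegularTriangulation v T)
    {w w' : basisSet v T χ} (h : coord v T w = coord v T w') : w = w' :=
  Subtype.ext (by rw [(hT.coord_spec w).2, (hT.coord_spec w').2, h])

theorem IsRegularTriangulation.supp_coord_subset (hT : IsRegularTriangulation v T)
    {w : ℝ ⊗[ℤ] N} {I : Finset (Fin k)} (hI : I ∈ T) (hw : w ∈ cone v I) :
    supp (coord v T w) ⊆ I := by
  obtain ⟨a, ha, hs, rfl⟩ := mem_cone_iff.1 hw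
  rwa [hT.coord_pt (hT.isFanCoord ha hI hs)]

/-- Points that differ by an integral combination of the generators lie in the same translate of
the lattice. -/
theorem IsRegularTriangulation.exists_coord_eq (hT : IsRegularTriangulation v T)
    (w : basisSet v T χ) {a : Fin k → ℝ} (ha : IsFanCoord T a) (z : Fin k → ℤ)
    (haz : a = coord v T w + fun i => (z i : ℝ)) :
    ∃ w' : basisSet v T χ, coord v T w' = a := by
  refine ⟨⟨pt v a, ha.exists_cone, ?_⟩, hT.coord_pt ha⟩
  rw [haz, pt_add, ← (hT.coord_spec w).2]
  exact add_mem_lattice w.2.2 z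

/-- The endomorphism `E` of `ℂ[Σ; χ]` translates coordinates by `p`, and annihilates the basis
elements for which the translate leaves the fan. -/
structure IsShift (v : Fin k → N) (T : Set (Finset (Fin k))) (χ : ℝ ⊗[ℤ] N)
    (E : Module.End ℂ (DMod v T χ)) (p : Fin k → ℕ) : Prop where
  of_eq : ∀ w w' : basisSet v T χ, coord v T w' = coord v T w + natVec p →
    E (Finsupp.single w 1) = Finsupp.single w' 1
  of_not : ∀ w : basisSet v T χ, (¬ ∃ w' : basisSet v T χ,
    coord v T w' = coord v T w + natVec p) → E (Finsupp.single w 1) = 0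

theorem IsShift.one (hT : IsRegularTriangulation v T) : IsShift v T χ 1 0 where
  of_eq w w' h := by
    rw [natVec_zero, add_zero] at h
    rw [hT.coord_injective h, Module.End.one_apply]
  of_not w h := absurd ⟨w, by simp⟩ h

theorem IsShift.mul (hT : IsRegularTriangulation v T) {E F : Module.End ℂ (DMod v T χ)}
    {p q : Fin k → ℕ} (hE : IsShift v T χ E p) (hF : IsShift v T χ F q) :
    IsShift v T χ (E * F) (p + q) where
  of_eq w w' h := by
    have hw' := (hT.coord_spec w').1
    have hw := (hT.coord_spec w).1
    rw [natVec_add] at h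
    have hnn : ∀ i, 0 ≤ (coord v T w + natVec q) i := fun i =>
      add_nonneg (hw.nonneg i) (natVec_nonneg q i)
    obtain ⟨u, hu⟩ := hT.exists_coord_eq w (a := coord v T w + natVec q) (z := fun i => q i)
      (hT.isFanCoord hnn hw'.supp_mem (by
        rw [h, add_left_comm, supp_add_of_nonneg (natVec_nonneg p) hnn]
        exact Finset.subset_union_right)) (by funext i; simp [natVec])
    rw [Module.End.mul_apply, hF.of_eq w u hu]
    exact hE.of_eq u w' (by rw [h, hu]; abel)
  of_not w h := by
    rw [Module.End.mul_apply]
    by_cases hu : ∃ u : basisSet v T χ, coord v T u = coord v T w + natVec q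
    · obtain ⟨u, hu⟩ := hu
      rw [hF.of_eq w u hu]
      refine hE.of_not u fun ⟨w', hw'⟩ => h ⟨w', ?_⟩
      rw [hw', hu, natVec_add]; abel
    · rw [hF.of_not w hu, map_zero]

theorem IsShift.pow (hT : IsRegularTriangulation v T) {E : Module.End ℂ (DMod v T χ)}
    {p : Fin k → ℕ} (hE : IsShift v T χ E p) (m : ℕ) : IsShift v T χ (E ^ m) (m • p) := by
  induction m with
  | zero => simpa using IsShift.one hT
  | succ m ih => rw [pow_succ, succ_nsmul]; exact ih.mul hT hE

theorem IsShift.prod_ofFn (hT : IsRegularTriangulation v T) {n : ℕ}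
    {E : Fin n → Module.End ℂ (DMod v T χ)} {p : Fin n → Fin k → ℕ}
    (h : ∀ i, IsShift v T χ (E i) (p i)) : IsShift v T χ (List.ofFn E).prod (∑ i, p i) := by
  induction n with
  | zero => simpa using IsShift.one hT
  | succ n ih =>
    rw [List.ofFn_succ, List.prod_cons, Fin.sum_univ_succ]
    exact (h 0).mul hT (ih fun i => h i.succ)

theorem IsRegularTriangulation.mem_of_emb_mem_cone (hT : IsRegularTriangulation v T)
    {i : Fin k} (hi : {i} ∈ T) {I : Finset (Fin k)} (hI : I ∈ T) (h : emb ℝ (v i) ∈ cone v I) :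
    i ∈ I := by
  have hsupp : supp (Pi.single i 1 : Fin k → ℝ) = {i} := by
    ext j; by_cases hj : j = i <;> simp [hj]
  have := hT.supp_coord_subset hI h
  rw [← one_smul ℝ (emb ℝ (v i)), ← pt_single, hT.coord_pt ⟨fun j =>
    (Pi.single_nonneg.2 zero_le_one : (0 : Fin k → ℝ) ≤ _) j, by rwa [hsupp]⟩, hsupp] at this
  exact this (Finset.mem_singleton_self i)

theorem emb_mem_cone {i : Fin k} {I : Finset (Fin k)} (h : i ∈ I) : emb ℝ (v i) ∈ cone v I := by
  refine mem_cone_iff.2 ⟨Pi.single i 1, fun j =>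
    (Pi.single_nonneg.2 zero_le_one : (0 : Fin k → ℝ) ≤ _) j, fun j hj => ?_, by simp⟩
  by_cases hji : j = i
  · rwa [hji]
  · simp [hji] at hj

theorem isShift_opD (hT : IsRegularTriangulation v T) (i : Fin k) :
    IsShift v T χ (opD v T χ i) (Pi.single i 1) where
  of_eq w w' h := by
    have hw' := hT.coord_spec w'
    have hw := hT.coord_spec w
    rw [natVec_single] at h
    have hsi : supp (Pi.single i 1 : Fin k → ℝ) = {i} := by
      ext j; by_cases hj : j = i <;> simp [hj]
    have hsupp : supp (coord v T w') = supp (coord v T w) ∪ {i} := by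
      rw [h, supp_add_of_nonneg hw.1.nonneg fun j =>
        (Pi.single_nonneg.2 zero_le_one : (0 : Fin k → ℝ) ≤ _) j, hsi]
    have hi : {i} ∈ T := hT.face_mem _ hw'.1.supp_mem _ (by
      rw [hsupp]; exact Finset.subset_union_right)
    have hex : ∃ I ∈ T, emb ℝ (v i) ∈ cone v I ∧ (w : ℝ ⊗[ℤ] N) ∈ cone v I := by
      refine ⟨_, hw'.1.supp_mem, emb_mem_cone (by simp [hsupp]), mem_cone_iff.2 ⟨_, hw.1.nonneg,
        by rw [hsupp]; exact Finset.subset_union_left, hw.2⟩⟩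
    rw [opD, if_pos hi, mulBasis, Finsupp.linearCombination_single, one_smul, dif_pos hex]
    congr 1
    apply Subtype.ext
    change emb ℝ (v i) + (w : ℝ ⊗[ℤ] N) = w'
    rw [hw'.2, h, pt_add, ← hw.2, pt_single, one_smul, add_comm]
  of_not w h := by
    rw [opD]
    split_ifs with hi
    · rw [mulBasis, Finsupp.linearCombination_single, one_smul, dif_neg]
      rintro ⟨I, hI, h1, h2⟩
      have hiI := hT.mem_of_emb_mem_cone hi hI h1
      have hw := hT.coord_spec w
      refine h (hT.exists_coord_eq w (z := Pi.single i 1) (hT.isFanCoord (I := I)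
        (fun j => add_nonneg (hw.1.nonneg j) (natVec_nonneg _ j)) hI fun j hj => ?_) ?_)
      · by_contra hjI
        apply mem_supp.1 hj
        have hji : j ≠ i := fun h => hjI (h ▸ hiI)
        rw [Pi.add_apply, natVec_single, Pi.single_eq_of_ne hji, add_zero]
        exact notMem_supp.1 fun h => hjI (hT.supp_coord_subset hI h2 h)
      · funext j
        by_cases hj : j = i
        · subst hj; simp [natVec]
        · simp [natVec, hj]
    · simp

theorem isShift_monomialD (hT : IsRegularTriangulation v T) (m : Fin k → ℕ) :
    IsShift v T χ (monomialD v T χ m) m := by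
  have h := IsShift.prod_ofFn hT fun i => (isShift_opD (χ := χ) hT i).pow hT (m i)
  have hm : ∑ i, m i • (Pi.single i 1 : Fin k → ℕ) = m := by
    funext j
    simp [Finset.sum_apply, Pi.single_apply]
  rwa [hm] at h

open Classical in
theorem IsShift.apply {E : Module.End ℂ (DMod v T χ)}
    {p : Fin k → ℕ} (hE : IsShift v T χ E p) (w w' : basisSet v T χ) :
    E (Finsupp.single w 1) w' = if coord v T w' = coord v T w + natVec p then 1 else 0 := by
  split_ifs with h
  · rw [hE.of_eq w w' h, Finsupp.single_eq_same]
  · by_cases hu : ∃ u : basisSet v T χ, coord v T u = coord v T w + natVec p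
    · obtain ⟨u, hu⟩ := hu
      rw [hE.of_eq w u hu, Finsupp.single_eq_of_ne]
      rintro rfl
      exact h hu
    · rw [hE.of_not w hu, Finsupp.zero_apply]

/-! ### The coefficients of the `Γ`-series -/

variable {β : ℂ ⊗[ℤ] N} {δ : ℝ}

theorem boxPoint_mem_basisSet (hT : IsRegularTriangulation v T) {α : Fin k → ℂ}
    (hα : α ∈ Bx v T β) : boxPoint v δ α ∈ basisSet v T (betaDelta β δ) := by
  obtain ⟨-, -, -, -, -, -, h⟩ := boxPoint_mem_Box δ hα
  exact ⟨(isFanCoord_alphaDelta hT δ hα).exists_cone, h⟩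

/-- The exponent of the monomial in the `D_i` that leads from a box element to `[w]`. -/
def multiplicity (v : Fin k → N) (T : Set (Finset (Fin k))) (w : ℝ ⊗[ℤ] N) : Fin k → ℕ :=
  fun i => ⌊coord v T w i⌋₊

/-- Each `[w]` arises from exactly one box element, by exactly one monomial in the `D_i`. -/
theorem IsAdmissible.exists_box (hT : IsRegularTriangulation v T)
    (hδ : IsAdmissible v T β δ) (w : basisSet v T (betaDelta β δ)) :
    ∃ α ∈ Bx v T β, coord v T w = alphaDelta δ α + natVec (multiplicity v T w) := by
  obtain ⟨hc, hw⟩ := hT.coord_spec w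
  set a := coord v T w with ha
  have hle : ∀ i, (⌊a i⌋₊ : ℝ) ≤ a i := fun i => Nat.floor_le (hc.nonneg i)
  set b : Fin k → ℝ := fun i => a i - ⌊a i⌋₊ with hb
  obtain ⟨I, hI, hsI⟩ := exists_isMaxCone hc.supp_mem
  have hbs : supp b ⊆ I := fun i hi => hsI (mem_supp.2 fun h => mem_supp.1 hi (by simp [hb, h]))
  have hbox : pt v b ∈ Box v T (betaDelta β δ) := by
    refine ⟨I, hI, b, fun i => ⟨sub_nonneg.2 (hle i), ?_⟩, fun i hi =>
      notMem_supp.1 fun h => hi (hbs h), rfl, ?_⟩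
    · linarith [Nat.lt_floor_add_one (a i)]
    · have := add_mem_lattice (v := v) w.2.2 fun i => -(⌊a i⌋₊ : ℤ)
      rw [hw, ← pt_add] at this
      convert this using 4
      funext i
      simp [hb, sub_eq_add_neg]
  obtain ⟨α, hα, hαb⟩ := hδ.bijOn.surjOn hbox
  refine ⟨α, hα, ?_⟩
  have : alphaDelta δ α = b := hT.fanCoord_unique (isFanCoord_alphaDelta hT δ hα)
    (hT.isFanCoord (fun i => sub_nonneg.2 (hle i)) hI.prop hbs) hαb
  rw [this]
  funext i
  simp [hb, natVec, multiplicity, ← ha]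

theorem IsAdmissible.eq_of_coord (hδ : IsAdmissible v T β δ) {w : ℝ ⊗[ℤ] N}
    {α α' : Fin k → ℂ} (hα : α ∈ Bx v T β) (hα' : α' ∈ Bx v T β) {m m' : Fin k → ℕ}
    (h : coord v T w = alphaDelta δ α + natVec m)
    (h' : coord v T w = alphaDelta δ α' + natVec m') : α = α' ∧ m = m' := by
  have hi : ∀ i, alphaDelta δ α i = alphaDelta δ α' i ∧ m i = m' i := by
    intro i
    have h1 := congrFun h i
    have h2 := congrFun h' i
    obtain ⟨p1, p2⟩ := alphaDelta_mem δ α i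
    obtain ⟨q1, q2⟩ := alphaDelta_mem δ α' i
    simp only [Pi.add_apply, natVec] at h1 h2
    have e1 : ⌊coord v T w i⌋₊ = m i := by rw [h1, Nat.floor_add_natCast p1, Nat.floor_eq_zero.2 p2,
      zero_add]
    have e2 : ⌊coord v T w i⌋₊ = m' i := by rw [h2, Nat.floor_add_natCast q1, Nat.floor_eq_zero.2 q2,
      zero_add]
    have e3 : m i = m' i := e1.symm.trans e2
    refine ⟨?_, e3⟩
    rw [h1, e3] at h2
    linarith
  refine ⟨hδ.bijOn.injOn hα hα' ?_, funext fun i => (hi i).2⟩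
  rw [boxPoint_eq_pt, boxPoint_eq_pt, funext fun i => (hi i).1]

theorem gammaTerm_of_eq (hT : IsRegularTriangulation v T) (hδ : IsAdmissible v T β δ)
    {α : Fin k → ℂ} (hα : α ∈ Bx v T β) (l y : Fin k → ℂ) {w : basisSet v T (betaDelta β δ)}
    {m : Fin k → ℕ} (h : coord v T w = alphaDelta δ α + natVec m) :
    gammaTerm v T (betaDelta β δ) (boxPoint v δ α) l y w =
      ∏ i, taylorCoeff (l i) (y i) (m i) := by
  classical
  have hb := boxPoint_mem_basisSet (δ := δ) hT hα
  have hcoord : coord v T (boxPoint v δ α) = alphaDelta δ α :=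
    hT.coord_pt (isFanCoord_alphaDelta hT δ hα)
  rw [gammaTerm, finsum_eq_single _ m]
  · rw [basisElt, dif_pos hb, (isShift_monomialD hT m).apply, if_pos (by rw [hcoord, h]), mul_one]
  · intro m' hm'
    rw [basisElt, dif_pos hb, (isShift_monomialD hT m').apply, if_neg, mul_zero]
    intro h'
    rw [hcoord] at h'
    exact hm' (hδ.eq_of_coord hα hα h' h).2

theorem gammaTerm_of_ne (hT : IsRegularTriangulation v T)
    {α : Fin k → ℂ} (hα : α ∈ Bx v T β) (l y : Fin k → ℂ) {w : basisSet v T (betaDelta β δ)}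
    (h : ∀ m : Fin k → ℕ, coord v T w ≠ alphaDelta δ α + natVec m) :
    gammaTerm v T (betaDelta β δ) (boxPoint v δ α) l y w = 0 := by
  classical
  have hb := boxPoint_mem_basisSet (δ := δ) hT hα
  have hcoord : coord v T (boxPoint v δ α) = alphaDelta δ α :=
    hT.coord_pt (isFanCoord_alphaDelta hT δ hα)
  rw [gammaTerm]
  refine finsum_eq_zero_of_forall_eq_zero fun m => ?_
  rw [basisElt, dif_pos hb, (isShift_monomialD hT m).apply, if_neg, mul_zero]
  intro h'
  rw [hcoord] at h'
  exact h m h'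

/-- The scalar series `∑_l ∏_i (coefficient of t_i ^ m_i in x_i ^ (l_i + t_i) / Γ(l_i + t_i + 1))`,
a coefficient of the `Γ`-series. -/
def coeffSeries (v : Fin k → N) (β : ℂ ⊗[ℤ] N) (α : Fin k → ℂ) (m : Fin k → ℕ) (u : N)
    (y : Fin k → ℂ) : ℂ :=
  ∑' l : setL v β α u, ∏ i, taylorCoeff (l.1 i) (y i) (m i)

theorem gammaSeries_eq_coeffSeries (hT : IsRegularTriangulation v T) (hδ : IsAdmissible v T β δ)
    {α : Fin k → ℂ} (hα : α ∈ Bx v T β) (u : N) (y : Fin k → ℂ)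
    {w : basisSet v T (betaDelta β δ)} {m : Fin k → ℕ}
    (h : coord v T w = alphaDelta δ α + natVec m) :
    gammaSeries v T β δ u y w = coeffSeries v β α m u y := by
  rw [gammaSeries, finsum_eq_single _ ⟨α, hα⟩]
  · exact tsum_congr fun l => gammaTerm_of_eq hT hδ hα _ y h
  · intro α' hne
    have : ∀ m' : Fin k → ℕ, coord v T w ≠ alphaDelta δ α'.1 + natVec m' := fun m' h' =>
      hne (Subtype.ext (hδ.eq_of_coord α'.2 hα h' h).1)
    simp [gammaTerm_of_ne hT α'.2 _ y this]

end

section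

variable {N : Type*} [AddCommGroup N] {k : ℕ}
variable {v : Fin k → N} {T : Set (Finset (Fin k))} {χ ξ : ℝ ⊗[ℤ] N}

/-! ### The shadow modules -/

/-- The points from which one can move a little in the direction of `ξ` without leaving the
support of the fan. -/
def IsGood (T : Set (Finset (Fin k))) (v : Fin k → N) (ξ w : ℝ ⊗[ℤ] N) : Prop :=
  ∀ᶠ ε : ℝ in nhdsWithin 0 (Set.Ioi 0), ∃ I ∈ T, w + ε • ξ ∈ cone v I

theorem IsGood.add_left (hT : IsRegularTriangulation v T) {w x : ℝ ⊗[ℤ] N}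
    (hw : IsGood T v ξ w) (hx : x ∈ coneK v) : IsGood T v ξ (x + w) := by
  filter_upwards [hw] with ε hε
  rw [← hT.mem_coneK] at hε ⊢
  rw [add_assoc]
  exact cone_add hx hε

theorem IsGood.smul {w : ℝ ⊗[ℤ] N} (hT : IsRegularTriangulation v T) (hw : IsGood T v ξ w)
    {t : ℝ} (ht : 0 < t) : IsGood T v ξ (t • w) := by
  have htend : Filter.Tendsto (fun ε : ℝ => t⁻¹ * ε) (nhdsWithin 0 (Set.Ioi 0))
      (nhdsWithin 0 (Set.Ioi 0)) := by
    refine tendsto_nhdsWithin_iff.2 ⟨?_, ?_⟩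
    · have : Filter.Tendsto (fun ε : ℝ => t⁻¹ * ε) (nhds 0) (nhds (t⁻¹ * 0)) :=
        Continuous.tendsto (by fun_prop) 0
      rw [mul_zero] at this
      exact this.mono_left nhdsWithin_le_nhds
    · filter_upwards [self_mem_nhdsWithin] with ε hε
      exact mul_pos (inv_pos.2 ht) hε
  filter_upwards [htend.eventually hw] with ε hε
  rw [← hT.mem_coneK] at hε ⊢
  have := smul_mem_coneK ht.le hε
  rwa [smul_add, smul_smul, ← mul_assoc, mul_inv_cancel₀ ht.ne', one_mul] at this

/-- Whether a point is good depends only on the smallest cone containing it. -/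
theorem IsGood.of_supp_subset (hT : IsRegularTriangulation v T) {a b : Fin k → ℝ}
    (hb : ∀ i, 0 ≤ b i) (hab : supp a ⊆ supp b)
    (hw : IsGood T v ξ (pt v a)) : IsGood T v ξ (pt v b) := by
  have hex : ∀ᶠ t : ℝ in nhdsWithin 0 (Set.Ioi 0), ∀ i, t * a i ≤ b i := by
    refine Filter.eventually_all.2 fun i => ?_
    by_cases hai : a i = 0
    · simp [hai, hb i]
    · have hbi : 0 < b i := lt_of_le_of_ne (hb i) (Ne.symm (mem_supp.1 (hab (mem_supp.2 hai))))
      have : Filter.Tendsto (fun t : ℝ => t * a i) (nhds 0) (nhds (0 * a i)) :=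
        Continuous.tendsto (by fun_prop) 0
      rw [zero_mul] at this
      exact ((this.mono_left nhdsWithin_le_nhds).eventually (gt_mem_nhds hbi)).mono
        fun t ht => ht.le
  obtain ⟨t, ht, ht0⟩ := (hex.and self_mem_nhdsWithin).exists
  have h1 : pt v b = pt v (b - t • a) + t • pt v a := by rw [← pt_smul, ← pt_add]; simp
  rw [h1]
  exact (hw.smul hT ht0).add_left hT (pt_mem_coneK fun i => sub_nonneg.2 (ht i))

theorem mulBasis_single_mem_supported (hT : IsRegularTriangulation v T) (n : N)
    {w : basisSet v T χ} (hw : IsGood T v ξ w) :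
    mulBasis v T χ n (Finsupp.single w 1) ∈
      Finsupp.supported ℂ ℂ {w : basisSet v T χ | IsGood T v ξ w} := by
  rw [mulBasis, Finsupp.linearCombination_single, one_smul]
  split_ifs with h
  · obtain ⟨I, hI, h1, -⟩ := h
    exact Finsupp.single_mem_supported _ _ (hw.add_left hT (hT.mem_coneK.2 ⟨I, hI, h1⟩))
  · exact Submodule.zero_mem _

theorem shadow_eq_supported (hT : IsRegularTriangulation v T) :
    shadow v T χ ξ = Finsupp.supported ℂ ℂ {w : basisSet v T χ | IsGood T v ξ w} := by
  apply le_antisymm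
  · refine sInf_le ⟨fun w hw => Finsupp.single_mem_supported _ _ hw, fun n m hm => ?_⟩
    rw [Finsupp.supported_eq_span_single] at hm
    induction hm using Submodule.span_induction with
    | mem x hx => obtain ⟨w, hw, rfl⟩ := hx; exact mulBasis_single_mem_supported hT n hw
    | zero => simp
    | add x y _ _ hx hy => rw [map_add]; exact Submodule.add_mem _ hx hy
    | smul c x _ hx => rw [map_smul]; exact Submodule.smul_mem _ c hx
  · rw [Finsupp.supported_eq_span_single, Submodule.span_le]
    rintro _ ⟨w, hw, rfl⟩
    exact Submodule.mem_sInf.2 fun P hP => hP.1 w hw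

theorem mem_shadowSet_iff (hT : IsRegularTriangulation v T) {w : basisSet v T χ} :
    w ∈ shadowSet v T χ ξ ↔ IsGood T v ξ w := by
  change Finsupp.single w (1 : ℂ) ∈ shadow v T χ ξ ↔ _
  rw [shadow_eq_supported hT, Finsupp.mem_supported,
    Finsupp.support_single _ one_ne_zero]
  simp

theorem mem_shadowSet_of_supp_subset (hT : IsRegularTriangulation v T) {w w' : basisSet v T χ}
    (hw : w ∈ shadowSet v T χ ξ) (h : supp (coord v T w) ⊆ supp (coord v T w')) :
    w' ∈ shadowSet v T χ ξ := by
  rw [mem_shadowSet_iff hT] at hw ⊢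
  rw [(hT.coord_spec w).2] at hw
  rw [(hT.coord_spec w').2]
  exact hw.of_supp_subset hT (hT.coord_spec w').1.nonneg h

theorem supp_coord_of_shift (hT : IsRegularTriangulation v T) {w w' : basisSet v T χ} {i : Fin k}
    (h : coord v T w' = coord v T w + natVec (Pi.single i 1)) :
    supp (coord v T w') = insert i (supp (coord v T w)) := by
  rw [h, supp_add_of_nonneg (hT.coord_spec w).1.nonneg (natVec_nonneg _)]
  ext j
  by_cases hj : j = i <;> simp [natVec, hj]

theorem opD_single_mem_shadow (hT : IsRegularTriangulation v T) (i : Fin k)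
    {w : basisSet v T χ} (hw : w ∈ shadowSet v T χ ξ) :
    opD v T χ i (Finsupp.single w 1) ∈ shadow v T χ ξ := by
  by_cases hu : ∃ u : basisSet v T χ, coord v T u = coord v T w + natVec (Pi.single i 1)
  · obtain ⟨u, hu⟩ := hu
    rw [(isShift_opD hT i).of_eq w u hu]
    exact mem_shadowSet_of_supp_subset hT hw
      (by rw [supp_coord_of_shift hT hu]; exact Finset.subset_insert _ _)
  · rw [(isShift_opD hT i).of_not w hu]
    exact Submodule.zero_mem _

theorem opZ_mem_shadow (hT : IsRegularTriangulation v T) (g : N →ₗ[ℤ] ℤ) {x : DMod v T χ}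
    (hx : x ∈ shadow v T χ ξ) : opZ v T χ g x ∈ shadow v T χ ξ := by
  rw [shadow_eq_supported hT, Finsupp.supported_eq_span_single] at hx
  induction hx using Submodule.span_induction with
  | mem x hx =>
    obtain ⟨w, hw, rfl⟩ := hx
    rw [opZ, LinearMap.sum_apply]
    refine Submodule.sum_mem _ fun i _ => ?_
    rw [LinearMap.smul_apply]
    exact Submodule.smul_mem _ _ (opD_single_mem_shadow hT i ((mem_shadowSet_iff hT).2 hw))
  | zero => simp
  | add x y _ _ hx hy => rw [map_add]; exact Submodule.add_mem _ hx hy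
  | smul c x _ hx => rw [map_smul]; exact Submodule.smul_mem _ c hx

/-! ### The quotient of a shadow module lives in bounded degree -/

theorem IsRegularTriangulation.exists_interpolation (hT : IsRegularTriangulation v T)
    (hgen : AddSubgroup.closure (Set.range v) = ⊤) {I : Finset (Fin k)} (hI : IsMaxCone T I)
    (ω : Fin k → ℝ) : ∃ ψ : (ℝ ⊗[ℤ] N) →ₗ[ℝ] ℝ, ∀ i ∈ I, ψ (emb ℝ (v i)) = ω i := by
  have hspan : ⊤ ≤ Submodule.span ℝ (Set.range fun i : I => emb ℝ (v i)) := by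
    intro w _
    obtain ⟨a, ha, rfl⟩ := hT.exists_coord hgen hI w
    refine Submodule.sum_mem _ fun i _ => ?_
    by_cases hi : i ∈ I
    · exact Submodule.smul_mem _ _ (Submodule.subset_span ⟨⟨i, hi⟩, rfl⟩)
    · rw [notMem_supp.1 fun h => hi (ha h), zero_smul]
      exact Submodule.zero_mem _
  let b := Module.Basis.mk (hT.linearIndependent I hI.prop) hspan
  refine ⟨b.constr ℝ fun i : I => ω i, fun i hi => ?_⟩
  have := b.constr_basis ℝ (fun i : I => ω i) ⟨i, hi⟩
  rwa [Module.Basis.mk_apply] at this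

theorem exists_combination_of_dual_basis [Module.Free ℤ N] [Module.Finite ℤ N] {d : ℕ}
    (g : Module.Basis (Fin d) ℤ (N →ₗ[ℤ] ℤ)) (φ : (ℝ ⊗[ℤ] N) →ₗ[ℝ] ℝ) :
    ∃ c : Fin d → ℝ, ∀ n : N, φ (emb ℝ n) = ∑ j, c j * g j n := by
  let e : Module.Basis (Fin d) ℤ N := g.dualBasis.map (Module.evalEquiv ℤ N).symm
  have he : ∀ i j, g i (e j) = if i = j then 1 else 0 := by
    intro i j
    have h1 : Module.Dual.eval ℤ N (e j) = g.dualBasis j := by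
      rw [Module.Basis.map_apply]
      exact (Module.evalEquiv ℤ N).apply_symm_apply _
    rw [← Module.Dual.eval_apply ℤ N (e j) (g i), h1, Module.Basis.coe_dualBasis,
      Module.Basis.coord_apply, Module.Basis.repr_self, Finsupp.single_apply]
  have hrepr : ∀ (n : N) (i : Fin d), e.repr n i = g i n := by
    intro n i
    conv_rhs => rw [← e.sum_repr n, map_sum]
    simp [he]
  refine ⟨fun j => φ (emb ℝ (e j)), fun n => ?_⟩
  conv_lhs => rw [← e.sum_repr n, emb_sum, map_sum]
  refine Finset.sum_congr rfl fun j _ => ?_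
  rw [emb_zsmul, map_smul, smul_eq_mul, hrepr, mul_comm]

/-- The subspace `(Z_1, …, Z_d) ℂ[Σ; χ]_ξ` of `ℂ[Σ; χ]`. -/
def zSpan (v : Fin k → N) (T : Set (Finset (Fin k))) (χ ξ : ℝ ⊗[ℤ] N) {d : ℕ}
    (g : Fin d → (N →ₗ[ℤ] ℤ)) : Submodule ℂ (DMod v T χ) :=
  Submodule.span ℂ {y | ∃ j, ∃ m ∈ shadow v T χ ξ, y = opZ v T χ (g j) m}

theorem opZ_eq_sum {d : ℕ} (g : Fin d → (N →ₗ[ℤ] ℤ)) (c : Fin d → ℂ) (f : Fin k → ℂ)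
    (h : ∀ i, f i = ∑ j, c j * (g j (v i) : ℂ)) (x : DMod v T χ) :
    ∑ i, f i • opD v T χ i x = ∑ j, c j • opZ v T χ (g j) x := by
  simp only [opZ, LinearMap.sum_apply, LinearMap.smul_apply, Finset.smul_sum, h, Finset.sum_smul,
    smul_smul]
  exact Finset.sum_comm

theorem sum_smul_opD_mem_zSpan {d : ℕ} (g : Fin d → (N →ₗ[ℤ] ℤ)) (c : Fin d → ℂ)
    (f : Fin k → ℂ) (h : ∀ i, f i = ∑ j, c j * (g j (v i) : ℂ)) {x : DMod v T χ}
    (hx : x ∈ shadow v T χ ξ) : ∑ i, f i • opD v T χ i x ∈ zSpan v T χ ξ g := by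
  rw [opZ_eq_sum g c f h]
  exact Submodule.sum_mem _ fun j _ => Submodule.smul_mem _ _ (Submodule.subset_span ⟨j, x, hx, rfl⟩)

/-- In degree greater than `k` some coordinate of `w` is greater than `1`, say the `i`-th, and
`w - v_i` has the same support as `w`. Apply to `[w - v_i]` the combination of the `Z_j` that
belongs to the linear function dual to `v_i` in a maximal cone: it expresses `[w]` by basis
elements of the same degree whose supports are strictly larger. -/
theorem single_mem_zSpan [Module.Free ℤ N] [Module.Finite ℤ N]
    (hT : IsRegularTriangulation v T) (hgen : AddSubgroup.closure (Set.range v) = ⊤) {d : ℕ}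
    (g : Module.Basis (Fin d) ℤ (N →ₗ[ℤ] ℤ)) (w : basisSet v T χ)
    (hw : w ∈ shadowSet v T χ ξ) (hdeg : (k : ℝ) < ∑ i, coord v T w i) :
    Finsupp.single w (1 : ℂ) ∈ zSpan v T χ ξ g := by
  classical
  induction hn : k - (supp (coord v T w)).card using Nat.strong_induction_on generalizing w with
  | _ n ih =>
  obtain ⟨hwc, -⟩ := hT.coord_spec w
  obtain ⟨i, hi⟩ : ∃ i, 1 < coord v T w i := by
    by_contra! h
    have := Finset.sum_le_sum fun i (_ : i ∈ Finset.univ) => h i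
    simp only [Finset.sum_const, Finset.card_univ, Fintype.card_fin, nsmul_eq_mul, mul_one] at this
    linarith
  set b : Fin k → ℝ := coord v T w - Pi.single i 1 with hb
  have hbi : ∀ j, j ≠ i → b j = coord v T w j := fun j hj => by simp [hb, hj]
  have hbi' : 0 < b i := by simp [hb]; linarith
  have hbs : supp b = supp (coord v T w) := by
    ext j
    rw [mem_supp, mem_supp]
    by_cases hj : j = i
    · subst hj
      exact iff_of_true hbi'.ne' (by linarith)
    · rw [hbi j hj]
  have hb0 : ∀ j, 0 ≤ b j := by
    intro j
    by_cases hj : j = i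
    · rw [hj]; exact hbi'.le
    · rw [hbi j hj]; exact hwc.nonneg j
  obtain ⟨w', hw'⟩ := hT.exists_coord_eq w (a := b) ⟨hb0, hbs ▸ hwc.supp_mem⟩
    (z := -Pi.single i 1) (by
      rw [hb]
      funext j
      by_cases hj : j = i
      · subst hj; simp [sub_eq_add_neg]
      · simp [hj])
  have hw'w : coord v T w = coord v T w' + natVec (Pi.single i 1) := by
    rw [hw', hb, natVec_single, sub_add_cancel]
  have hgood : w' ∈ shadowSet v T χ ξ := mem_shadowSet_of_supp_subset hT hw (by rw [hw', hbs])
  obtain ⟨I, hI, hsI⟩ := exists_isMaxCone hwc.supp_mem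
  obtain ⟨φ, hφ⟩ := hT.exists_interpolation hgen hI (Pi.single i 1)
  obtain ⟨c, hc⟩ := exists_combination_of_dual_basis g φ
  have hZ := sum_smul_opD_mem_zSpan (v := v) (T := T) (χ := χ) (ξ := ξ) g (fun j => (c j : ℂ))
    (fun i => (φ (emb ℝ (v i)) : ℂ)) (fun i => by rw [hc]; push_cast; rfl) hgood
  rw [← Finset.add_sum_erase _ _ (Finset.mem_univ i), (isShift_opD hT i).of_eq w' w hw'w,
    hφ i (hsI (mem_supp.2 (by linarith))), Pi.single_eq_same, Complex.ofReal_one, one_smul] at hZ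
  refine (Submodule.add_mem_iff_left _ (Submodule.sum_mem _ fun j hj => ?_)).1 hZ
  rw [Finset.mem_erase] at hj
  by_cases hjI : j ∈ I
  · rw [hφ j hjI, Pi.single_eq_of_ne hj.1, Complex.ofReal_zero, zero_smul]
    exact Submodule.zero_mem _
  refine Submodule.smul_mem _ _ ?_
  by_cases hu : ∃ u : basisSet v T χ, coord v T u = coord v T w' + natVec (Pi.single j 1)
  · obtain ⟨u, hu⟩ := hu
    rw [(isShift_opD hT j).of_eq w' u hu]
    have hus : supp (coord v T u) = insert j (supp (coord v T w)) := by
      rw [supp_coord_of_shift hT hu, hw', hbs]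
    have hcard : (supp (coord v T u)).card = (supp (coord v T w)).card + 1 := by
      rw [hus, Finset.card_insert_of_notMem fun h => hjI (hsI h)]
    have hle : (supp (coord v T u)).card ≤ k := by
      simpa using Finset.card_le_univ (supp (coord v T u))
    refine ih _ ?_ u (mem_shadowSet_of_supp_subset hT hw
      (by rw [hus]; exact Finset.subset_insert _ _)) ?_ rfl
    · omega
    · have h1 : ∑ x, coord v T u x = ∑ x, coord v T w x := by
        rw [hu, hw'w, natVec_single, natVec_single]
        simp [Finset.sum_add_distrib]
      rw [h1]; exact hdeg
  · rw [(isShift_opD hT j).of_not w' hu]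
    exact Submodule.zero_mem _

theorem shadowClass_eq_zero [Module.Free ℤ N] [Module.Finite ℤ N]
    (hT : IsRegularTriangulation v T) (hgen : AddSubgroup.closure (Set.range v) = ⊤) {d : ℕ}
    (g : Module.Basis (Fin d) ℤ (N →ₗ[ℤ] ℤ)) (w : shadowSet v T χ ξ)
    (hdeg : (k : ℝ) < ∑ i, coord v T (w : basisSet v T χ) i) : shadowClass v T χ ξ g w = 0 :=
  (Submodule.Quotient.mk_eq_zero _).2 (single_mem_zSpan hT hgen g w.1 w.2 hdeg)

theorem finite_coord_sum_le [Module.Free ℤ N] [Module.Finite ℤ N]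
    (hT : IsRegularTriangulation v T) (χ : ℝ ⊗[ℤ] N) (C : ℝ) :
    {w : basisSet v T χ | ∑ i, coord v T w i ≤ C}.Finite := by
  choose n hn using fun w : basisSet v T χ => w.2.2
  refine Set.Finite.of_finite_image (f := n) ?_ fun w _ w' _ h =>
    Subtype.ext (by rw [hn w, hn w', h])
  apply finite_lattice_of_bounded
  intro g
  refine ⟨C * ∑ i, |(g (v i) : ℝ)| + |extR g χ|, ?_⟩
  rintro _ ⟨w, hw, rfl⟩
  have h1 := congrArg (extR g) (hn w)
  obtain ⟨hc, hwc⟩ := hT.coord_spec w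
  rw [map_add, extR_emb, hwc, map_pt] at h1
  rw [eq_sub_of_add_eq h1.symm]
  refine (abs_sub _ _).trans (add_le_add_left ((Finset.abs_sum_le_sum_abs _ _).trans ?_) _)
  rw [Finset.mul_sum]
  refine Finset.sum_le_sum fun i _ => ?_
  rw [abs_mul, abs_of_nonneg (hc.nonneg i), extR_emb]
  refine mul_le_mul_of_nonneg_right (le_trans ?_ hw) (abs_nonneg _)
  exact Finset.single_le_sum (fun j _ => hc.nonneg j) (Finset.mem_univ i)

theorem finite_ne_zero [Module.Free ℤ N] [Module.Finite ℤ N]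
    (hT : IsRegularTriangulation v T) (hgen : AddSubgroup.closure (Set.range v) = ⊤) {d : ℕ}
    (g : Module.Basis (Fin d) ℤ (N →ₗ[ℤ] ℤ)) (h : ShadowQuot v T χ ξ g →ₗ[ℂ] ℂ) :
    {w | h (shadowClass v T χ ξ g w) ≠ 0}.Finite := by
  refine Set.Finite.subset ((finite_coord_sum_le hT χ k).preimage
    (Subtype.val_injective (p := (· ∈ shadowSet v T χ ξ))).injOn) fun w hw => ?_
  by_contra hlt
  exact hw (by rw [shadowClass_eq_zero hT hgen g w (not_le.1 hlt), map_zero])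

/-! ### Functionals on the quotient, as functions on the basis -/

open Classical in
/-- The values of a functional on the quotient of the shadow module at the basis elements, extended
by zero to all the basis elements of `ℂ[Σ; χ]`. -/
def basisValue (v : Fin k → N) (T : Set (Finset (Fin k))) (χ ξ : ℝ ⊗[ℤ] N) {d : ℕ}
    (g : Fin d → (N →ₗ[ℤ] ℤ)) (h : ShadowQuot v T χ ξ g →ₗ[ℂ] ℂ) (w : basisSet v T χ) : ℂ :=
  if hw : w ∈ shadowSet v T χ ξ then h (shadowClass v T χ ξ g ⟨w, hw⟩) else 0

theorem linearCombination_basisValue (hT : IsRegularTriangulation v T) {d : ℕ}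
    (g : Fin d → (N →ₗ[ℤ] ℤ)) (h : ShadowQuot v T χ ξ g →ₗ[ℂ] ℂ) {x : DMod v T χ}
    (hx : x ∈ shadow v T χ ξ) :
    Finsupp.linearCombination ℂ (basisValue v T χ ξ g h) x =
      h (Submodule.Quotient.mk ⟨x, hx⟩) := by
  have hspan : shadow v T χ ξ = Submodule.span ℂ
      ((fun w => Finsupp.single w (1 : ℂ)) '' {w : basisSet v T χ | IsGood T v ξ w}) := by
    rw [shadow_eq_supported hT, Finsupp.supported_eq_span_single]
  have hx' := hx
  rw [hspan] at hx'
  induction hx' using Submodule.span_induction with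
  | mem x hx' =>
    obtain ⟨w, hw, rfl⟩ := hx'
    rw [Finsupp.linearCombination_single, one_smul, basisValue, dif_pos (show w ∈ shadowSet v T χ ξ from hx)]
    rfl
  | zero => rw [map_zero]; exact (map_zero h).symm
  | add x y hx1 hy1 hx' hy' =>
    rw [← hspan] at hx1 hy1
    rw [map_add, hx' hx1, hy' hy1, ← map_add]
    rfl
  | smul c x hx1 hx' =>
    rw [← hspan] at hx1
    rw [map_smul, hx' hx1, ← map_smul]
    rfl

theorem linearCombination_basisValue_of_mem_zSpan (hT : IsRegularTriangulation v T) {d : ℕ}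
    (g : Fin d → (N →ₗ[ℤ] ℤ)) (h : ShadowQuot v T χ ξ g →ₗ[ℂ] ℂ) {x : DMod v T χ}
    (hx : x ∈ zSpan v T χ ξ g) :
    Finsupp.linearCombination ℂ (basisValue v T χ ξ g h) x = 0 := by
  have hle : zSpan v T χ ξ g ≤ shadow v T χ ξ := by
    rw [zSpan, Submodule.span_le]
    rintro _ ⟨j, m, hm, rfl⟩
    exact opZ_mem_shadow hT (g j) hm
  rw [linearCombination_basisValue hT g h (hle hx)]
  have : (Submodule.Quotient.mk ⟨x, hle hx⟩ : ShadowQuot v T χ ξ g) = 0 :=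
    (Submodule.Quotient.mk_eq_zero _).2 hx
  rw [this, map_zero]

end

section

/-! ### Taylor coefficients of `x ^ (l + t) / Γ(l + t + 1)` -/

theorem contDiff_inv_Gamma (l : ℂ) {n : WithTop ℕ∞} :
    ContDiff ℂ n fun t : ℂ => (Complex.Gamma (l + t + 1))⁻¹ := by
  have h : Differentiable ℂ fun t : ℂ => (Complex.Gamma (l + t + 1))⁻¹ :=
    Complex.differentiable_one_div_Gamma.comp (by fun_prop : Differentiable ℂ fun t : ℂ => l + t + 1)
  exact h.contDiff

theorem contDiff_taylorFun (l y : ℂ) {n : WithTop ℕ∞} :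
    ContDiff ℂ n fun t : ℂ => Complex.exp ((l + t) * y) * (Complex.Gamma (l + t + 1))⁻¹ :=
  ContDiff.mul (by fun_prop) (contDiff_inv_Gamma l)

/-- The zeros of `1 / Γ`. -/
theorem taylorCoeff_zero_of_neg (y : ℂ) {l : ℂ} {z : ℤ} (hl : l = z) (hz : z < 0) :
    taylorCoeff l y 0 = 0 := by
  obtain ⟨n, rfl⟩ : ∃ n : ℕ, z = -(n : ℤ) - 1 := ⟨(-z - 1).toNat, by omega⟩
  have h : l + 0 + 1 = -(n : ℂ) := by rw [hl]; push_cast; ring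
  rw [taylorCoeff, iteratedDeriv_zero, h, Complex.Gamma_neg_nat_eq_zero]
  simp

/-- The Taylor coefficient of index `m - 1`, understood to be `0` when `m = 0`. -/
def taylorCoeffPred (l y : ℂ) : ℕ → ℂ
  | 0 => 0
  | m + 1 => taylorCoeff l y m

theorem iteratedDeriv_const_add_id (l : ℂ) (i : ℕ) :
    iteratedDeriv (i + 2) (fun t : ℂ => l + t) 0 = 0 := by
  rw [iteratedDeriv_const_add (by omega)]
  have := iteratedDeriv_id (𝕜 := ℂ) (n := i + 2) (x := 0)
  simpa [show (fun t : ℂ => t) = id from rfl] using this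

theorem iteratedDeriv_linear_mul (l : ℂ) {f : ℂ → ℂ} (hf : ∀ n : ℕ, ContDiff ℂ n f) (m : ℕ) :
    iteratedDeriv (m + 1) (fun t : ℂ => (l + t) * f t) 0 =
      l * iteratedDeriv (m + 1) f 0 + (m + 1) * iteratedDeriv m f 0 := by
  rw [iteratedDeriv_fun_mul (by fun_prop) (hf _).contDiffAt, Finset.sum_range_succ',
    Finset.sum_range_succ']
  have h0 : ∑ i ∈ Finset.range m, ((m + 1).choose (i + 1 + 1) : ℂ) *
      iteratedDeriv (i + 1 + 1) (fun t : ℂ => l + t) 0 *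
        iteratedDeriv (m + 1 - (i + 1 + 1)) f 0 = 0 :=
    Finset.sum_eq_zero fun i _ => by rw [iteratedDeriv_const_add_id]; ring
  rw [h0, iteratedDeriv_const_add (by omega)]
  have h1 : iteratedDeriv (0 + 1) (fun z : ℂ => z) 0 = 1 := by simp [iteratedDeriv_one]
  rw [h1]
  simp
  ring

/-- Multiplication of `x ^ (l + t) / Γ(l + t + 1)` by `l + t` lowers `l` by one. -/
theorem linear_mul_taylorCoeff (l y : ℂ) (m : ℕ) :
    l * taylorCoeff l y m + taylorCoeffPred l y m =
      Complex.exp y * taylorCoeff (l - 1) y m := by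
  have hfun : (fun t : ℂ => Complex.exp ((l - 1 + t) * y) * (Complex.Gamma (l - 1 + t + 1))⁻¹) =
      fun t : ℂ => Complex.exp (-y) *
        ((l + t) * (Complex.exp ((l + t) * y) * (Complex.Gamma (l + t + 1))⁻¹)) := by
    funext t
    have h1 : l - 1 + t + 1 = l + t := by ring
    have h2 : (l - 1 + t) * y = -y + (l + t) * y := by ring
    rw [h1, Complex.one_div_Gamma_eq_self_mul_one_div_Gamma_add_one (l + t), h2, Complex.exp_add]
    ring
  have hscale : Complex.exp y * taylorCoeff (l - 1) y m = iteratedDeriv m (fun t : ℂ =>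
      (l + t) * (Complex.exp ((l + t) * y) * (Complex.Gamma (l + t + 1))⁻¹)) 0 / m.factorial := by
    rw [taylorCoeff, hfun, iteratedDeriv_const_mul_field, mul_div_assoc, ← mul_assoc,
      ← Complex.exp_add, add_neg_cancel, Complex.exp_zero, one_mul]
  rw [hscale]
  cases m with
  | zero => simp [taylorCoeff, taylorCoeffPred]
  | succ m =>
    rw [iteratedDeriv_linear_mul l fun n => contDiff_taylorFun l y, taylorCoeffPred, taylorCoeff,
      taylorCoeff, Nat.factorial_succ]
    generalize iteratedDeriv (m + 1) (fun t : ℂ =>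
      Complex.exp ((l + t) * y) * (Complex.Gamma (l + t + 1))⁻¹) 0 = p
    generalize iteratedDeriv m (fun t : ℂ =>
      Complex.exp ((l + t) * y) * (Complex.Gamma (l + t + 1))⁻¹) 0 = q
    have : (m.factorial : ℂ) ≠ 0 := by exact_mod_cast m.factorial_ne_zero
    have : (m : ℂ) + 1 ≠ 0 := by exact_mod_cast m.succ_ne_zero
    push_cast
    field_simp

theorem taylorCoeff_eq_sum (l y : ℂ) (m : ℕ) :
    taylorCoeff l y m = Complex.exp (l * y) * ∑ i ∈ Finset.range (m + 1), y ^ i / i.factorial *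
      (iteratedDeriv (m - i) (fun t : ℂ => (Complex.Gamma (l + t + 1))⁻¹) 0 /
        (m - i).factorial) := by
  have hfun : (fun t : ℂ => Complex.exp ((l + t) * y) * (Complex.Gamma (l + t + 1))⁻¹) =
      fun t : ℂ => Complex.exp (l * y) * (Complex.exp (y * t) * (Complex.Gamma (l + t + 1))⁻¹) := by
    funext t
    rw [← mul_assoc, ← Complex.exp_add]
    ring_nf
  rw [taylorCoeff, hfun, iteratedDeriv_const_mul_field, mul_div_assoc]
  congr 1
  rw [iteratedDeriv_fun_mul (by fun_prop) (contDiff_inv_Gamma l).contDiffAt, Finset.sum_div]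
  refine Finset.sum_congr rfl fun i hi => ?_
  have him : i ≤ m := Nat.lt_succ_iff.1 (Finset.mem_range.1 hi)
  rw [iteratedDeriv_cexp_const_mul]
  beta_reduce
  rw [mul_zero, Complex.exp_zero, mul_one,
    Nat.cast_choose ℂ him]
  have h1 : (m.factorial : ℂ) ≠ 0 := by exact_mod_cast m.factorial_ne_zero
  field_simp

/-- The derivative of `x ^ (l + t) / Γ(l + t + 1)` in `log x` is its product by `l + t`. -/
theorem hasDerivAt_taylorCoeff (l y : ℂ) (m : ℕ) :
    HasDerivAt (fun y => taylorCoeff l y m) (Complex.exp y * taylorCoeff (l - 1) y m) y := by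
  rw [← linear_mul_taylorCoeff]
  set c : ℕ → ℂ := fun j =>
    iteratedDeriv j (fun t : ℂ => (Complex.Gamma (l + t + 1))⁻¹) 0 / j.factorial with hc
  have hexp : HasDerivAt (fun y : ℂ => Complex.exp (l * y)) (Complex.exp (l * y) * l) y := by
    simpa using ((hasDerivAt_id y).const_mul l).cexp
  cases m with
  | zero =>
    simp only [taylorCoeff_eq_sum, taylorCoeffPred]
    refine ((hexp.mul_const (c 0)).congr_deriv ?_).congr_of_eventuallyEq
      (Filter.Eventually.of_forall fun y => ?_)
    · simp [hc]; ring
    · simp [hc]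
  | succ m =>
    have hsum : HasDerivAt (fun y : ℂ => ∑ i ∈ Finset.range (m + 1 + 1), y ^ i / i.factorial *
        c (m + 1 - i)) (∑ i ∈ Finset.range (m + 1), y ^ i / i.factorial * c (m - i)) y := by
      have hterm : ∀ i, HasDerivAt
          (fun y : ℂ => y ^ (i + 1) / (i + 1).factorial * c (m + 1 - (i + 1)))
          (y ^ i / i.factorial * c (m - i)) y := by
        intro i
        refine (((hasDerivAt_pow (i + 1) y).div_const ((i + 1).factorial : ℂ)).mul_const
          (c (m + 1 - (i + 1)))).congr_deriv ?_
        have : (i.factorial : ℂ) ≠ 0 := by exact_mod_cast i.factorial_ne_zero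
        have : (i : ℂ) + 1 ≠ 0 := by exact_mod_cast i.succ_ne_zero
        rw [Nat.factorial_succ, Nat.add_sub_add_right]
        push_cast
        field_simp
        rw [Nat.sub_zero, mul_comm]
      simp only [Finset.sum_range_succ' _ (m + 1), pow_zero]
      exact HasDerivAt.add_const _ (HasDerivAt.fun_sum fun i _ => hterm i)
    have := hexp.mul hsum
    simp only [taylorCoeffPred, taylorCoeff_eq_sum]
    refine this.congr_deriv ?_
    ring

/-! ### Growth of the coefficients -/

theorem norm_taylorCoeff_le (l y : ℂ) (m : ℕ) {C : ℝ}
    (hC : ∀ t : ℂ, ‖t‖ = 1 →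
      ‖Complex.exp ((l + t) * y) * (Complex.Gamma (l + t + 1))⁻¹‖ ≤ C) :
    ‖taylorCoeff l y m‖ ≤ C := by
  have h := Complex.norm_iteratedDeriv_le_of_forall_mem_sphere_norm_le (c := 0) (R := 1) (C := C) m
    one_pos (((contDiff_taylorFun l y (n := 1)).differentiable one_ne_zero).diffContOnCl)
    (fun t ht => hC t (by simpa using ht))
  rw [taylorCoeff, norm_div, Complex.norm_natCast, div_le_iff₀ (by positivity)]
  simpa [mul_comm] using h

theorem exists_bound_inv_Gamma (l : ℂ) :
    ∃ C : ℝ, ∀ t : ℂ, ‖t‖ = 1 → ‖(Complex.Gamma (l + t + 1))⁻¹‖ ≤ C := by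
  obtain ⟨C, hC⟩ := (isCompact_sphere (0 : ℂ) 1).exists_bound_of_continuousOn
    (contDiff_inv_Gamma l (n := 0)).continuous.continuousOn
  exact ⟨C, fun t ht => hC t (by simpa using ht)⟩

/-- A sequence that is nonincreasing from some index on is bounded, uniformly in parameters. -/
theorem exists_bound_of_eventually_antitone {ι : Type*} (S : Set ι) (f : ℕ → ι → ℝ)
    (hb : ∀ n, ∃ C, ∀ t ∈ S, f n t ≤ C) {M : ℕ}
    (hf : ∀ n, M ≤ n → ∀ t ∈ S, f (n + 1) t ≤ f n t) : ∃ A : ℝ, 0 < A ∧ ∀ n, ∀ t ∈ S, f n t ≤ A := by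
  choose C hC using hb
  have hle : ∀ n ≤ M, ∀ t ∈ S, f n t ≤ ∑ i ∈ Finset.range (M + 1), |C i| + 1 := by
    intro n hn t ht
    have h1 : |C n| ≤ ∑ i ∈ Finset.range (M + 1), |C i| :=
      Finset.single_le_sum (f := fun i => |C i|) (fun i _ => abs_nonneg _) (by simp; omega)
    linarith [hC n t ht, le_abs_self (C n)]
  refine ⟨∑ i ∈ Finset.range (M + 1), |C i| + 1, by positivity, fun n => ?_⟩
  rcases le_total n M with h | h
  · exact hle n h
  · induction n, h using Nat.le_induction with
    | base => exact hle M le_rfl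
    | succ n hn ih => exact fun t ht => (hf n hn t ht).trans (ih t ht)

theorem exists_bound_inv_Gamma_add_nat (a : ℂ) :
    ∃ A : ℝ, 0 < A ∧ ∀ (n : ℕ) (t : ℂ), ‖t‖ = 1 →
      ‖(Complex.Gamma (a + n + t + 1))⁻¹‖ ≤ A * (4 ^ n / n.factorial) := by
  obtain ⟨M, hM⟩ := exists_nat_gt (‖a‖ + 2)
  obtain ⟨A, hA, h⟩ : ∃ A : ℝ, 0 < A ∧ ∀ n : ℕ, ∀ t ∈ {t : ℂ | ‖t‖ = 1},
      ‖(Complex.Gamma (a + n + t + 1))⁻¹‖ * (n.factorial / 4 ^ n) ≤ A := by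
    refine exists_bound_of_eventually_antitone _ _ (M := 2 * M) ?_ ?_
    · intro n
      obtain ⟨C, hC⟩ := exists_bound_inv_Gamma (a + n)
      exact ⟨C * (n.factorial / 4 ^ n), fun t ht =>
        mul_le_mul_of_nonneg_right (hC t ht) (by positivity)⟩
    · intro n hn t ht
      simp only [Set.mem_ofPred_eq] at ht
      have hn' : (2 * M : ℝ) ≤ n := by exact_mod_cast hn
      have hM2 : (2 : ℝ) < M := by linarith [norm_nonneg a]
      have hnorm : ((n : ℝ) + 1) / 4 ≤ ‖a + n + t + 1‖ := by
        have h1 : ‖(n : ℂ)‖ ≤ ‖a + n + t + 1‖ + ‖a + t + 1‖ := by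
          have := norm_sub_le (a + n + t + 1) (a + t + 1)
          have e : a + n + t + 1 - (a + t + 1) = (n : ℂ) := by ring
          rwa [e] at this
        have h2 : ‖a + t + 1‖ ≤ ‖a‖ + 2 := by
          have := norm_add₃_le (a := a) (b := t) (c := 1)
          rw [ht, norm_one] at this
          linarith
        rw [Complex.norm_natCast] at h1
        linarith
      have hrec := Complex.one_div_Gamma_eq_self_mul_one_div_Gamma_add_one (a + n + t + 1)
      have e : a + ((n + 1 : ℕ) : ℂ) + t + 1 = a + n + t + 1 + 1 := by push_cast; ring
      rw [e, hrec, norm_mul, Nat.factorial_succ, pow_succ]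
      push_cast
      have : ‖(Complex.Gamma (a + n + t + 1 + 1))⁻¹‖ * (((n : ℝ) + 1) * n.factorial / (4 ^ n * 4)) =
          (((n : ℝ) + 1) / 4) * (‖(Complex.Gamma (a + n + t + 1 + 1))⁻¹‖ * (n.factorial / 4 ^ n)) := by
        ring
      rw [this, mul_assoc ‖a + n + t + 1‖]
      exact mul_le_mul_of_nonneg_right hnorm (by positivity)
  refine ⟨A, hA, fun n t ht => ?_⟩
  have := h n t ht
  rwa [← div_le_iff₀ (by positivity), div_div_eq_mul_div, mul_div_assoc]

theorem exists_bound_inv_Gamma_sub_nat (a : ℂ) :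
    ∃ A : ℝ, 0 < A ∧ ∀ (n : ℕ) (t : ℂ), ‖t‖ = 1 →
      ‖(Complex.Gamma (a - n + t + 1))⁻¹‖ ≤ A * (4 ^ n * n.factorial) := by
  obtain ⟨M, hM⟩ := exists_nat_gt (‖a‖ + 2)
  obtain ⟨A, hA, h⟩ : ∃ A : ℝ, 0 < A ∧ ∀ n : ℕ, ∀ t ∈ {t : ℂ | ‖t‖ = 1},
      ‖(Complex.Gamma (a - n + t + 1))⁻¹‖ / (4 ^ n * n.factorial) ≤ A := by
    refine exists_bound_of_eventually_antitone _ _ (M := M) ?_ ?_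
    · intro n
      obtain ⟨C, hC⟩ := exists_bound_inv_Gamma (a - n)
      exact ⟨C / (4 ^ n * n.factorial), fun t ht =>
        div_le_div_of_nonneg_right (hC t ht) (by positivity)⟩
    · intro n hn t ht
      simp only [Set.mem_ofPred_eq] at ht
      have hn' : (M : ℝ) ≤ n := by exact_mod_cast hn
      have hnorm : ‖a - n + t‖ ≤ 4 * ((n : ℝ) + 1) := by
        have h1 := norm_add_le (a - n) t
        have h2 := norm_sub_le a n
        rw [Complex.norm_natCast] at h2
        linarith [Nat.cast_nonneg (α := ℝ) n]
      have hrec := Complex.one_div_Gamma_eq_self_mul_one_div_Gamma_add_one (a - n + t)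
      have e : a - ((n + 1 : ℕ) : ℂ) + t + 1 = a - n + t := by push_cast; ring
      rw [e, hrec, norm_mul, Nat.factorial_succ, pow_succ, div_le_div_iff₀ (by positivity)
        (by positivity)]
      push_cast
      have : ‖(Complex.Gamma (a - n + t + 1))⁻¹‖ * (4 ^ n * 4 * (((n : ℝ) + 1) * n.factorial)) =
          (4 * ((n : ℝ) + 1)) * (‖(Complex.Gamma (a - n + t + 1))⁻¹‖ * (4 ^ n * n.factorial)) := by
        ring
      rw [this, mul_assoc ‖a - n + t‖]
      exact mul_le_mul_of_nonneg_right hnorm (by positivity)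
  refine ⟨A, hA, fun n t ht => ?_⟩
  have := h n t ht
  rwa [div_le_iff₀ (by positivity)] at this

/-- Up to an exponential factor, `1 / Γ(a + z + 1)` grows like `1 / z!` for `z ≥ 0` and like
`|z|!` for `z ≤ 0`. -/
theorem exists_bound_inv_Gamma_add_int (a : ℂ) :
    ∃ A : ℝ, 0 < A ∧ ∀ (z : ℤ) (t : ℂ), ‖t‖ = 1 → ‖(Complex.Gamma (a + z + t + 1))⁻¹‖ ≤
      A * (4 ^ z.natAbs * ((-z).toNat.factorial / z.toNat.factorial)) := by
  obtain ⟨A, hA, h⟩ := exists_bound_inv_Gamma_add_nat a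
  obtain ⟨B, hB, h'⟩ := exists_bound_inv_Gamma_sub_nat a
  refine ⟨max A B, lt_max_of_lt_left hA, fun z t ht => ?_⟩
  obtain ⟨n, rfl | rfl⟩ := z.eq_nat_or_neg
  · refine (Eq.trans_le ?_ (h n t ht)).trans ?_
    · push_cast; rfl
    · simp only [Int.natAbs_natCast, Int.toNat_natCast, Int.toNat_neg_natCast, Nat.factorial_zero,
        Nat.cast_one]
      rw [mul_one_div]
      exact mul_le_mul_of_nonneg_right (le_max_left _ _) (by positivity)
  · refine (Eq.trans_le ?_ (h' n t ht)).trans ?_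
    · push_cast; rw [← sub_eq_add_neg]
    · simp only [Int.natAbs_neg, Int.natAbs_natCast, neg_neg, Int.toNat_natCast,
        Int.toNat_neg_natCast, Nat.factorial_zero, Nat.cast_one, div_one]
      exact mul_le_mul_of_nonneg_right (le_max_right _ _) (by positivity)

theorem factorial_add_le (a b : ℕ) :
    (a + b).factorial ≤ 2 ^ (a + b) * (a.factorial * b.factorial) := by
  rw [← Nat.add_choose_mul_factorial_mul_factorial, mul_assoc]
  exact Nat.mul_le_mul_right _ (Nat.choose_le_two_pow _ _)

theorem factorial_sum_le {ι : Type*} (s : Finset ι) (p : ι → ℕ) :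
    (∑ i ∈ s, p i).factorial ≤ 2 ^ (s.card * ∑ i ∈ s, p i) * ∏ i ∈ s, (p i).factorial := by
  classical
  induction s using Finset.induction_on with
  | empty => simp
  | insert a s ha ih =>
    rw [Finset.sum_insert ha, Finset.prod_insert ha, Finset.card_insert_of_notMem ha]
    calc (p a + ∑ i ∈ s, p i).factorial
        ≤ 2 ^ (p a + ∑ i ∈ s, p i) * ((p a).factorial * (∑ i ∈ s, p i).factorial) :=
          factorial_add_le _ _
      _ ≤ 2 ^ (p a + ∑ i ∈ s, p i) * ((p a).factorial *
          (2 ^ (s.card * ∑ i ∈ s, p i) * ∏ i ∈ s, (p i).factorial)) := by gcongr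
      _ = 2 ^ (p a + ∑ i ∈ s, p i + s.card * ∑ i ∈ s, p i) *
          ((p a).factorial * ∏ i ∈ s, (p i).factorial) := by rw [pow_add]; ring
      _ ≤ _ := by
          gcongr
          · norm_num
          · nlinarith [Nat.zero_le (s.card * p a)]

/-- When the sum of the `z_i` is prescribed, the factorials of their positive and negative parts
balance each other up to an exponential factor. -/
theorem prod_factorial_le {k : ℕ} (s : ℤ) (z : Fin k → ℤ) (hz : ∑ i, z i = s) :
    ∏ i, ((-z i).toNat.factorial / (z i).toNat.factorial : ℝ) ≤
      (2 ^ s.natAbs * s.natAbs.factorial) * (2 ^ (k + 1)) ^ (∑ i, (z i).natAbs) := by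
  set P := ∑ i, (z i).toNat with hP
  set Q := ∑ i, (-z i).toNat with hQ
  have hPQ : (P : ℤ) - Q = s := by
    rw [← hz, hP, hQ]
    push_cast
    rw [← Finset.sum_sub_distrib]
    refine Finset.sum_congr rfl fun i _ => ?_
    omega
  have hQle : Q ≤ P + s.natAbs := by omega
  have hPle : P ≤ ∑ i, (z i).natAbs := Finset.sum_le_sum fun i _ => by omega
  rw [Finset.prod_div_distrib, div_le_iff₀ (Finset.prod_pos fun i _ => by positivity)]
  have h1 : ∏ i, (-z i).toNat.factorial ≤ Q.factorial :=
    Nat.le_of_dvd (Nat.factorial_pos _) (Nat.prod_factorial_dvd_factorial_sum _ _)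
  have h2 := factorial_sum_le Finset.univ fun i => (z i).toNat
  rw [← hP, Finset.card_univ, Fintype.card_fin] at h2
  have h3 : ∏ i, (-z i).toNat.factorial ≤ (2 ^ s.natAbs * s.natAbs.factorial) *
      (2 ^ (k + 1)) ^ (∑ i, (z i).natAbs) * ∏ i, (z i).toNat.factorial := by
    calc ∏ i, (-z i).toNat.factorial ≤ Q.factorial := h1
      _ ≤ (P + s.natAbs).factorial := Nat.factorial_le hQle
      _ ≤ 2 ^ (P + s.natAbs) * (P.factorial * s.natAbs.factorial) := factorial_add_le _ _
      _ ≤ 2 ^ (P + s.natAbs) * ((2 ^ (k * P) * ∏ i, (z i).toNat.factorial) *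
          s.natAbs.factorial) := by gcongr
      _ = (2 ^ s.natAbs * s.natAbs.factorial) * (2 ^ (k + 1)) ^ P *
          ∏ i, (z i).toNat.factorial := by rw [← pow_mul, pow_add]; ring
      _ ≤ _ := by
        gcongr
        exact Nat.one_le_two_pow
  exact_mod_cast h3

theorem exists_bound_prod_taylorCoeff {k : ℕ} (α : Fin k → ℂ) (s : ℤ) :
    ∃ A : ℝ, 0 < A ∧ ∀ z : Fin k → ℤ, ∑ i, z i = s → ∀ (y : Fin k → ℂ) (m : Fin k → ℕ),
      ‖∏ i, taylorCoeff (α i + z i) (y i) (m i)‖ ≤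
        A * (2 ^ (k + 3)) ^ (∑ i, (z i).natAbs) *
          Real.exp (∑ i, (‖α i‖ + 1) * ‖y i‖ + ∑ i, z i * (y i).re) := by
  choose A hA hb using fun i => exists_bound_inv_Gamma_add_int (α i)
  refine ⟨(∏ i, A i) * (2 ^ s.natAbs * s.natAbs.factorial),
    mul_pos (Finset.prod_pos fun i _ => hA i) (by positivity), fun z hz y m => ?_⟩
  have hone : ∀ i, ‖taylorCoeff (α i + z i) (y i) (m i)‖ ≤
      Real.exp ((‖α i‖ + 1) * ‖y i‖ + z i * (y i).re) *
        (A i * (4 ^ (z i).natAbs * ((-z i).toNat.factorial / (z i).toNat.factorial))) := by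
    intro i
    refine norm_taylorCoeff_le _ _ _ fun t ht => ?_
    rw [norm_mul]
    refine mul_le_mul ?_ (hb i (z i) t ht) (norm_nonneg _) (Real.exp_pos _).le
    rw [Complex.norm_exp, Real.exp_le_exp]
    have e : (α i + z i + t) * y i = (α i + t) * y i + ((z i : ℝ) : ℂ) * y i := by
      push_cast; ring
    rw [e, Complex.add_re, Complex.re_ofReal_mul]
    refine add_le_add_left ((Complex.re_le_norm _).trans ?_) _
    rw [norm_mul]
    refine mul_le_mul_of_nonneg_right ((norm_add_le _ _).trans ?_) (norm_nonneg _)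
    rw [ht]
  rw [norm_prod]
  refine (Finset.prod_le_prod (fun i _ => norm_nonneg _) fun i _ => hone i).trans ?_
  rw [Finset.prod_mul_distrib, Finset.prod_mul_distrib, Finset.prod_mul_distrib,
    ← Real.exp_sum, Finset.sum_add_distrib, Finset.prod_pow_eq_pow_sum]
  rw [mul_comm]
  refine mul_le_mul_of_nonneg_right ?_ (Real.exp_pos _).le
  rw [mul_assoc (∏ i, A i)]
  refine mul_le_mul_of_nonneg_left ?_ (Finset.prod_nonneg fun i _ => (hA i).le)
  calc (4 : ℝ) ^ (∑ i, (z i).natAbs) *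
        ∏ i, ((-z i).toNat.factorial / (z i).toNat.factorial : ℝ)
      ≤ 4 ^ (∑ i, (z i).natAbs) * ((2 ^ s.natAbs * s.natAbs.factorial) *
        (2 ^ (k + 1)) ^ (∑ i, (z i).natAbs)) := by
        gcongr
        exact prod_factorial_le s z hz
    _ = _ := by
        rw [show (2 : ℝ) ^ (k + 3) = 4 * 2 ^ (k + 1) by ring, mul_pow]
        ring

end

section

variable {N : Type*} [AddCommGroup N] {k : ℕ}
variable {v : Fin k → N} {T : Set (Finset (Fin k))}

/-! ### The secondary cone -/

/-- `κ I j` are the coordinates of `v_j` with respect to the generators of the maximal cone `I`. -/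
def IsCoordMatrix (v : Fin k → N) (T : Set (Finset (Fin k)))
    (κ : Finset (Fin k) → Fin k → Fin k → ℝ) : Prop :=
  ∀ I, IsMaxCone T I → ∀ j, supp (κ I j) ⊆ I ∧ emb ℝ (v j) = pt v (κ I j)

theorem IsRegularTriangulation.exists_isCoordMatrix (hT : IsRegularTriangulation v T) :
    ∃ κ, IsCoordMatrix v T κ := by
  have h : ∀ (I : Finset (Fin k)) (j : Fin k), ∃ q : Fin k → ℝ, IsMaxCone T I →
      supp q ⊆ I ∧ emb ℝ (v j) = pt v q := by
    intro I j
    by_cases hI : IsMaxCone T I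
    · obtain ⟨q, hq⟩ := hT.exists_coord_generator hI j
      exact ⟨q, fun _ => hq⟩
    · exact ⟨0, fun h => absurd h hI⟩
  choose κ hκ using h
  exact ⟨κ, fun I hI j => hκ I j hI⟩

theorem IsCoordMatrix.map_eq {κ : Finset (Fin k) → Fin k → Fin k → ℝ}
    (hκ : IsCoordMatrix v T κ) {I : Finset (Fin k)} (hI : IsMaxCone T I)
    {ψ : (ℝ ⊗[ℤ] N) →ₗ[ℝ] ℝ} {ω : Fin k → ℝ} (hψ : ∀ i ∈ I, ψ (emb ℝ (v i)) = ω i) (j : Fin k) :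
    ψ (emb ℝ (v j)) = ∑ i, κ I j i * ω i := by
  obtain ⟨hs, he⟩ := hκ I hI j
  rw [he, map_pt]
  refine Finset.sum_congr rfl fun i _ => ?_
  by_cases hi : i ∈ I
  · rw [hψ i hi]
  · rw [notMem_supp.1 fun h => hi (hs h), zero_mul, zero_mul]

/-- The secondary cone is cut out by finitely many strict linear inequalities. -/
theorem IsCoordMatrix.mem_secondaryCone_iff {κ : Finset (Fin k) → Fin k → Fin k → ℝ}
    (hκ : IsCoordMatrix v T κ) (hT : IsRegularTriangulation v T)
    (hgen : AddSubgroup.closure (Set.range v) = ⊤) (ω : Fin k → ℝ) :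
    ω ∈ secondaryCone v T ↔
      ∀ I, IsMaxCone T I → ∀ j, j ∉ I → ∑ i, κ I j i * ω i < ω j := by
  constructor
  · intro h I hI j hj
    obtain ⟨ψ, h1, h2⟩ := h I hI
    rw [← hκ.map_eq hI h1]
    exact h2 j hj
  · intro h I hI
    obtain ⟨ψ, hψ⟩ := hT.exists_interpolation hgen hI ω
    exact ⟨ψ, hψ, fun j hj => by rw [hκ.map_eq hI hψ]; exact h I hI j hj⟩

theorem isOpen_secondaryCone (hT : IsRegularTriangulation v T)
    (hgen : AddSubgroup.closure (Set.range v) = ⊤) : IsOpen (secondaryCone v T) := by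
  obtain ⟨κ, hκ⟩ := hT.exists_isCoordMatrix
  have : secondaryCone v T = ⋂ I, ⋂ j, {ω : Fin k → ℝ | IsMaxCone T I → j ∉ I →
      ∑ i, κ I j i * ω i < ω j} := by
    ext ω
    rw [hκ.mem_secondaryCone_iff hT hgen]
    simp only [Set.mem_iInter, Set.mem_ofPred_eq]
    exact ⟨fun h I j hI hj => h I hI j hj, fun h I hI j hj => h I j hI hj⟩
  rw [this]
  refine isOpen_iInter_of_finite fun I => isOpen_iInter_of_finite fun j => ?_
  by_cases hI : IsMaxCone T I
  · by_cases hj : j ∈ I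
    · simp [hj]
    · simpa only [hI, hj, not_false_eq_true, forall_const] using
        isOpen_lt (by fun_prop) (by fun_prop)
  · simp [hI]

/-- Far inside the secondary cone, the strict inequalities that define it hold with a margin as
large as desired. -/
theorem IsCoordMatrix.exists_margin {κ : Finset (Fin k) → Fin k → Fin k → ℝ}
    (hκ : IsCoordMatrix v T κ) (hT : IsRegularTriangulation v T)
    (hgen : AddSubgroup.closure (Set.range v) = ⊤) (R : ℝ) :
    ∃ c : Fin k → ℝ, ∀ ω : Fin k → ℝ, ω - c ∈ secondaryCone v T →
      ∀ I, IsMaxCone T I → ∀ j, j ∉ I → R ≤ ω j - ∑ i, κ I j i * ω i := by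
  obtain ⟨ω₀, h₀⟩ := hT.regular
  rw [hκ.mem_secondaryCone_iff hT hgen] at h₀
  have hex : ∀ᶠ r : ℝ in Filter.atTop, ∀ I, ∀ j, IsMaxCone T I → j ∉ I →
      R ≤ r * (ω₀ j - ∑ i, κ I j i * ω₀ i) := by
    refine Filter.eventually_all.2 fun I => Filter.eventually_all.2 fun j => ?_
    by_cases hI : IsMaxCone T I
    · by_cases hj : j ∈ I
      · simp [hj]
      · have hpos : 0 < ω₀ j - ∑ i, κ I j i * ω₀ i := sub_pos.2 (h₀ I hI j hj)
        filter_upwards [(Filter.tendsto_id.atTop_mul_const hpos).eventually_ge_atTop R]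
          with r hr _ _ using hr
    · simp [hI]
  obtain ⟨r, hr⟩ := hex.exists
  refine ⟨r • ω₀, fun ω hω I hI j hj => (hr I j hI hj).trans ?_⟩
  have h1 := (hκ.mem_secondaryCone_iff hT hgen _).1 hω I hI j hj
  simp only [Pi.sub_apply, Pi.smul_apply, smul_eq_mul, mul_sub, Finset.sum_sub_distrib] at h1
  have h2 : r * ∑ i, κ I j i * ω₀ i = ∑ i, κ I j i * (r * ω₀ i) := by
    rw [Finset.mul_sum]
    exact Finset.sum_congr rfl fun i _ => by ring
  rw [mul_sub, h2]
  linarith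

/-- An integral relation is determined by its entries outside of a maximal cone. -/
theorem IsCoordMatrix.eq_add_sum {κ : Finset (Fin k) → Fin k → Fin k → ℝ}
    (hκ : IsCoordMatrix v T κ) (hT : IsRegularTriangulation v T) {I : Finset (Fin k)}
    (hI : IsMaxCone T I) {γ z : Fin k → ℝ} (hγ : supp γ ⊆ I) (h : pt v z = pt v γ) :
    z = γ + ∑ j ∈ Finset.univ \ I, z j • (Pi.single j 1 - κ I j) := by
  classical
  rw [← sub_eq_iff_eq_add]
  refine hT.eq_of_pt_eq hI.prop (fun i hi => ?_) hγ ?_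
  · by_contra hiI
    apply mem_supp.1 hi
    have hk : ∀ j, κ I j i = 0 := fun j => notMem_supp.1 fun h => hiI ((hκ I hI j).1 h)
    simp [Finset.sum_apply, hk, Pi.single_apply, hiI]
  · have hlin : ∀ s : Finset (Fin k),
        pt v (∑ j ∈ s, z j • (Pi.single j 1 - κ I j)) = 0 := by
      intro s
      induction s using Finset.induction_on with
      | empty => simp [pt]
      | insert a s ha ih =>
        rw [Finset.sum_insert ha, pt_add, ih, pt_smul, pt_sub, pt_single, ← (hκ I hI a).2]
        simp
    rw [pt_sub, hlin, sub_zero, h]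

/-- The exponential decay of the monomials beats any given exponential growth when `ω` lies far
inside the secondary cone. -/
theorem IsCoordMatrix.pow_mul_exp_le {κ : Finset (Fin k) → Fin k → Fin k → ℝ}
    (hκ : IsCoordMatrix v T κ) (hT : IsRegularTriangulation v T) {I : Finset (Fin k)}
    (hI : IsMaxCone T I) {γ : Fin k → ℝ} (hγ : supp γ ⊆ I) {z : Fin k → ℤ}
    (h : pt v (fun i => (z i : ℝ)) = pt v γ) (hz : ∀ j, j ∉ I → 0 ≤ z j) {B : ℝ} (hB : 1 ≤ B)
    {D : ℝ} (hD : ∀ j, 1 + ∑ i, |κ I j i| ≤ D) {ω : Fin k → ℝ}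
    (hω : ∀ j, j ∉ I → D * Real.log (2 * B) ≤ ω j - ∑ i, κ I j i * ω i) :
    B ^ (∑ i, (z i).natAbs) * Real.exp (-∑ i, z i * ω i) ≤
      Real.exp ((∑ i, |γ i|) * Real.log (2 * B) - ∑ i, γ i * ω i) *
        (1 / 2) ^ (∑ i, (z i).natAbs) := by
  classical
  set n := ∑ i, (z i).natAbs with hn
  set S : ℝ := ∑ j ∈ Finset.univ \ I, (z j : ℝ) with hS
  have hzj : ∀ j ∈ Finset.univ \ I, (0 : ℝ) ≤ z j := fun j hj => by
    exact_mod_cast hz j (by simpa using hj)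
  have hzi : ∀ i, (z i : ℝ) = γ i + ∑ j ∈ Finset.univ \ I,
      (z j : ℝ) * ((Pi.single j 1 : Fin k → ℝ) i - κ I j i) := by
    intro i
    have := congrFun (hκ.eq_add_sum hT hI hγ h) i
    simpa [Finset.sum_apply] using this
  have hlog : 0 ≤ Real.log (2 * B) := Real.log_nonneg (by linarith)
  have hsum : ∑ i, γ i * ω i + D * Real.log (2 * B) * S ≤ ∑ i, z i * ω i := by
    have e : ∑ i, z i * ω i = ∑ i, γ i * ω i +
        ∑ j ∈ Finset.univ \ I, z j * (ω j - ∑ i, κ I j i * ω i) := by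
      have e1 : ∀ i, z i * ω i = γ i * ω i + ∑ j ∈ Finset.univ \ I,
          (z j : ℝ) * ((Pi.single j 1 : Fin k → ℝ) i * ω i - κ I j i * ω i) := by
        intro i
        conv_lhs => rw [hzi i, add_mul, Finset.sum_mul]
        simp only [mul_assoc, sub_mul]
      rw [Finset.sum_congr rfl fun i _ => e1 i, Finset.sum_add_distrib, Finset.sum_comm]
      congr 1
      refine Finset.sum_congr rfl fun j _ => ?_
      rw [← Finset.mul_sum, Finset.sum_sub_distrib]
      simp [Pi.single_apply]
    rw [e, hS, Finset.mul_sum]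
    refine add_le_add_right (Finset.sum_le_sum fun j hj => ?_) _
    rw [mul_comm]
    exact mul_le_mul_of_nonneg_left (hω j (by simpa using hj)) (hzj j hj)
  have hnle : (n : ℝ) ≤ ∑ i, |γ i| + D * S := by
    have e : (n : ℝ) = ∑ i, |(z i : ℝ)| := by
      rw [hn]; push_cast; exact Finset.sum_congr rfl fun i _ => by
        rw [Nat.cast_natAbs, Int.cast_abs]
    have e1 : ∀ i, |(z i : ℝ)| ≤ |γ i| + ∑ j ∈ Finset.univ \ I,
        (z j : ℝ) * ((Pi.single j 1 : Fin k → ℝ) i + |κ I j i|) := by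
      intro i
      conv_lhs => rw [hzi i]
      refine (abs_add_le _ _).trans (add_le_add_right
        ((Finset.abs_sum_le_sum_abs _ _).trans (Finset.sum_le_sum fun j hj => ?_)) _)
      rw [abs_mul, abs_of_nonneg (hzj j hj)]
      refine mul_le_mul_of_nonneg_left ((abs_sub _ _).trans (add_le_add_left ?_ _)) (hzj j hj)
      rw [abs_of_nonneg ((Pi.single_nonneg.2 zero_le_one : (0 : Fin k → ℝ) ≤ _) i)]
    rw [e]
    refine (Finset.sum_le_sum fun i _ => e1 i).trans ?_
    rw [Finset.sum_add_distrib, Finset.sum_comm, hS, Finset.mul_sum]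
    refine add_le_add_right (Finset.sum_le_sum fun j hj => ?_) _
    rw [← Finset.mul_sum, Finset.sum_add_distrib, mul_comm]
    refine mul_le_mul_of_nonneg_right ?_ (hzj j hj)
    simpa using hD j
  have hpow : B ^ n = Real.exp (n * Real.log (2 * B)) * (1 / 2) ^ n := by
    rw [← Real.log_pow, Real.exp_log (by positivity), ← mul_pow]
    congr 1; ring
  rw [hpow, mul_right_comm, ← Real.exp_add]
  refine mul_le_mul_of_nonneg_right (Real.exp_le_exp.2 ?_) (by positivity)
  nlinarith [mul_le_mul_of_nonneg_right hnle hlog]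

/-! ### Convergence of the coefficient series -/

theorem summable_prod_of_nonneg {f : ℤ → ℝ} (hf : Summable f) (h0 : ∀ z, 0 ≤ f z) (n : ℕ) :
    Summable fun z : Fin n → ℤ => ∏ i, f (z i) := by
  induction n with
  | zero => exact (hasSum_fintype _).summable
  | succ n ih =>
    rw [← (Fin.consEquiv fun _ : Fin (n + 1) => ℤ).summable_iff]
    have := hf.mul_of_nonneg ih h0 fun z => Finset.prod_nonneg fun i _ => h0 _
    refine this.congr fun p => ?_
    simp [Fin.consEquiv, Fin.prod_univ_succ]

theorem summable_half_pow_natAbs (n : ℕ) :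
    Summable fun z : Fin n → ℤ => ((1 : ℝ) / 2) ^ (∑ i, (z i).natAbs) := by
  have h1 : Summable fun z : ℤ => ((1 : ℝ) / 2) ^ z.natAbs := by
    refine Summable.of_nat_of_neg ?_ ?_ <;>
    simpa using summable_geometric_two
  refine (summable_prod_of_nonneg h1 (fun z => by positivity) n).congr fun z => ?_
  rw [Finset.prod_pow_eq_pow_sum]

/-- The logarithms of the points of the region of convergence. -/
def regionLog (v : Fin k → N) (T : Set (Finset (Fin k))) (c : Fin k → ℝ) : Set (Fin k → ℂ) :=
  {y | (fun i => -(y i).re - c i) ∈ secondaryCone v T}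

theorem isOpen_regionLog (hT : IsRegularTriangulation v T)
    (hgen : AddSubgroup.closure (Set.range v) = ⊤) (c : Fin k → ℝ) :
    IsOpen (regionLog v T c) :=
  (isOpen_secondaryCone hT hgen).preimage (by fun_prop)

/-- The shift vector `c` makes all the coefficient series converge, locally uniformly in the
logarithms. -/
def IsConvergenceShift (v : Fin k → N) (T : Set (Finset (Fin k))) (c : Fin k → ℝ) : Prop :=
  ∀ (β : ℂ ⊗[ℤ] N) (α : Fin k → ℂ) (m : Fin k → ℕ), supp α ∪ supp m ∈ T → ∀ (u : N) (Y : ℝ),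
    ∃ b : setL v β α u → ℝ, Summable b ∧ ∀ (l : setL v β α u), ∀ y ∈ regionLog v T c,
      (∀ i, ‖y i‖ ≤ Y) → ‖∏ i, taylorCoeff (l.1 i) (y i) (m i)‖ ≤ b l

theorem exists_isConvergenceShift (hT : IsRegularTriangulation v T)
    (hgen : AddSubgroup.closure (Set.range v) = ⊤)
    (hdeg : ∃ deg : N →+ ℤ, ∀ i, deg (v i) = 1) : ∃ c, IsConvergenceShift v T c := by
  obtain ⟨κ, hκ⟩ := hT.exists_isCoordMatrix
  obtain ⟨deg, hdeg⟩ := hdeg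
  -- `B` is the growth rate of the Gamma factors; `D` bounds the total size of a relation by its
  -- entries outside of a maximal cone, so a margin of `D * log (2 * B)` leaves a factor `1 / 2`.
  set B : ℝ := 2 ^ (k + 3) with hB
  have hB1 : 1 ≤ B := one_le_pow₀ (by norm_num)
  set D : ℝ := 1 + ∑ I, ∑ j, ∑ i, |κ I j i| with hD
  have hDle : ∀ I j, 1 + ∑ i, |κ I j i| ≤ D := by
    intro I j
    refine add_le_add_right ?_ _
    calc ∑ i, |κ I j i| ≤ ∑ j, ∑ i, |κ I j i| :=
          Finset.single_le_sum (f := fun j => ∑ i, |κ I j i|)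
            (fun j _ => Finset.sum_nonneg fun i _ => abs_nonneg _) (Finset.mem_univ j)
      _ ≤ _ := Finset.single_le_sum (f := fun I => ∑ j, ∑ i, |κ I j i|)
            (fun I _ => Finset.sum_nonneg fun j _ => Finset.sum_nonneg fun i _ => abs_nonneg _)
            (Finset.mem_univ I)
  obtain ⟨c, hc⟩ := hκ.exists_margin hT hgen (D * Real.log (2 * B))
  refine ⟨c, fun β α m hαm u Y => ?_⟩
  obtain ⟨I, hI, hsI⟩ := exists_isMaxCone hαm
  choose z hz using fun l : setL v β α u => l.2.2
  have hl : ∀ l : setL v β α u, ∀ i, l.1 i = α i + z l i := fun l i => by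
    rw [← hz l i]; ring
  -- all the `z` have the same image in `N ⊗ ℝ`, hence the same degree
  obtain ⟨γ, hγI, hγ⟩ := hT.exists_coord hgen hI
    (rePart (β - emb ℂ u - ∑ i, α i • emb ℂ (v i)))
  have hzγ : ∀ l, pt v (fun i => (z l i : ℝ)) = pt v γ := by
    intro l
    rw [← hγ, ← l.2.1, ← Finset.sum_sub_distrib]
    simp only [← sub_smul, hz]
    rw [rePart_sum_smul]
    simp
  have hs : ∀ l, ∑ i, z l i = ⌊extR deg.toIntLinearMap (pt v γ)⌋ := by
    intro l
    rw [← hzγ l, map_pt]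
    simp only [extR_emb, AddMonoidHom.coe_toIntLinearMap, hdeg, Int.cast_one, mul_one]
    rw [← Int.cast_sum, Int.floor_intCast]
  obtain ⟨A, hA, hbound⟩ := exists_bound_prod_taylorCoeff α
    ⌊extR deg.toIntLinearMap (pt v γ)⌋
  set E : ℝ := ∑ i, (‖α i‖ + 1) * Y + ((∑ i, |γ i|) * Real.log (2 * B) + ∑ i, |γ i| * Y) with hE
  have hzinj : Function.Injective z := by
    intro l l' h
    apply Subtype.ext
    funext i
    rw [hl, hl, h]
  refine ⟨fun l => A * Real.exp E * (1 / 2) ^ (∑ i, (z l i).natAbs),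
    ((summable_half_pow_natAbs k).comp_injective hzinj).mul_left _, fun l y hy hY => ?_⟩
  by_cases hne : ∏ i, taylorCoeff (l.1 i) (y i) (m i) = 0
  · rw [hne, norm_zero]; positivity
  -- outside of the cone the exponents of a nonzero term are nonnegative integers
  have hznn : ∀ j, j ∉ I → 0 ≤ z l j := by
    intro j hj
    by_contra! hlt
    have hαj : α j = 0 := notMem_supp.1 fun h => hj (hsI (Finset.mem_union_left _ h))
    have hmj : m j = 0 := notMem_supp.1 fun h => hj (hsI (Finset.mem_union_right _ h))
    refine hne (Finset.prod_eq_zero (Finset.mem_univ j) ?_)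
    rw [hmj]
    exact taylorCoeff_zero_of_neg _ (by rw [hl, hαj, zero_add]) hlt
  have hdecay := hκ.pow_mul_exp_le hT hI hγI (hzγ l) hznn hB1 (hDle I)
    (ω := fun i => -(y i).re) (fun j hj => hc _ hy I hI j hj)
  have h1 := hbound (z l) (hs l) y m
  simp only [← hl] at h1
  refine h1.trans ?_
  have e1 : ∑ i, (z l i : ℝ) * (y i).re = -∑ i, (z l i : ℝ) * -(y i).re := by
    simp
  rw [e1, Real.exp_add, mul_assoc, mul_left_comm (B ^ _)]
  calc A * (Real.exp (∑ i, (‖α i‖ + 1) * ‖y i‖) *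
        (B ^ (∑ i, (z l i).natAbs) * Real.exp (-∑ i, (z l i : ℝ) * -(y i).re)))
      ≤ A * (Real.exp (∑ i, (‖α i‖ + 1) * Y) *
        (Real.exp ((∑ i, |γ i|) * Real.log (2 * B) + ∑ i, |γ i| * Y) *
          (1 / 2) ^ (∑ i, (z l i).natAbs))) := by
        refine mul_le_mul_of_nonneg_left (mul_le_mul (Real.exp_le_exp.2 ?_) (hdecay.trans ?_)
          (by positivity) (by positivity)) hA.le
        · exact Finset.sum_le_sum fun i _ =>
            mul_le_mul_of_nonneg_left (hY i) (by positivity)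
        · refine mul_le_mul_of_nonneg_right (Real.exp_le_exp.2 ?_) (by positivity)
          rw [sub_eq_add_neg, ← Finset.sum_neg_distrib]
          refine add_le_add_right (Finset.sum_le_sum fun i _ => ?_) _
          rw [mul_neg, neg_neg]
          refine (le_abs_self _).trans ?_
          rw [abs_mul]
          exact mul_le_mul_of_nonneg_left ((Complex.abs_re_le_norm _).trans (hY i)) (abs_nonneg _)
    _ = _ := by rw [hE, Real.exp_add (∑ i, (‖α i‖ + 1) * Y)]; ring

end

section

variable {N : Type*} [AddCommGroup N] {k : ℕ}
variable {v : Fin k → N} {T : Set (Finset (Fin k))} {c : Fin k → ℝ}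
variable {β : ℂ ⊗[ℤ] N} {α : Fin k → ℂ} {m : Fin k → ℕ}

/-! ### Differential equations for the coefficient series -/

theorem sub_single_mem_setL {l : Fin k → ℂ} {u : N} (j : Fin k) :
    l - Pi.single j 1 ∈ setL v β α (u + v j) ↔ l ∈ setL v β α u := by
  have hsum : ∑ i, (l - (Pi.single j 1 : Fin k → ℂ)) i • emb ℂ (v i) =
      ∑ i, l i • emb ℂ (v i) - emb ℂ (v j) := by
    simp [sub_smul, Finset.sum_sub_distrib, Pi.single_apply]
  have hz : (∀ i, ∃ z : ℤ, (l - (Pi.single j 1 : Fin k → ℂ)) i - α i = z) ↔ ∀ i, ∃ z : ℤ, l i - α i = z := by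
    refine forall_congr' fun i => ?_
    obtain ⟨e, he⟩ : ∃ e : ℤ, (Pi.single j 1 : Fin k → ℂ) i = e := by
      by_cases hi : i = j
      · exact ⟨1, by simp [hi]⟩
      · exact ⟨0, by simp [hi]⟩
    rw [Pi.sub_apply, he]
    constructor
    · rintro ⟨z, hz⟩
      exact ⟨z + e, by push_cast; rw [← hz]; ring⟩
    · rintro ⟨z, hz⟩
      exact ⟨z - e, by push_cast; rw [← hz]; ring⟩
  change (_ ∧ _) ↔ (_ ∧ _)
  rw [hz, hsum, emb_add, ← sub_sub, sub_left_inj]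

/-- The bijection `l ↦ l - e_j` from `L(α, u)` to `L(α, u + v_j)`. -/
def setLShift (v : Fin k → N) (β : ℂ ⊗[ℤ] N) (α : Fin k → ℂ) (u : N) (j : Fin k) :
    setL v β α u ≃ setL v β α (u + v j) :=
  (Equiv.subRight (Pi.single j 1 : Fin k → ℂ)).subtypeEquiv fun _ =>
    (sub_single_mem_setL j).symm

/-- The terms of the coefficient series. -/
def coeffTerm (m : Fin k → ℕ) (l y : Fin k → ℂ) : ℂ := ∏ i, taylorCoeff (l i) (y i) (m i)

theorem coeffSeries_eq_tsum (u : N) (y : Fin k → ℂ) :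
    coeffSeries v β α m u y = ∑' l : setL v β α u, coeffTerm m l.1 y := rfl

theorem coeffSeries_shift (u : N) (j : Fin k) (y : Fin k → ℂ) :
    coeffSeries v β α m (u + v j) y =
      ∑' l : setL v β α u, coeffTerm m (l.1 - Pi.single j 1) y :=
  ((setLShift v β α u j).tsum_eq fun l => coeffTerm m l.1 y).symm

theorem IsConvergenceShift.summable (hc : IsConvergenceShift v T c)
    (hαm : supp α ∪ supp m ∈ T) (u : N) {y : Fin k → ℂ} (hy : y ∈ regionLog v T c) :
    Summable fun l : setL v β α u => coeffTerm m l.1 y := by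
  obtain ⟨b, hb, hle⟩ := hc β α m hαm u (∑ i, ‖y i‖)
  exact Summable.of_norm_bounded hb fun l => hle l y hy fun i =>
    Finset.single_le_sum (f := fun i => ‖y i‖) (fun i _ => norm_nonneg _) (Finset.mem_univ i)

theorem IsConvergenceShift.summable_shift (hc : IsConvergenceShift v T c)
    (hαm : supp α ∪ supp m ∈ T) (u : N) {y : Fin k → ℂ} (hy : y ∈ regionLog v T c) (j : Fin k) :
    Summable fun l : setL v β α u => coeffTerm m (l.1 - Pi.single j 1) y := by
  have h := hc.summable (β := β) hαm (u + v j) hy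
  exact (h.comp_injective (setLShift v β α u j).injective).congr fun l => rfl

theorem coeffTerm_sub_single (l y : Fin k → ℂ) (j : Fin k) :
    coeffTerm m (l - Pi.single j 1) y = taylorCoeff (l j - 1) (y j) (m j) *
      ∏ i ∈ Finset.univ.erase j, taylorCoeff (l i) (y i) (m i) := by
  rw [coeffTerm, ← Finset.mul_prod_erase _ _ (Finset.mem_univ j)]
  congr 1
  · simp
  · refine Finset.prod_congr rfl fun i hi => ?_
    simp [Finset.ne_of_mem_erase hi]

theorem hasFDerivAt_coeffTerm (l y : Fin k → ℂ) :
    HasFDerivAt (coeffTerm m l) (∑ j, (Complex.exp (y j) * coeffTerm m (l - Pi.single j 1) y) •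
      (ContinuousLinearMap.proj j : (Fin k → ℂ) →L[ℂ] ℂ)) y := by
  have h1 : ∀ i, HasFDerivAt (fun y : Fin k → ℂ => taylorCoeff (l i) (y i) (m i))
      ((Complex.exp (y i) * taylorCoeff (l i - 1) (y i) (m i)) •
        (ContinuousLinearMap.proj i : (Fin k → ℂ) →L[ℂ] ℂ)) y := by
    intro i
    have h := hasDerivAt_taylorCoeff (l i) (y i) (m i)
    exact HasDerivAt.comp_hasFDerivAt (f := fun y : Fin k → ℂ => y i) y h (hasFDerivAt_apply i y)
  refine (HasFDerivAt.finsetProd (u := Finset.univ) fun i _ => h1 i).congr_fderiv ?_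
  refine Finset.sum_congr rfl fun j _ => ?_
  rw [smul_smul, coeffTerm_sub_single]
  congr 1
  ring

/-- Termwise differentiation of the coefficient series. -/
theorem IsConvergenceShift.hasFDerivAt (hc : IsConvergenceShift v T c)
    (hT : IsRegularTriangulation v T) (hgen : AddSubgroup.closure (Set.range v) = ⊤)
    (hαm : supp α ∪ supp m ∈ T) (u : N) {y : Fin k → ℂ} (hy : y ∈ regionLog v T c) :
    HasFDerivAt (coeffSeries v β α m u)
      (∑ j, (Complex.exp (y j) * coeffSeries v β α m (u + v j) y) •
        (ContinuousLinearMap.proj j : (Fin k → ℂ) →L[ℂ] ℂ)) y := by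
  obtain ⟨r, hr, hball⟩ := Metric.isOpen_iff.1 (isOpen_regionLog hT hgen c) y hy
  set Y : ℝ := ‖y‖ + r with hYdef
  have hY : ∀ y' ∈ Metric.ball y r, ∀ i, ‖y' i‖ ≤ Y := fun y' hy' i => by
    have h1 := norm_le_pi_norm y' i
    have h2 := norm_le_norm_add_norm_sub' y' y
    rw [mem_ball_iff_norm] at hy'
    linarith
  choose b hb hle using fun j => hc β α m hαm (u + v j) Y
  have hsum : Summable fun l : setL v β α u =>
      ∑ j, Real.exp Y * b j (setLShift v β α u j l) :=
    summable_sum fun j _ => ((setLShift v β α u j).summable_iff.2 (hb j)).mul_left _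
  have key := hasFDerivAt_tsum_of_isPreconnected hsum Metric.isOpen_ball
    (convex_ball y r).isPreconnected
    (fun (l : setL v β α u) y' _ => hasFDerivAt_coeffTerm (m := m) l.1 y') ?_
    (Metric.mem_ball_self hr) (hc.summable hαm u hy) (Metric.mem_ball_self hr)
  · refine key.congr_fderiv ?_
    have hs : ∀ j, Summable fun l : setL v β α u =>
        (Complex.exp (y j) * coeffTerm m (l.1 - Pi.single j 1) y) •
          (ContinuousLinearMap.proj j : (Fin k → ℂ) →L[ℂ] ℂ) := fun j =>
      ((hc.summable_shift hαm u hy j).mul_left _).smul_const _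
    rw [Summable.tsum_finsetSum fun j _ => hs j]
    refine Finset.sum_congr rfl fun j _ => ?_
    rw [((hc.summable_shift hαm u hy j).mul_left _).tsum_smul_const, tsum_mul_left,
      coeffSeries_shift]
  · intro l y' hy'
    refine (norm_sum_le _ _).trans (Finset.sum_le_sum fun j _ => ?_)
    rw [norm_smul, norm_mul]
    have hproj : ‖(ContinuousLinearMap.proj j : (Fin k → ℂ) →L[ℂ] ℂ)‖ ≤ 1 :=
      ContinuousLinearMap.opNorm_le_bound _ zero_le_one fun x => by
        simpa using norm_le_pi_norm x j
    have hexp : ‖Complex.exp (y' j)‖ ≤ Real.exp Y := by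
      rw [Complex.norm_exp]
      exact Real.exp_le_exp.2 ((Complex.re_le_norm _).trans (hY y' hy' j))
    have hterm : ‖coeffTerm m (l.1 - Pi.single j 1) y'‖ ≤ b j (setLShift v β α u j l) :=
      hle j (setLShift v β α u j l) y' (hball hy') (hY y' hy')
    refine (mul_le_of_le_one_right (by positivity) hproj).trans ?_
    exact mul_le_mul hexp hterm (norm_nonneg _) (Real.exp_pos _).le

/-- The coefficient series with exponents `m - e_i`, understood to be `0` when `m_i = 0`. -/
def coeffSeriesPred (v : Fin k → N) (β : ℂ ⊗[ℤ] N) (α : Fin k → ℂ) (m : Fin k → ℕ) (u : N)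
    (y : Fin k → ℂ) (i : Fin k) : ℂ :=
  if m i = 0 then 0 else coeffSeries v β α (m - Pi.single i 1) u y

theorem exp_mul_coeffTerm (l y : Fin k → ℂ) (i : Fin k) :
    Complex.exp (y i) * coeffTerm m (l - Pi.single i 1) y =
      l i * coeffTerm m l y + if m i = 0 then 0 else coeffTerm (m - Pi.single i 1) l y := by
  have hpred : (if m i = 0 then 0 else coeffTerm (m - Pi.single i 1) l y) =
      taylorCoeffPred (l i) (y i) (m i) *
        ∏ j ∈ Finset.univ.erase i, taylorCoeff (l j) (y j) (m j) := by
    split_ifs with h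
    · rw [h, taylorCoeffPred, zero_mul]
    · obtain ⟨n, hn⟩ := Nat.exists_eq_succ_of_ne_zero h
      rw [coeffTerm, ← Finset.mul_prod_erase _ _ (Finset.mem_univ i)]
      congr 1
      · simp [hn, taylorCoeffPred]
      · refine Finset.prod_congr rfl fun j hj => ?_
        simp [Finset.ne_of_mem_erase hj]
  rw [hpred, coeffTerm_sub_single, ← mul_assoc, ← linear_mul_taylorCoeff, coeffTerm,
    ← Finset.mul_prod_erase _ _ (Finset.mem_univ i)]
  ring

theorem supp_sub_single_mem (hT : IsRegularTriangulation v T) (hαm : supp α ∪ supp m ∈ T)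
    (i : Fin k) : supp α ∪ supp (m - Pi.single i 1) ∈ T := by
  refine hT.face_mem _ hαm _ (Finset.union_subset_union subset_rfl fun j hj => ?_)
  rw [mem_supp] at hj ⊢
  intro h
  exact hj (by simp [h])

/-- The Euler equation, which holds up to the series with lowered exponents. -/
theorem IsConvergenceShift.euler (hc : IsConvergenceShift v T c)
    (hT : IsRegularTriangulation v T)
    (hαm : supp α ∪ supp m ∈ T) (u : N) {y : Fin k → ℂ} (hy : y ∈ regionLog v T c)
    (g : N →ₗ[ℤ] ℤ) :
    ∑ i, (g (v i) : ℂ) * (Complex.exp (y i) * coeffSeries v β α m (u + v i) y) =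
      extC g (β - emb ℂ u) * coeffSeries v β α m u y +
        ∑ i, (g (v i) : ℂ) * coeffSeriesPred v β α m u y i := by
  have hs := hc.summable (β := β) hαm u hy
  have hs1 := fun i => hc.summable_shift (β := β) hαm u hy i
  have hs2 : ∀ i, Summable fun l : setL v β α u =>
      if m i = 0 then 0 else coeffTerm (m - Pi.single i 1) l.1 y := by
    intro i
    split_ifs with h
    · exact summable_zero
    · exact hc.summable (supp_sub_single_mem hT hαm i) u hy
  have hpred : ∀ i, coeffSeriesPred v β α m u y i = ∑' l : setL v β α u,
      if m i = 0 then 0 else coeffTerm (m - Pi.single i 1) l.1 y := by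
    intro i
    rw [coeffSeriesPred]
    split_ifs with h
    · exact tsum_zero.symm
    · rfl
  have hL : ∑ i, (g (v i) : ℂ) * (Complex.exp (y i) * coeffSeries v β α m (u + v i) y) =
      ∑' l : setL v β α u, ∑ i, (g (v i) : ℂ) *
        (Complex.exp (y i) * coeffTerm m (l.1 - Pi.single i 1) y) := by
    rw [Summable.tsum_finsetSum fun i _ => ((hs1 i).mul_left _).mul_left _]
    refine Finset.sum_congr rfl fun i _ => ?_
    rw [tsum_mul_left, tsum_mul_left, coeffSeries_shift]
  have hR : ∑ i, (g (v i) : ℂ) * coeffSeriesPred v β α m u y i =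
      ∑' l : setL v β α u, ∑ i, (g (v i) : ℂ) *
        if m i = 0 then 0 else coeffTerm (m - Pi.single i 1) l.1 y := by
    rw [Summable.tsum_finsetSum fun i _ => (hs2 i).mul_left _]
    refine Finset.sum_congr rfl fun i _ => ?_
    rw [tsum_mul_left, hpred]
  rw [hL, hR, coeffSeries_eq_tsum, ← tsum_mul_left, ← Summable.tsum_add (hs.mul_left _)
    (summable_sum fun i _ => (hs2 i).mul_left _)]
  refine tsum_congr fun l => ?_
  have hl : extC g (β - emb ℂ u) = ∑ i, (g (v i) : ℂ) * l.1 i := by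
    rw [← l.2.1, map_sum]
    refine Finset.sum_congr rfl fun i _ => ?_
    rw [map_smul, extC_emb, smul_eq_mul, mul_comm]
  rw [hl, Finset.sum_mul, ← Finset.sum_add_distrib]
  refine Finset.sum_congr rfl fun i _ => ?_
  rw [exp_mul_coeffTerm]
  ring

/-! ### Logarithms -/

theorem isOpen_regionU (hT : IsRegularTriangulation v T)
    (hgen : AddSubgroup.closure (Set.range v) = ⊤) (c : Fin k → ℝ) :
    IsOpen (regionU v T c) := by
  have h1 : IsOpen {x : Fin k → ℂ | ∀ i, x i ≠ 0} := by
    have : {x : Fin k → ℂ | ∀ i, x i ≠ 0} = ⋂ i, {x | x i ≠ 0} := by ext; simp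
    rw [this]
    exact isOpen_iInter_of_finite fun i => isOpen_ne_fun (by fun_prop) (by fun_prop)
  refine ContinuousOn.isOpen_inter_preimage (f := fun (x : Fin k → ℂ) i => -Real.log ‖x i‖ - c i)
    ?_ h1 (isOpen_secondaryCone hT hgen)
  refine continuousOn_pi.2 fun i => ContinuousOn.sub (ContinuousOn.neg ?_) continuousOn_const
  exact ContinuousOn.log (by fun_prop) fun x hx => norm_ne_zero_iff.2 (hx i)

theorem regionU_nonempty (hT : IsRegularTriangulation v T) (c : Fin k → ℝ) :
    (regionU v T c).Nonempty := by
  obtain ⟨ω, hω⟩ := hT.regular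
  refine ⟨fun i => ((Real.exp (-(ω i + c i)) : ℝ) : ℂ), fun i => ?_, ?_⟩
  · exact Complex.ofReal_ne_zero.2 (Real.exp_pos _).ne'
  · convert hω using 2 with i
    rw [Complex.norm_real, Real.norm_eq_abs, abs_of_pos (Real.exp_pos _), Real.log_exp]
    ring

variable {W : Set (Fin k → ℂ)} {θ : (Fin k → ℂ) → Fin k → ℝ}

theorem logVec_mem_regionLog {x : Fin k → ℂ} (hx : x ∈ regionU v T c) :
    logVec θ x ∈ regionLog v T c := by
  have h := hx.2
  change (fun i => -(logVec θ x i).re - c i) ∈ secondaryCone v T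
  simpa [logVec] using h

theorem IsArgChoice.exp_logVec (hθ : IsArgChoice W θ) {x : Fin k → ℂ} (hx : x ∈ W)
    (hx0 : ∀ i, x i ≠ 0) (i : Fin k) : Complex.exp (logVec θ x i) = x i := by
  conv_rhs => rw [hθ.2 x hx i]
  rw [logVec, Complex.exp_add, ← Complex.ofReal_exp,
    Real.exp_log (norm_pos_iff.2 (hx0 i))]

/-- A continuous logarithm is holomorphic: near a point it differs from a branch of the principal
logarithm by a constant. -/
theorem IsArgChoice.hasFDerivAt_logVec (hθ : IsArgChoice W θ) (hW : IsOpen W)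
    (h0 : ∀ x ∈ W, ∀ i, x i ≠ 0) {x : Fin k → ℂ} (hx : x ∈ W) (i : Fin k) :
    HasFDerivAt (fun x => logVec θ x i)
      ((x i)⁻¹ • (ContinuousLinearMap.proj i : (Fin k → ℂ) →L[ℂ] ℂ)) x := by
  have hxi := h0 x hx i
  have hslit : x i / x i ∈ Complex.slitPlane := by rw [div_self hxi]; exact Complex.one_mem_slitPlane
  have hdiv : HasFDerivAt (fun x' : Fin k → ℂ => x' i / x i)
      ((x i)⁻¹ • (ContinuousLinearMap.proj i : (Fin k → ℂ) →L[ℂ] ℂ)) x := by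
    simpa [div_eq_inv_mul] using
      ((ContinuousLinearMap.proj i : (Fin k → ℂ) →L[ℂ] ℂ).hasFDerivAt (x := x)).const_mul (x i)⁻¹
  have hlog : HasFDerivAt (fun x' : Fin k → ℂ => logVec θ x i + Complex.log (x' i / x i))
      ((x i)⁻¹ • (ContinuousLinearMap.proj i : (Fin k → ℂ) →L[ℂ] ℂ)) x := by
    refine ((hdiv.clog hslit).const_add _).congr_fderiv ?_
    rw [div_self hxi, inv_one, one_smul]
  refine hlog.congr_of_eventuallyEq ?_
  have hcont : ContinuousAt (fun x' => logVec θ x' i) x := by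
    have h1 : ContinuousAt (fun x' => θ x' i) x :=
      (continuous_apply i).continuousAt.comp (hθ.1.continuousAt (hW.mem_nhds hx))
    have h2 : ContinuousAt (fun x' : Fin k → ℂ => Real.log ‖x' i‖) x :=
      ContinuousAt.log (continuous_apply i).norm.continuousAt (norm_ne_zero_iff.2 hxi)
    exact (Complex.continuous_ofReal.continuousAt.comp h2).add
      (continuousAt_const.mul (Complex.continuous_ofReal.continuousAt.comp h1))
  have hsub : ContinuousAt (fun x' : Fin k → ℂ =>
      logVec θ x' i - (logVec θ x i + Complex.log (x' i / x i))) x :=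
    hcont.sub hlog.continuousAt
  have hzero : logVec θ x i - (logVec θ x i + Complex.log (x i / x i)) = 0 := by
    rw [div_self hxi, Complex.log_one]; ring
  have hnear := hsub.norm.eventually_lt (continuousAt_const (y := 2 * Real.pi)) (by
    rw [hzero, norm_zero]; exact Real.two_pi_pos)
  filter_upwards [hnear, hW.mem_nhds hx] with x' hx' hx'W
  have hexp : Complex.exp (logVec θ x' i - (logVec θ x i + Complex.log (x' i / x i))) = 1 := by
    have hxi' := h0 x' hx'W i
    rw [Complex.exp_sub, Complex.exp_add, hθ.exp_logVec hx'W (h0 x' hx'W),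
      hθ.exp_logVec hx (h0 x hx), Complex.exp_log (div_ne_zero hxi' hxi)]
    field_simp
  obtain ⟨n, hn⟩ := Complex.exp_eq_one_iff.1 hexp
  have hn0 : n = 0 := by
    rw [hn, norm_mul, Complex.norm_intCast] at hx'
    have h2 : ‖(2 * Real.pi * Complex.I : ℂ)‖ = 2 * Real.pi := by
      simp [abs_of_pos Real.pi_pos]
    rw [h2] at hx'
    have h3 : |(n : ℝ)| < 1 := by
      by_contra! h
      nlinarith [Real.pi_pos]
    have h4 : |n| < 1 := by exact_mod_cast h3
    exact Int.abs_lt_one_iff.1 h4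
  rw [hn0, Int.cast_zero, zero_mul] at hn
  exact sub_eq_zero.1 hn

theorem IsArgChoice.hasFDerivAt_coeffSeries (hθ : IsArgChoice W θ) (hW : IsOpen W)
    (hWU : W ⊆ regionU v T c) (hc : IsConvergenceShift v T c)
    (hT : IsRegularTriangulation v T) (hgen : AddSubgroup.closure (Set.range v) = ⊤)
    (hαm : supp α ∪ supp m ∈ T) (u : N) {x : Fin k → ℂ} (hx : x ∈ W) :
    HasFDerivAt (fun x => coeffSeries v β α m u (logVec θ x))
      (∑ j, coeffSeries v β α m (u + v j) (logVec θ x) •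
        (ContinuousLinearMap.proj j : (Fin k → ℂ) →L[ℂ] ℂ)) x := by
  have h0 : ∀ x ∈ W, ∀ i, x i ≠ 0 := fun x hx => (hWU hx).1
  have hlog : HasFDerivAt (logVec θ) (ContinuousLinearMap.pi fun i =>
      (x i)⁻¹ • (ContinuousLinearMap.proj i : (Fin k → ℂ) →L[ℂ] ℂ)) x :=
    hasFDerivAt_pi.2 fun i => hθ.hasFDerivAt_logVec hW h0 hx i
  refine ((hc.hasFDerivAt hT hgen hαm u (logVec_mem_regionLog (hWU hx))).comp x hlog).congr_fderiv
    ?_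
  ext e
  simp only [ContinuousLinearMap.coe_comp, Function.comp_apply, sum_apply, smul_apply,
    ContinuousLinearMap.proj_apply, ContinuousLinearMap.pi_apply,
    smul_eq_mul]
  refine Finset.sum_congr rfl fun j _ => ?_
  rw [hθ.exp_logVec hx (h0 x hx)]
  field_simp [h0 x hx j]

end

section

variable {N : Type*} [AddCommGroup N] {k : ℕ}
variable {v : Fin k → N} {T : Set (Finset (Fin k))} {c : Fin k → ℝ}
variable {β : ℂ ⊗[ℤ] N} {δ : ℝ} {α : Fin k → ℂ} {m : Fin k → ℕ}

/-! ### The support of the `Γ`-series -/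

theorem IsAdmissible.supp_coord (hδ : IsAdmissible v T β δ)
    {w : basisSet v T (betaDelta β δ)} (hα : α ∈ Bx v T β)
    (h : coord v T w = alphaDelta δ α + natVec m) : supp (coord v T w) = supp α ∪ supp m := by
  rw [h, supp_add_of_nonneg (fun i => (alphaDelta_mem δ α i).1) (natVec_nonneg m)]
  congr 1
  · ext i
    rw [mem_supp, mem_supp, not_iff_not]
    exact hδ.support_eq α hα i
  · ext i
    simp [natVec]

theorem IsAdmissible.supp_union_mem (hT : IsRegularTriangulation v T)
    (hδ : IsAdmissible v T β δ) {w : basisSet v T (betaDelta β δ)} (hα : α ∈ Bx v T β)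
    (h : coord v T w = alphaDelta δ α + natVec m) : supp α ∪ supp m ∈ T := by
  rw [← hδ.supp_coord hα h]
  exact (hT.coord_spec w).1.supp_mem

theorem IsConvergenceShift.summable_gammaTerm (hc : IsConvergenceShift v T c)
    (hT : IsRegularTriangulation v T) (hδ : IsAdmissible v T β δ) (hα : α ∈ Bx v T β) (u : N)
    {y : Fin k → ℂ} (hy : y ∈ regionLog v T c) (w : basisSet v T (betaDelta β δ)) :
    Summable fun l : setL v β α u =>
      gammaTerm v T (betaDelta β δ) (boxPoint v δ α) l y w := by
  by_cases h : ∃ m : Fin k → ℕ, coord v T w = alphaDelta δ α + natVec m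
  · obtain ⟨m, hm⟩ := h
    exact (hc.summable (hδ.supp_union_mem hT hα hm) u hy).congr fun l =>
      (gammaTerm_of_eq hT hδ hα _ y hm).symm
  · push Not at h
    exact summable_zero.congr fun l => (gammaTerm_of_ne hT hα _ y h).symm

/-- If `[w]` occurs in the `Γ`-series, some exponent `l` has nonnegative integral entries outside
of the support of `w`. As `Re β = u + ∑ Re l_i v_i`, one can move from `w` in the direction of
`Re β`. -/
theorem mem_shadowSet_of_gammaSeries_ne_zero (hT : IsRegularTriangulation v T)
    (hδ : IsAdmissible v T β δ) {u : N} (hu : emb ℝ u ∈ coneK v) {y : Fin k → ℂ}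
    {w : basisSet v T (betaDelta β δ)} (hw : gammaSeries v T β δ u y w ≠ 0) :
    w ∈ shadowSet v T (betaDelta β δ) (rePart β) := by
  obtain ⟨α, hα, hm⟩ := hδ.exists_box hT w
  set m := multiplicity v T w
  rw [gammaSeries_eq_coeffSeries hT hδ hα u y hm, coeffSeries] at hw
  obtain ⟨l, hl⟩ : ∃ l : setL v β α u, ∏ i, taylorCoeff (l.1 i) (y i) (m i) ≠ 0 := by
    by_contra! h
    exact hw (by simp [h])
  obtain ⟨hcoord, hwpt⟩ := hT.coord_spec w
  have hRe : rePart β = emb ℝ u + pt v fun i => (l.1 i).re := by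
    have := congrArg rePart l.2.1
    rw [rePart_sum_smul, map_sub, rePart_emb] at this
    rw [this]; abel
  have hpos : ∀ᶠ ε : ℝ in nhdsWithin 0 (Set.Ioi 0), ∀ i,
      0 ≤ coord v T w i + ε * (l.1 i).re := by
    refine Filter.eventually_all.2 fun i => ?_
    rcases (hcoord.nonneg i).eq_or_lt with h0 | h0
    · have hi : i ∉ supp α ∪ supp m := by
        rw [← hδ.supp_coord hα hm, notMem_supp]; exact h0.symm
      rw [Finset.mem_union, not_or, notMem_supp, notMem_supp] at hi
      obtain ⟨z, hz⟩ := l.2.2 i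
      rw [hi.1, sub_zero] at hz
      have hz0 : 0 ≤ z := by
        by_contra! hlt
        refine hl (Finset.prod_eq_zero (Finset.mem_univ i) ?_)
        rw [hi.2]
        exact taylorCoeff_zero_of_neg _ hz hlt
      filter_upwards [self_mem_nhdsWithin] with ε hε
      rw [← h0, zero_add, hz, Complex.intCast_re]
      exact mul_nonneg (le_of_lt hε) (by exact_mod_cast hz0)
    · have : Filter.Tendsto (fun ε : ℝ => coord v T w i + ε * (l.1 i).re) (nhds 0)
          (nhds (coord v T w i + 0 * (l.1 i).re)) := Continuous.tendsto (by fun_prop) 0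
      rw [zero_mul, add_zero] at this
      exact ((this.mono_left nhdsWithin_le_nhds).eventually (lt_mem_nhds h0)).mono
        fun ε hε => hε.le
  rw [mem_shadowSet_iff hT]
  filter_upwards [hpos, self_mem_nhdsWithin] with ε hε hε0
  rw [← hT.mem_coneK, hwpt, hRe, smul_add, ← pt_smul, add_left_comm, ← pt_add]
  exact cone_add (smul_mem_coneK (le_of_lt hε0) hu) (pt_mem_coneK hε)

/-! ### The better behaved GKZ equations -/

section Functional

variable [Module.Free ℤ N] [Module.Finite ℤ N] {χ ξ : ℝ ⊗[ℤ] N} {d : ℕ}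
  {g : Module.Basis (Fin d) ℤ (N →ₗ[ℤ] ℤ)}

/-- The finitely many basis elements of degree at most `k`. -/
def lowDegree (hT : IsRegularTriangulation v T) (χ : ℝ ⊗[ℤ] N) : Finset (basisSet v T χ) :=
  (finite_coord_sum_le hT χ k).toFinset

theorem mem_lowDegree (hT : IsRegularTriangulation v T) {w : basisSet v T χ} :
    w ∈ lowDegree hT χ ↔ ∑ i, coord v T w i ≤ k := by
  simp [lowDegree]

theorem mem_lowDegree_of_basisValue_ne_zero (hT : IsRegularTriangulation v T)
    (hgen : AddSubgroup.closure (Set.range v) = ⊤) {h : ShadowQuot v T χ ξ g →ₗ[ℂ] ℂ}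
    {w : basisSet v T χ} (hw : basisValue v T χ ξ g h w ≠ 0) : w ∈ lowDegree hT χ := by
  rw [mem_lowDegree]
  by_contra! hlt
  apply hw
  rw [basisValue]
  split_ifs with hs
  · rw [shadowClass_eq_zero hT hgen g ⟨w, hs⟩ hlt, map_zero]
  · rfl

theorem applyHat_eq_sum (hT : IsRegularTriangulation v T)
    (hgen : AddSubgroup.closure (Set.range v) = ⊤) (h : ShadowQuot v T χ ξ g →ₗ[ℂ] ℂ)
    (F : DModHat v T χ) : applyHat v T χ ξ g h F =
      ∑ w ∈ lowDegree hT χ, F w * basisValue v T χ ξ g h w := by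
  have h1 : applyHat v T χ ξ g h F =
      ∑ᶠ w : shadowSet v T χ ξ, F w * basisValue v T χ ξ g h w := by
    refine finsum_congr fun w => ?_
    rw [basisValue, dif_pos w.2]
  rw [h1, finsum_set_coe_eq_finsum_mem (shadowSet v T χ ξ)
    (f := fun w => F w * basisValue v T χ ξ g h w)]
  rw [← finsum_eq_sum_of_support_subset]
  · refine finsum_congr fun w => ?_
    by_cases hw : w ∈ shadowSet v T χ ξ
    · simp [hw]
    · simp [hw, basisValue]
  · intro w hw
    exact mem_lowDegree_of_basisValue_ne_zero hT hgen (right_ne_zero_of_mul hw)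

/-- The series with lowered exponents are the coefficients of `[v_i] · Φ`. -/
theorem sum_coeffSeriesPred_mul_basisValue (hT : IsRegularTriangulation v T)
    (hgen : AddSubgroup.closure (Set.range v) = ⊤) (hδ : IsAdmissible v T β δ)
    (h : ShadowQuot v T (betaDelta β δ) ξ g →ₗ[ℂ] ℂ)
    (a : basisSet v T (betaDelta β δ) → Fin k → ℂ) (ha : ∀ w, a w ∈ Bx v T β)
    (hm : ∀ w : basisSet v T (betaDelta β δ),
      coord v T w = alphaDelta δ (a w) + natVec (multiplicity v T w))
    (u : N) (y : Fin k → ℂ) (i : Fin k) :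
    ∑ w ∈ lowDegree hT (betaDelta β δ), coeffSeriesPred v β (a w) (multiplicity v T w) u y i *
        basisValue v T (betaDelta β δ) ξ g h w =
      ∑ w ∈ lowDegree hT (betaDelta β δ), gammaSeries v T β δ u y w *
        Finsupp.linearCombination ℂ (basisValue v T (betaDelta β δ) ξ g h)
          (opD v T (betaDelta β δ) i (Finsupp.single w 1)) := by
  have hex : ∀ w : basisSet v T (betaDelta β δ), ∃ w' : basisSet v T (betaDelta β δ),
      multiplicity v T w i ≠ 0 → coord v T w = coord v T w' + natVec (Pi.single i 1) ∧
        coord v T w' = alphaDelta δ (a w) + natVec (multiplicity v T w - Pi.single i 1) := by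
    intro w
    by_cases h0 : multiplicity v T w i = 0
    · exact ⟨w, fun h => absurd h0 h⟩
    have hsplit : multiplicity v T w = (multiplicity v T w - Pi.single i 1) + Pi.single i 1 := by
      funext j
      by_cases hj : j = i
      · subst hj; simp; omega
      · simp [hj]
    set p := multiplicity v T w - Pi.single i 1 with hp
    have hadd : coord v T w =
        (alphaDelta δ (a w) + natVec p) + natVec (Pi.single i 1) := by
      rw [add_assoc, ← natVec_add, ← hsplit]; exact hm w
    have hnn : ∀ j, 0 ≤ (alphaDelta δ (a w) + natVec p) j := fun j =>
      add_nonneg (alphaDelta_mem δ _ j).1 (natVec_nonneg p j)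
    obtain ⟨w', hw'⟩ := hT.exists_coord_eq w (a := alphaDelta δ (a w) + natVec p)
      (z := -Pi.single i 1) (hT.isFanCoord hnn (hT.coord_spec w).1.supp_mem (by
        rw [hadd, supp_add_of_nonneg hnn (natVec_nonneg _)]
        exact Finset.subset_union_left)) (by
      rw [hadd, natVec_single, add_assoc (alphaDelta δ (a w) + natVec p)]
      convert (add_zero _).symm using 2
      funext j
      by_cases hj : j = i
      · subst hj; simp
      · simp [hj])
    exact ⟨w', fun _ => ⟨by rw [hw']; exact hadd, hw'⟩⟩
  choose σ hσ using hex
  have hne : ∀ w : basisSet v T (betaDelta β δ), coeffSeriesPred v β (a w) (multiplicity v T w) u y i *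
      basisValue v T (betaDelta β δ) ξ g h w ≠ 0 → multiplicity v T w i ≠ 0 := by
    intro w hw h0
    apply hw
    rw [coeffSeriesPred, if_pos h0, zero_mul]
  have hval : ∀ w : basisSet v T (betaDelta β δ), multiplicity v T w i ≠ 0 →
      coeffSeriesPred v β (a w) (multiplicity v T w) u y i *
        basisValue v T (betaDelta β δ) ξ g h w =
      gammaSeries v T β δ u y (σ w) *
        Finsupp.linearCombination ℂ (basisValue v T (betaDelta β δ) ξ g h)
          (opD v T (betaDelta β δ) i (Finsupp.single (σ w) 1)) := by
    intro w h0
    rw [coeffSeriesPred, if_neg h0, gammaSeries_eq_coeffSeries hT hδ (ha w) u y (hσ w h0).2,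
      (isShift_opD hT i).of_eq (σ w) w (hσ w h0).1, Finsupp.linearCombination_single, one_smul]
  have hdegree : ∀ w w' : basisSet v T (betaDelta β δ),
      coord v T w = coord v T w' + natVec (Pi.single i 1) → w ∈ lowDegree hT (betaDelta β δ) →
        w' ∈ lowDegree hT (betaDelta β δ) := by
    intro w w' hww' hw
    rw [mem_lowDegree] at hw ⊢
    refine le_trans (Finset.sum_le_sum fun j _ => ?_) hw
    rw [hww', Pi.add_apply]
    linarith [natVec_nonneg (Pi.single i 1 : Fin k → ℕ) j]
  refine Finset.sum_bij_ne_zero (fun w _ _ => σ w) ?_ ?_ ?_ ?_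
  · intro w hw h0
    exact hdegree w _ (hσ w (hne w h0)).1 hw
  · intro w₁ _ h1 w₂ _ h2 heq
    refine hT.coord_injective ?_
    rw [(hσ w₁ (hne w₁ h1)).1, (hσ w₂ (hne w₂ h2)).1, heq]
  · intro w' _ h'
    by_cases hu : ∃ w : basisSet v T (betaDelta β δ),
        coord v T w = coord v T w' + natVec (Pi.single i 1)
    · obtain ⟨w, hw⟩ := hu
      have h0 : multiplicity v T w i ≠ 0 := by
        rw [multiplicity, ← Nat.pos_iff_ne_zero, Nat.floor_pos, hw, natVec_single]
        simpa using (hT.coord_spec w').1.nonneg i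
      have hσw : σ w = w' := hT.coord_injective (by
        have := (hσ w h0).1
        rw [hw] at this
        exact (add_right_cancel this).symm)
      have hnz : coeffSeriesPred v β (a w) (multiplicity v T w) u y i *
          basisValue v T (betaDelta β δ) ξ g h w ≠ 0 := by rw [hval w h0, hσw]; exact h'
      exact ⟨w, mem_lowDegree_of_basisValue_ne_zero hT hgen (right_ne_zero_of_mul hnz), hnz, hσw⟩
    · rw [(isShift_opD hT i).of_not w' hu, map_zero, mul_zero] at h'
      exact absurd rfl h'
  · intro w _ h0
    exact hval w (hne w h0)

/-- The functional kills the multiples of the `Z_j`, hence the defect of the Euler equations. -/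
theorem sum_defect_eq_zero (hT : IsRegularTriangulation v T)
    (hgen : AddSubgroup.closure (Set.range v) = ⊤) (hδ : IsAdmissible v T β δ)
    (h : ShadowQuot v T (betaDelta β δ) (rePart β) g →ₗ[ℂ] ℂ)
    (a : basisSet v T (betaDelta β δ) → Fin k → ℂ) (ha : ∀ w, a w ∈ Bx v T β)
    (hm : ∀ w : basisSet v T (betaDelta β δ),
      coord v T w = alphaDelta δ (a w) + natVec (multiplicity v T w))
    {u : N} (hu : emb ℝ u ∈ coneK v) (y : Fin k → ℂ) (f : N →ₗ[ℤ] ℤ) :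
    ∑ w ∈ lowDegree hT (betaDelta β δ),
      (∑ i, (f (v i) : ℂ) * coeffSeriesPred v β (a w) (multiplicity v T w) u y i) *
        basisValue v T (betaDelta β δ) (rePart β) g h w = 0 := by
  obtain ⟨c, hc⟩ := exists_combination_of_dual_basis g (extR f)
  have hf : ∀ i, (f (v i) : ℂ) = ∑ j, (c j : ℂ) * (g j (v i) : ℂ) := by
    intro i
    have := hc (v i)
    rw [extR_emb] at this
    exact_mod_cast congrArg (fun r : ℝ => (r : ℂ)) this
  simp only [Finset.sum_mul, mul_assoc]
  rw [Finset.sum_comm]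
  simp only [← Finset.mul_sum, sum_coeffSeriesPred_mul_basisValue hT hgen hδ h a ha hm u y]
  simp only [Finset.mul_sum]
  rw [Finset.sum_comm]
  refine Finset.sum_eq_zero fun w _ => ?_
  by_cases hw : gammaSeries v T β δ u y w = 0
  · simp [hw]
  have hmem := mem_shadowSet_of_gammaSeries_ne_zero hT hδ hu hw
  have hZ := linearCombination_basisValue_of_mem_zSpan hT g h
    (sum_smul_opD_mem_zSpan (v := v) (T := T) g (fun j => (c j : ℂ)) _ hf hmem)
  rw [map_sum] at hZ
  simp only [map_smul, smul_eq_mul] at hZ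
  rw [← mul_zero (gammaSeries v T β δ u y w), ← hZ, Finset.mul_sum]
  exact Finset.sum_congr rfl fun i _ => by ring

theorem isSolution_applyHat (hT : IsRegularTriangulation v T)
    (hgen : AddSubgroup.closure (Set.range v) = ⊤) (hc : IsConvergenceShift v T c)
    (hδ : IsAdmissible v T β δ) {W : Set (Fin k → ℂ)} (hW : IsOpen W) (hWU : W ⊆ regionU v T c)
    {θ : (Fin k → ℂ) → Fin k → ℝ} (hθ : IsArgChoice W θ)
    (h : ShadowQuot v T (betaDelta β δ) (rePart β) g →ₗ[ℂ] ℂ) :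
    IsSolution v β W fun u x => applyHat v T (betaDelta β δ) (rePart β) g h
      (gammaSeries v T β δ u (logVec θ x)) := by
  choose a ha hm using hδ.exists_box hT
  have hsupp := fun w => hδ.supp_union_mem hT (ha w) (hm w)
  have hF : ∀ (u : N) (x : Fin k → ℂ), applyHat v T (betaDelta β δ) (rePart β) g h
      (gammaSeries v T β δ u (logVec θ x)) = ∑ w ∈ lowDegree hT (betaDelta β δ),
        coeffSeries v β (a w) (multiplicity v T w) u (logVec θ x) *
          basisValue v T (betaDelta β δ) (rePart β) g h w := by
    intro u x
    rw [applyHat_eq_sum hT hgen]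
    exact Finset.sum_congr rfl fun w _ => by
      rw [gammaSeries_eq_coeffSeries hT hδ (ha w) u _ (hm w)]
  have hder : ∀ (u : N), ∀ x ∈ W, HasFDerivAt (fun x => ∑ w ∈ lowDegree hT (betaDelta β δ),
      coeffSeries v β (a w) (multiplicity v T w) u (logVec θ x) *
        basisValue v T (betaDelta β δ) (rePart β) g h w)
      (∑ w ∈ lowDegree hT (betaDelta β δ), basisValue v T (betaDelta β δ) (rePart β) g h w •
        ∑ j, coeffSeries v β (a w) (multiplicity v T w) (u + v j) (logVec θ x) •
          (ContinuousLinearMap.proj j : (Fin k → ℂ) →L[ℂ] ℂ)) x := fun u x hx =>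
    HasFDerivAt.fun_sum fun w _ =>
      (hθ.hasFDerivAt_coeffSeries hW hWU hc hT hgen (hsupp w) u hx).mul_const _
  have hpartial : ∀ (u : N), ∀ x ∈ W, ∀ i, partialD i (fun x =>
      ∑ w ∈ lowDegree hT (betaDelta β δ),
        coeffSeries v β (a w) (multiplicity v T w) u (logVec θ x) *
          basisValue v T (betaDelta β δ) (rePart β) g h w) x =
      ∑ w ∈ lowDegree hT (betaDelta β δ),
        coeffSeries v β (a w) (multiplicity v T w) (u + v i) (logVec θ x) *
          basisValue v T (betaDelta β δ) (rePart β) g h w := by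
    intro u x hx i
    rw [partialD, (hder u x hx).fderiv]
    simp [Pi.single_apply, mul_comm]
  intro u hu
  simp only [hF]
  refine ⟨fun x hx => (hder u x hx).differentiableAt.differentiableWithinAt,
    fun x hx i => hpartial u x hx i, fun x hx f => ?_⟩
  simp only [hpartial u x hx]
  have hy : logVec θ x ∈ regionLog v T c := logVec_mem_regionLog (hWU hx)
  have heuler := fun w => hc.euler (β := β) hT (hsupp w) u hy f
  simp only [hθ.exp_logVec hx (hWU hx).1] at heuler
  calc ∑ i, (f (v i) : ℂ) * x i * ∑ w ∈ lowDegree hT (betaDelta β δ),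
        coeffSeries v β (a w) (multiplicity v T w) (u + v i) (logVec θ x) *
          basisValue v T (betaDelta β δ) (rePart β) g h w
      = ∑ w ∈ lowDegree hT (betaDelta β δ), (∑ i, (f (v i) : ℂ) *
          (x i * coeffSeries v β (a w) (multiplicity v T w) (u + v i) (logVec θ x))) *
            basisValue v T (betaDelta β δ) (rePart β) g h w := by
        simp only [Finset.mul_sum, Finset.sum_mul]
        rw [Finset.sum_comm]
        exact Finset.sum_congr rfl fun w _ => Finset.sum_congr rfl fun i _ => by ring
    _ = extC f (β - emb ℂ u) * ∑ w ∈ lowDegree hT (betaDelta β δ),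
          coeffSeries v β (a w) (multiplicity v T w) u (logVec θ x) *
            basisValue v T (betaDelta β δ) (rePart β) g h w := by
        simp only [heuler, add_mul, Finset.sum_add_distrib]
        rw [sum_defect_eq_zero hT hgen hδ h a ha hm hu, add_zero, Finset.mul_sum]
        exact Finset.sum_congr rfl fun w _ => by ring

end Functional

end

end BBGKZ

end

theorem mainTheorem3 {N : Type*} [AddCommGroup N] [Module.Free ℤ N] [Module.Finite ℤ N]
    {k : ℕ} (v : Fin k → N) (hinj : Function.Injective v)
    (hgen : AddSubgroup.closure (Set.range v) = ⊤)
    (hdeg : ∃ deg : N →+ ℤ, ∀ i, deg (v i) = 1)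
    (T : Set (Finset (Fin k))) (hT : BBGKZ.IsRegularTriangulation v T) :
    ∃ c : Fin k → ℝ, IsOpen (BBGKZ.regionU v T c) ∧ (BBGKZ.regionU v T c).Nonempty ∧
      ∀ β : TensorProduct ℤ ℂ N,
        (∀ᶠ δ : ℝ in nhdsWithin 0 (Set.Ioi 0), BBGKZ.IsAdmissible v T β δ) ∧
        ∀ δ : ℝ, BBGKZ.IsAdmissible v T β δ →
        ∀ (d : ℕ) (g : Module.Basis (Fin d) ℤ (N →ₗ[ℤ] ℤ)),
        ∀ W : Set (Fin k → ℂ), IsOpen W → W ⊆ BBGKZ.regionU v T c →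
        ∀ θ : (Fin k → ℂ) → Fin k → ℝ, BBGKZ.IsArgChoice W θ →
          -- the series converge, and take values in the completion of the shadow module
          (∀ u : N, BBGKZ.emb ℝ u ∈ BBGKZ.coneK v → ∀ x ∈ W,
            ∀ w : BBGKZ.basisSet v T (BBGKZ.betaDelta β δ),
              (∀ α ∈ BBGKZ.Bx v T β, Summable fun l : BBGKZ.setL v β α u =>
                BBGKZ.gammaTerm v T (BBGKZ.betaDelta β δ) (BBGKZ.boxPoint v δ α) l
                  (BBGKZ.logVec θ x) w) ∧
              (BBGKZ.gammaSeries v T β δ u (BBGKZ.logVec θ x) w ≠ 0 →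
                w ∈ BBGKZ.shadowSet v T (BBGKZ.betaDelta β δ) (BBGKZ.rePart β))) ∧
          -- and their images under any linear functional on the quotient form a solution
          ∀ h : BBGKZ.ShadowQuot v T (BBGKZ.betaDelta β δ) (BBGKZ.rePart β) g →ₗ[ℂ] ℂ,
            {w | h (BBGKZ.shadowClass v T (BBGKZ.betaDelta β δ) (BBGKZ.rePart β) g w) ≠
              0}.Finite ∧
            BBGKZ.IsSolution v β W fun u x =>
              BBGKZ.applyHat v T (BBGKZ.betaDelta β δ) (BBGKZ.rePart β) g h
                (BBGKZ.gammaSeries v T β δ u (BBGKZ.logVec θ x)) := by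

  obtain ⟨c, hc⟩ := BBGKZ.exists_isConvergenceShift hT hgen hdeg
  refine ⟨c, BBGKZ.isOpen_regionU hT hgen c, BBGKZ.regionU_nonempty hT c, fun β =>
    ⟨BBGKZ.eventually_isAdmissible hT hgen β, fun δ hδ d g W hW hWU θ hθ =>
      ⟨fun u hu x hx w => ⟨fun α hα => ?_, BBGKZ.mem_shadowSet_of_gammaSeries_ne_zero hT hδ hu⟩,
        fun h => ⟨BBGKZ.finite_ne_zero hT hgen g h,
          BBGKZ.isSolution_applyHat hT hgen hc hδ hW hWU hθ h⟩⟩⟩⟩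
  exact hc.summable_gammaTerm hT hδ hα u (BBGKZ.logVec_mem_regionLog (hWU hx)) w
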